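/- Let $C$ be a field of characteristic zero, $\bar C\supseteq C$ an algebraically closed field, and for $\alpha\in\bar C$ put $\bar C[[[x-\alpha]]]=\bigcup_{\nu\in C}(x-\alpha)^\nu\bar C[[x-\alpha]][\log(x-\alpha)]$. Let $\iota\colon C/\mathbb Z\times\mathbb N\to C$ satisfy $\iota(\nu+\mathbb Z,j)\in\nu+\mathbb Z$, $\ \iota(\nu_1+\mathbb Z,j_1)+\iota(\nu_2+\mathbb Z,j_2)-\iota(\nu_1+\nu_2+\mathbb Z,j_1+j_2)\in\mathbb N$ and $\iota(\mathbb Z,0)=0$ (here $0\in\mathbb N$). A series (a $\bar C$-linear combination of elements of $\bar C[[[x-\alpha]]]$) is called integral if $\mu-\iota(\mu+\mathbb Z,j)\in\mathbb N$ for every term $(x-\alpha)^\mu\log(x-\alpha)^j$ occurring in it. Let $L=\ell_0+\cdots+\ell_rD^r\in C[x][D]$, $r\ge1$, $\ell_r\ne0$, be regular, i.e. for every $\alpha\in\bar C$ it has a fundamental system at $\alpha$: $r$ solutions in $\bar C[[[x-\alpha]]]$ that are linearly independent over $\bar C$. An element $A\in\bar C(x)[D]/\langle L\rangle$, where $\langle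 L\rangle=\bar C(x)[D]L$, is integral ($A\in\mathcal O_L$) if $A\cdot f$ is integral for every $\alpha\in\bar C$ and every solution $f\in\bar C[[[x-\alpha]]]$ of $L$. For a fundamental system $b_1,\dots,b_r$ at $\alpha$ let $\operatorname{wr}_{L,\alpha}(B_0,\dots,B_{r-1})=\det(B_i\cdot b_j)$ (it depends on the choice of the $b_j$ only up to a nonzero constant factor). Consider the following algorithm. Let $s$ be the squarefree part of $\ell_r$. Set $B_0=\prod_\alpha(x-\alpha)^{e_\alpha}$, where $\alpha$ runs over the roots of $\ell_r$ in $\bar C$ and $e_\alpha$ is the smallest integer such that $(x-\alpha)^{e_\alpha}b$ is integral for all elements $b$ of a fundamental system at $\alpha$, and initialize $B_i=s^iD^iB_0$ for $1\le i<r$. For $d=1,\dots,r-1$: set $B_d=s\,D\,B_{d-1}$; then, as long as the set $$E=\{A\in\mathcal O_L:\operatorname{ord}(A)\le d\}\setminus(\bar C[x]B_0+\cdots+\bar C[x]B_d)$$ is not empty, choose some $A\in E$ of the form $A=\frac1p(a_0B_0+\cdots+a_{d-1}B_{d-1}+B_d)$ with $a_0,\dots,a_{d-1},p\in C[x]$,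 $p\neq0$, and replace $B_d$ by $A$ (an "update" with denominator $p$). Finally return $B_0,\dots,B_{r-1}$. **Theorem.** This algorithm terminates: for all choices made on the way, it never gets stuck (the $e_\alpha$ exist, and an $A$ of the required form exists whenever $E\ne\emptyset$), and it returns after finitely many steps. Moreover: 1. At every time, $B_0,\dots,B_{r-1}$ are integral, and for every $\alpha\in\bar C$ the generalized Wronskian $W=\operatorname{wr}_{L,\alpha}(B_0,\dots,B_{r-1})$ is integral, nonzero and hyperexponential ($W'=gW$ with a rational function $g\in\bar C(x)$ that does not depend on $\alpha$), and it has no logarithmic terms. Hence there is a smallest $m_\alpha\in\mathbb N$ such that $(x-\alpha)^{\mu}$ with $\mu=\iota(\mu+\mathbb Z,0)+m_\alpha$ occurs in $W$ for some $\mu$. 2. In each update, $p$ is not constant, $\operatorname{wr}_{L,\alpha}(B_0,\dots,B_{r-1})$ is divided by $p$, and $m_\alpha$ decreases exactly by the multiplicity of $\alpha$ as a root of $p$, for every $\alpha\in\bar C$. If $Q\subseteq\bar C$ is a set consisting of exactly one root of each irreducible factor of $\ell_r$ in $C[x]$, then the nonnegative integer $\sum_{\alpha\in Q}m_\alpha$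 strictly decreases in each update. 3. When $B_d$ is set to $s\,D\,B_{d-1}$, none of the $m_\alpha$ increases. -/

import Mathlib

open Polynomial

namespace IntegralBasis

noncomputable section

/-! ### Exponents and generalized series -/

/-- The field `F`, regarded as the group of exponents of generalized series.  It is ordered by
`μ ≤ ν` iff `ν - μ` is a nonnegative integer. -/
def Expo (F : Type*) : Type _ := F

instance {F : Type*} [Field F] : AddCommGroup (Expo F) := inferInstanceAs (AddCommGroup F)

/-- Exponents as elements of the field. -/
def Expo.val {F : Type*} (μ : Expo F) : F := μ

/-- Elements of the field as exponents. -/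
def Expo.of {F : Type*} (μ : F) : Expo F := μ

instance {F : Type*} [Field F] [CharZero F] : PartialOrder (Expo F) where
  le μ ν := ∃ n : ℕ, ν.val = μ.val + n
  le_refl μ := ⟨0, by simp⟩
  le_trans a b c := by
    rintro ⟨m, hm⟩ ⟨n, hn⟩
    exact ⟨m + n, by rw [hn, hm]; push_cast; ring⟩
  le_antisymm a b := by
    rintro ⟨m, hm⟩ ⟨n, hn⟩
    have h : ((m + n : ℕ) : F) = 0 := by
      rw [hm] at hn
      push_cast
      linear_combination -hn
    have h0 : m = 0 := by
      have := Nat.cast_eq_zero.mp h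
      omega
    subst h0
    have hb : b.val = a.val := by simpa using hm
    exact hb.symm

theorem Expo.le_def {F : Type*} [Field F] [CharZero F] (μ ν : Expo F) :
    μ ≤ ν ↔ ∃ n : ℕ, ν.val = μ.val + n := Iff.rfl

instance {F : Type*} [Field F] [CharZero F] : IsOrderedCancelAddMonoid (Expo F) where
  add_le_add_left a b := by
    rintro ⟨n, hn⟩ c
    refine ⟨n, ?_⟩
    change b.val + c.val = a.val + c.val + n
    rw [hn]; ring
  le_of_add_le_add_left a b c := by
    rintro ⟨n, hn⟩
    refine ⟨n, ?_⟩
    change a.val + c.val = a.val + b.val + n at hn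
    linear_combination hn

/-- The ring of all `K`-linear combinations of elements of the sets
`(x - α)^ν K[[x - α]][log (x - α)]` with `ν ∈ F`.  A subset of `Expo F` is partially well-ordered
iff it is contained in a finite union of sets `ν + ℕ`, so a Hahn series over `Expo F` is a
`K`-linear combination of elements of the `(x - α)^ν K[[x - α]]`; the polynomial variable stands
for `log (x - α)`. -/
abbrev LogSeries (F K : Type*) [Field F] [CharZero F] [Field K] : Type _ :=
  Polynomial (HahnSeries (Expo F) K)

section Series

set_option linter.unusedSectionVars false

variable {F K : Type*} [Field F] [CharZero F] [Field K]

/-- The coefficient of the term `(x - α)^μ log (x - α)^j`. -/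
def termCoeff (f : LogSeries F K) (μ : F) (j : ℕ) : K := (f.coeff j).coeff (Expo.of μ)

/-- Membership in `K[[[x - α]]] = ⋃_ν (x - α)^ν K[[x - α]][log (x - α)]`. -/
def IsPure (f : LogSeries F K) : Prop :=
  ∃ ν : F, ∀ (μ : F) (j : ℕ), termCoeff f μ j ≠ 0 → ∃ n : ℕ, μ = ν + n

variable [Algebra F K]

/-- The operator `t d/dt` on series in `t = x - α` without logarithms, as a linear map: the term
`t^μ` is multiplied by `μ`. -/
def thetaLin : HahnSeries (Expo F) K →ₗ[K] HahnSeries (Expo F) K where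
  toFun f :=
    { coeff := fun μ => algebraMap F K μ.val * f.coeff μ
      isPWO_support' := f.isPWO_support.mono fun μ h h0 => h (by simp [h0]) }
  map_add' f g := by
    ext μ
    simp [mul_add]
  map_smul' c f := by
    ext μ
    simp only [HahnSeries.coeff_smul, smul_eq_mul, RingHom.id_apply]
    ring

theorem coeff_thetaLin (f : HahnSeries (Expo F) K) (μ : Expo F) :
    (thetaLin f).coeff μ = algebraMap F K μ.val * f.coeff μ := rfl

theorem support_thetaLin (f : HahnSeries (Expo F) K) :
    (thetaLin f).support ⊆ f.support := by
  intro μ h h0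
  exact h (by rw [coeff_thetaLin, h0, mul_zero])

/-- The derivation `t d/dt` on series in `t = x - α` without logarithms. -/
def theta : Derivation K (HahnSeries (Expo F) K) (HahnSeries (Expo F) K) :=
  Derivation.mk' thetaLin (by
    intro f g
    ext μ
    rw [coeff_thetaLin, smul_eq_mul, smul_eq_mul, HahnSeries.coeff_add, mul_comm g,
      HahnSeries.coeff_mul, HahnSeries.coeff_mul_right' g.isPWO_support (support_thetaLin g),
      HahnSeries.coeff_mul_left' f.isPWO_support (support_thetaLin f), ← Finset.sum_add_distrib,
      Finset.mul_sum]
    refine Finset.sum_congr rfl fun ij hij => ?_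
    rw [coeff_thetaLin, coeff_thetaLin]
    have h : μ.val = ij.1.val + ij.2.val := (Finset.mem_antidiagonal.mp hij).2.2.symm
    rw [h, map_add]
    ring)

/-- The derivation `t d/dt` on the coefficients of the powers of the logarithm. -/
def thetaCoeffs : LogSeries F K →ₗ[K] LogSeries F K where
  toFun f := f.sum fun j a => Polynomial.monomial j (theta a)
  map_add' f g := Polynomial.sum_add_index f g _ (by simp) (by simp)
  map_smul' c f := by
    rw [Polynomial.sum_smul_index' f c _ (by simp)]
    simp only [Polynomial.sum_def, Finset.smul_sum, RingHom.id_apply,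
      Derivation.map_smul, Polynomial.smul_monomial]

theorem thetaCoeffs_monomial (j : ℕ) (a : HahnSeries (Expo F) K) :
    thetaCoeffs (Polynomial.monomial j a) = Polynomial.monomial j (theta a) := 
  Polynomial.sum_monomial_index (f := fun j a => Polynomial.monomial j (theta a)) a (by simp)

theorem coeff_thetaCoeffs (f : LogSeries F K) (j : ℕ) :
    (thetaCoeffs f).coeff j = theta (f.coeff j) := by
  induction f using Polynomial.induction_on' with
  | add p q hp hq => simp [hp, hq]
  | monomial n a =>
    rw [thetaCoeffs_monomial, Polynomial.coeff_monomial, Polynomial.coeff_monomial]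
    split_ifs <;> simp

theorem thetaCoeffs_mul (f g : LogSeries F K) :
    thetaCoeffs (f * g) = f * thetaCoeffs g + g * thetaCoeffs f := by
  induction f using Polynomial.induction_on' with
  | add p q hp hq => rw [add_mul, map_add, hp, hq, map_add]; ring
  | monomial n a =>
    induction g using Polynomial.induction_on' with
    | add p q hp hq => rw [mul_add, map_add, hp, hq, map_add]; ring
    | monomial m b =>
      simp only [Polynomial.monomial_mul_monomial, thetaCoeffs_monomial, Derivation.leibniz,
        smul_eq_mul, map_add, add_comm m n]

/-- The derivation `d/dx` on generalized series, namely `t⁻¹ (t d/dt + d/d(log t))` with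
`t = x - α`, where `t d/dt` leaves `log t` fixed. -/
def D : Derivation K (LogSeries F K) (LogSeries F K) :=
  Derivation.mk'
    { toFun := fun f => Polynomial.C (HahnSeries.single (Expo.of (-1 : F)) (1 : K)) *
        (thetaCoeffs f + Polynomial.derivative f)
      map_add' := fun f g => by simp only [map_add]; ring
      map_smul' := fun c f => by
        simp only [map_smul, Polynomial.derivative_smul, RingHom.id_apply, ← smul_add,
          mul_smul_comm] }
    (fun f g => by
      simp only [LinearMap.coe_mk, AddHom.coe_mk, thetaCoeffs_mul, Polynomial.derivative_mul,
        smul_eq_mul]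
      ring)

theorem D_apply (f : LogSeries F K) :
    D f = Polynomial.C (HahnSeries.single (Expo.of (-1 : F)) (1 : K)) *
      (thetaCoeffs f + Polynomial.derivative f) := rfl

/-- The integers as exponents. -/
def intExpo : ℤ →+ Expo F where
  toFun n := Expo.of (n : F)
  map_zero' := Int.cast_zero (R := F)
  map_add' := Int.cast_add (R := F)

theorem intExpo_injective : Function.Injective (intExpo : ℤ →+ Expo F) := fun _ _ h =>
  Int.cast_injective (α := F) h

theorem intExpo_le (m n : ℤ) : (intExpo m : Expo F) ≤ intExpo n ↔ m ≤ n := by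
  rw [Expo.le_def]
  change (∃ k : ℕ, (n : F) = (m : F) + (k : F)) ↔ _
  constructor
  · rintro ⟨k, hk⟩
    have : n = m + k := by exact_mod_cast hk
    omega
  · intro h
    obtain ⟨k, rfl⟩ := Int.le.dest h
    exact ⟨k, by push_cast; rfl⟩

/-- The Laurent series expansion at `α` of a polynomial in `x`. -/
def polyExpand (α : K) : K[X] →+* LaurentSeries K :=
  (HahnSeries.ofPowerSeries ℤ K).comp
    (Polynomial.coeToPowerSeries.ringHom.comp (Polynomial.taylorAlgHom α).toRingHom)

theorem polyExpand_injective (α : K) : Function.Injective (polyExpand α) :=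
  HahnSeries.ofPowerSeries_injective.comp
    ((Polynomial.coe_injective K).comp (Polynomial.taylor_injective α))

/-- The expansion at `α` of a rational function, as a generalized series in `x - α`. -/
def expand (α : K) : RatFunc K →+* LogSeries F K :=
  Polynomial.C.comp ((HahnSeries.embDomainRingHom (intExpo : ℤ →+ Expo F) intExpo_injective intExpo_le).comp
    (RatFunc.liftRingHom (polyExpand α)
      (nonZeroDivisors_le_comap_nonZeroDivisors_of_injective _ (polyExpand_injective α))))

theorem expand_polynomial (α : K) (p : K[X]) :
    (expand α (algebraMap K[X] (RatFunc K) p) : LogSeries F K) =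
      Polynomial.C (HahnSeries.embDomainRingHom (intExpo : ℤ →+ Expo F) intExpo_injective
        intExpo_le (polyExpand α p)) := by
  simp [expand, RatFunc.liftRingHom_apply]

theorem expand_C (α a : K) :
    (expand α (algebraMap K[X] (RatFunc K) (Polynomial.C a)) : LogSeries F K) =
      algebraMap K (LogSeries F K) a := by
  rw [expand_polynomial]
  have h : polyExpand α (Polynomial.C a) = HahnSeries.C a := by
    simp [polyExpand]
  rw [h, HahnSeries.embDomainRingHom_C]
  rfl

theorem expand_X (α : K) :
    (expand α (algebraMap K[X] (RatFunc K) Polynomial.X) : LogSeries F K) =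
      algebraMap K (LogSeries F K) α + Polynomial.C (HahnSeries.single (Expo.of (1 : F)) 1) := by
  have h : polyExpand α Polynomial.X = HahnSeries.single 1 1 + HahnSeries.C α := by
    simp [polyExpand]
  rw [expand_polynomial, h, map_add, HahnSeries.embDomainRingHom_C, map_add, add_comm]
  have h1 : (intExpo 1 : Expo F) = Expo.of 1 := Int.cast_one (R := F)
  rw [← h1]
  congr 2
  exact HahnSeries.embDomain_single

theorem D_single_one :
    D (Polynomial.C (HahnSeries.single (Expo.of (1 : F)) (1 : K)) : LogSeries F K) = 1 := by
  have h : theta (HahnSeries.single (Expo.of (1 : F)) (1 : K)) =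
      HahnSeries.single (Expo.of (1 : F)) (1 : K) := by
    ext μ
    change algebraMap F K μ.val * _ = _
    by_cases hμ : μ = Expo.of 1
    · subst hμ
      simp [Expo.val, Expo.of]
    · rw [HahnSeries.coeff_single_of_ne hμ, mul_zero]
  rw [D_apply, derivative_C, add_zero]
  simp only [← Polynomial.monomial_zero_left]
  rw [thetaCoeffs_monomial, h, Polynomial.monomial_mul_monomial, HahnSeries.single_mul_single, mul_one]
  have h0 : Expo.of (-1 : F) + Expo.of (1 : F) = 0 := neg_add_cancel (1 : F)
  rw [h0]
  rfl

theorem D_expand_polynomial (α : K) (p : K[X]) :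
    D (expand α (algebraMap K[X] (RatFunc K) p) : LogSeries F K) =
      expand α (algebraMap K[X] (RatFunc K) (derivative p)) := by
  induction p using Polynomial.induction_on with
  | C a => rw [expand_C, Derivation.map_algebraMap, derivative_C, map_zero, map_zero]
  | add p q hp hq => simp only [map_add, hp, hq]
  | monomial n a h =>
    rw [pow_succ, ← mul_assoc, map_mul, map_mul, Derivation.leibniz, h, expand_X, map_add,
      Derivation.map_algebraMap, D_single_one, zero_add, ← expand_X,
      derivative_mul (f := Polynomial.C a * Polynomial.X ^ n), derivative_X, mul_one, map_add,
      map_add, map_mul _ (derivative (Polynomial.C a * Polynomial.X ^ n)) Polynomial.X,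
      map_mul _ (algebraMap K[X] (RatFunc K) _) (algebraMap K[X] (RatFunc K) Polynomial.X),
      smul_eq_mul, smul_eq_mul, mul_one]
    ring

end Series

/-! ### Rational functions and differential operators -/

section Operators

variable {K : Type*} [Field K]

/-- The derivative of a rational function, by the quotient rule. -/
def ratDerivFun (f : RatFunc K) : RatFunc K :=
  (algebraMap K[X] (RatFunc K) (derivative f.num * f.denom - f.num * derivative f.denom)) /
    (algebraMap K[X] (RatFunc K) f.denom) ^ 2

theorem ratDerivFun_div (n d : K[X]) (hd : d ≠ 0) :
    ratDerivFun (algebraMap K[X] (RatFunc K) n / algebraMap K[X] (RatFunc K) d) =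
      (algebraMap K[X] (RatFunc K) (derivative n * d - n * derivative d)) /
        (algebraMap K[X] (RatFunc K) d) ^ 2 := by
  set f := algebraMap K[X] (RatFunc K) n / algebraMap K[X] (RatFunc K) d with hf
  have hD : algebraMap K[X] (RatFunc K) d ≠ 0 := RatFunc.algebraMap_ne_zero hd
  have hE : algebraMap K[X] (RatFunc K) f.denom ≠ 0 :=
    RatFunc.algebraMap_ne_zero f.denom_ne_zero
  have h1 : f.num * d = n * f.denom := by
    have h := f.num_div_denom
    rw [hf, div_eq_div_iff (hf ▸ hE) hD, ← hf, ← map_mul, ← map_mul] at h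
    exact RatFunc.algebraMap_injective K h
  have h2 := congrArg derivative h1
  rw [derivative_mul, derivative_mul] at h2
  rw [ratDerivFun, div_eq_div_iff (pow_ne_zero 2 hE) (pow_ne_zero 2 hD), ← map_pow, ← map_pow,
    ← map_mul, ← map_mul]
  congr 1
  linear_combination (f.denom * d) * h2 -
    (derivative d * f.denom + derivative f.denom * d) * h1

/-- The derivation `d/dx` on rational functions. -/
def ratDeriv : RatFunc K →+ RatFunc K where
  toFun := ratDerivFun
  map_zero' := by simp [ratDerivFun]
  map_add' f g := by
    induction f using RatFunc.induction_on with | f a b hb => ?_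
    induction g using RatFunc.induction_on with | f c d hd => ?_
    have hB : algebraMap K[X] (RatFunc K) b ≠ 0 := RatFunc.algebraMap_ne_zero hb
    have hD : algebraMap K[X] (RatFunc K) d ≠ 0 := RatFunc.algebraMap_ne_zero hd
    have h : algebraMap K[X] (RatFunc K) a / algebraMap K[X] (RatFunc K) b +
        algebraMap K[X] (RatFunc K) c / algebraMap K[X] (RatFunc K) d =
        algebraMap K[X] (RatFunc K) (a * d + b * c) / algebraMap K[X] (RatFunc K) (b * d) := by
      simp only [map_add, map_mul]
      field_simp
    rw [h, ratDerivFun_div _ _ (mul_ne_zero hb hd), ratDerivFun_div _ _ hb,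
      ratDerivFun_div _ _ hd]
    simp only [derivative_mul, map_add, map_mul, map_sub]
    field_simp
    ring

theorem ratDeriv_div (n d : K[X]) (hd : d ≠ 0) :
    ratDeriv (algebraMap K[X] (RatFunc K) n / algebraMap K[X] (RatFunc K) d) =
      (algebraMap K[X] (RatFunc K) (derivative n * d - n * derivative d)) /
        (algebraMap K[X] (RatFunc K) d) ^ 2 := ratDerivFun_div n d hd

theorem ratDeriv_mul (f g : RatFunc K) :
    ratDeriv (f * g) = f * ratDeriv g + g * ratDeriv f := by
  induction f using RatFunc.induction_on with | f a b hb => ?_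
  induction g using RatFunc.induction_on with | f c d hd => ?_
  have hB : algebraMap K[X] (RatFunc K) b ≠ 0 := RatFunc.algebraMap_ne_zero hb
  have hD : algebraMap K[X] (RatFunc K) d ≠ 0 := RatFunc.algebraMap_ne_zero hd
  rw [div_mul_div_comm, ← map_mul, ← map_mul, ratDeriv_div _ _ (mul_ne_zero hb hd),
    ratDeriv_div _ _ hb, ratDeriv_div _ _ hd]
  simp only [derivative_mul, map_add, map_mul, map_sub]
  field_simp
  ring

/-- Differential operators `∑ i, P i D^i` over `K(x)` are given by their coefficients `P`; this is
left multiplication by `D`, that is, `D (∑ i, P i D^i) = ∑ i, (P i)' D^i + ∑ i, P i D^(i+1)`. -/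
def dMul : (ℕ →₀ RatFunc K) →+ (ℕ →₀ RatFunc K) :=
  Finsupp.mapRange.addMonoidHom ratDeriv + Finsupp.mapDomain.addMonoidHom (fun i => i + 1)

theorem dMul_smul (c : RatFunc K) (P : ℕ →₀ RatFunc K) :
    dMul (c • P) = ratDeriv c • P + c • dMul P := by
  ext i
  simp only [dMul, AddMonoidHom.add_apply, Finsupp.mapRange.addMonoidHom_apply,
    Finsupp.mapDomain.addMonoidHom_apply, Finsupp.mapDomain_smul, Finsupp.add_apply,
    Finsupp.mapRange_apply, Finsupp.smul_apply, smul_eq_mul, ratDeriv_mul]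
  ring

end Operators

section Action

set_option linter.unusedSectionVars false

variable {F K : Type*} [Field F] [CharZero F] [Field K] [Algebra F K]

theorem D_expand (α : K) (c : RatFunc K) :
    D (expand α c : LogSeries F K) = expand α (ratDeriv c) := by
  induction c using RatFunc.induction_on with | f n d hd => ?_
  have hD : algebraMap K[X] (RatFunc K) d ≠ 0 := RatFunc.algebraMap_ne_zero hd
  have h1 := congrArg (D (F := F)) (congrArg (expand (F := F) α) (div_mul_cancel₀
    (algebraMap K[X] (RatFunc K) n) hD))
  rw [map_mul, Derivation.leibniz, D_expand_polynomial, D_expand_polynomial, smul_eq_mul,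
    smul_eq_mul, ← map_mul] at h1
  have h2 : (expand α (algebraMap K[X] (RatFunc K) d)⁻¹ : LogSeries F K) *
      expand α (algebraMap K[X] (RatFunc K) d) = 1 := by
    rw [← map_mul, inv_mul_cancel₀ hD, map_one]
  have h3 := congrArg (fun y : LogSeries F K =>
    expand α (algebraMap K[X] (RatFunc K) d)⁻¹ * y) (eq_sub_of_add_eq' h1)
  simp only [← mul_assoc, h2, one_mul] at h3
  rw [h3, ← map_sub, ← map_mul, ratDeriv_div n d hd]
  congr 1
  simp only [map_sub, map_mul]
  field_simp

/-- The action of an operator `P` on a series `f` in `x - α`, namely `P · f = ∑ i, P i * D^i f`, as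
a map which is semilinear in `P` with respect to the expansion of rational functions at `α`. -/
def act (α : K) (f : LogSeries F K) : (ℕ →₀ RatFunc K) →ₛₗ[expand (F := F) α] LogSeries F K where
  toFun P := P.sum fun i c => expand α c * D^[i] f
  map_add' P Q := Finsupp.sum_add_index' (by simp) (by intros; rw [map_add, add_mul])
  map_smul' c P := by
    rw [Finsupp.sum_smul_index (by simp), Finsupp.sum, Finsupp.sum, Finset.smul_sum]
    simp only [smul_eq_mul, map_mul, mul_assoc]

theorem act_single (α : K) (f : LogSeries F K) (i : ℕ) (c : RatFunc K) :
    act α f (Finsupp.single i c) = expand α c * D^[i] f :=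
  Finsupp.sum_single_index (h := fun i c => expand α c * D^[i] f) (by simp)

theorem act_dMul (α : K) (f : LogSeries F K) (P : ℕ →₀ RatFunc K) :
    act α f (dMul P) = D (act α f P) := by
  induction P using Finsupp.induction_linear with
  | zero => simp
  | add P Q hP hQ => simp only [map_add, hP, hQ]
  | single i c =>
    have h : dMul (Finsupp.single i c) =
        Finsupp.single i (ratDeriv c) + Finsupp.single (i + 1) c := by
      simp [dMul]
    rw [h, map_add, act_single, act_single, act_single, Derivation.leibniz, D_expand,
      Function.iterate_succ_apply', smul_eq_mul, smul_eq_mul]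
    ring

/-- The embedding of `F[x]` into `K(x)`. -/
def polyEmb (F K : Type*) [Field F] [Field K] [Algebra F K] : F[X] →+* RatFunc K :=
  (algebraMap K[X] (RatFunc K)).comp (Polynomial.mapRingHom (algebraMap F K))

/-- An operator with coefficients in `F[x]` as an operator with coefficients in `K(x)`. -/
def toRat (K : Type*) [Field K] [Algebra F K] (L : ℕ →₀ F[X]) : ℕ →₀ RatFunc K :=
  L.mapRange (polyEmb F K) (map_zero _)

/-- The left ideal `⟨L⟩ = K(x)[D] L`, which is spanned over `K(x)` by the operators `D^k L`. -/
def leftIdeal (K : Type*) [Field K] [Algebra F K] (L : ℕ →₀ F[X]) :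
    Submodule (RatFunc K) (ℕ →₀ RatFunc K) :=
  Submodule.span (RatFunc K) (Set.range fun k : ℕ => dMul^[k] (toRat K L))

theorem dMul_mem_leftIdeal (L : ℕ →₀ F[X]) (P : ℕ →₀ RatFunc K) (hP : P ∈ leftIdeal K L) :
    dMul P ∈ leftIdeal K L := by
  induction hP using Submodule.span_induction with
  | mem P h =>
    obtain ⟨k, rfl⟩ := h
    exact Submodule.subset_span ⟨k + 1, Function.iterate_succ_apply' _ _ _⟩
  | zero => rw [map_zero]; exact Submodule.zero_mem _
  | add P Q _ _ hP hQ => rw [map_add]; exact Submodule.add_mem _ hP hQ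
  | smul c P hP h =>
    rw [dMul_smul]
    exact Submodule.add_mem _ (Submodule.smul_mem _ _ hP) (Submodule.smul_mem _ _ h)

/-- The quotient `K(x)[D] / ⟨L⟩`. -/
abbrev OpQuot (K : Type*) [Field K] [Algebra F K] (L : ℕ →₀ F[X]) : Type _ :=
  (ℕ →₀ RatFunc K) ⧸ leftIdeal K L

/-- Left multiplication by `D` on `K(x)[D] / ⟨L⟩`. -/
def quotD {L : ℕ →₀ F[X]} : OpQuot K L →+ OpQuot K L :=
  QuotientAddGroup.map (leftIdeal K L).toAddSubgroup (leftIdeal K L).toAddSubgroup dMul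
    (fun P hP => dMul_mem_leftIdeal L P hP)

theorem quotD_mk {L : ℕ →₀ F[X]} (P : ℕ →₀ RatFunc K) :
    quotD ((leftIdeal K L).mkQ P) = (leftIdeal K L).mkQ (dMul P) := rfl

/-- The solutions of `L` among the linear combinations of elements of `K[[[x - α]]]`. -/
def Solution (L : ℕ →₀ F[X]) (α : K) : Type _ :=
  {f : LogSeries F K // act α f (toRat K L) = 0}

theorem act_leftIdeal {L : ℕ →₀ F[X]} {α : K} (f : Solution L α) :
    leftIdeal K L ≤ LinearMap.ker (act α f.1) := by
  refine Submodule.span_le.mpr ?_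
  rintro _ ⟨k, rfl⟩
  change act α f.1 (dMul^[k] (toRat K L)) = 0
  induction k with
  | zero => exact f.2
  | succ k ih => rw [Function.iterate_succ_apply', act_dMul, ih, map_zero]

/-- The action `A · f` of an element `A` of `K(x)[D] / ⟨L⟩` on a solution `f` of `L`. -/
def Solution.apply {L : ℕ →₀ F[X]} {α : K} (f : Solution L α) :
    OpQuot K L →ₛₗ[expand (F := F) α] LogSeries F K :=
  (leftIdeal K L).liftQ (act α f.1) (act_leftIdeal f)

/-! ### Regular operators, integrality, and the generalized Wronskian -/

/-- The order of a nonzero operator. -/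
def ord (L : ℕ →₀ F[X]) : ℕ := L.support.sup id

/-- The coefficient of `D^(ord L)`. -/
def lead (L : ℕ →₀ F[X]) : F[X] := L (ord L)

/-- A fundamental system of `L` in `K[[[x - α]]]`: `ord L` solutions which belong to
`K[[[x - α]]]` and are linearly independent over `K`. -/
def IsFundamentalSystem {L : ℕ →₀ F[X]} {α : K} (b : Fin (ord L) → Solution L α) : Prop :=
  (∀ i, IsPure (b i).1) ∧ LinearIndependent K fun i => (b i).1

/-- `L` is regular if it has a fundamental system in `K[[[x - α]]]` for every `α` in `K`. -/
def IsRegular (K : Type*) [Field K] [Algebra F K] (L : ℕ →₀ F[X]) : Prop :=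
  ∀ α : K, ∃ b : Fin (ord L) → Solution L α, IsFundamentalSystem b

/-- The quotient group `F / ℤ`. -/
abbrev ModInt (F : Type*) [Field F] : Type _ := F ⧸ (Int.castAddHom F).range

/-- The functions `ι : F/ℤ × ℕ → F` that may be used to define integrality. -/
structure IsThreshold (ι : ModInt F → ℕ → F) : Prop where
  mem_coset : ∀ (ν : F) (j : ℕ), ((ι (ν : ModInt F) j : F) : ModInt F) = (ν : ModInt F)
  subadditive : ∀ (ν₁ ν₂ : F) (j₁ j₂ : ℕ), ∃ n : ℕ,
    ι (ν₁ : ModInt F) j₁ + ι (ν₂ : ModInt F) j₂ - ι ((ν₁ + ν₂ : F) : ModInt F) (j₁ + j₂) = n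
  zero : ι ((0 : F) : ModInt F) 0 = 0

/-- A series is integral if `μ - ι (μ + ℤ, j)` is a nonnegative integer for all terms
`(x - α)^μ log (x - α)^j` that occur in it. -/
def IsIntegralSeries (ι : ModInt F → ℕ → F) (f : LogSeries F K) : Prop :=
  ∀ (μ : F) (j : ℕ), termCoeff f μ j ≠ 0 → ∃ n : ℕ, μ - ι (μ : ModInt F) j = n

/-- An element `A` of `K(x)[D] / ⟨L⟩` is integral, i.e. belongs to `𝒪_L`, if `A · f` is integral for
every series solution `f` of `L`, at every point `α` of `K`. -/
def IsIntegralElement (ι : ModInt F → ℕ → F) {L : ℕ →₀ F[X]} (A : OpQuot K L) : Prop :=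
  ∀ (α : K) (f : Solution L α), IsPure f.1 → IsIntegralSeries ι (f.apply A)

/-- The element `A` of `K(x)[D] / ⟨L⟩` is represented by an operator of order at most `d`. -/
def OrdLE {L : ℕ →₀ F[X]} (A : OpQuot K L) (d : ℕ) : Prop :=
  ∃ P : ℕ →₀ RatFunc K, (∀ i, d < i → P i = 0) ∧ (leftIdeal K L).mkQ P = A

/-- The generalized Wronskian `det (B i · b j)` of `B 0, …, B (r - 1)`, where `r = ord L`. -/
def genWronskian {L : ℕ →₀ F[X]} {α : K} (b : Fin (ord L) → Solution L α) (B : ℕ → OpQuot K L) :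
    LogSeries F K :=
  Matrix.det (Matrix.of fun i j : Fin (ord L) => (b j).apply (B i))

/-- A nonnegative integer `m` such that `(x - α)^(ι (μ + ℤ, 0) + m)`, for some `μ`, is a term of
the series. -/
def levels (ι : ModInt F → ℕ → F) (f : LogSeries F K) : Set ℕ :=
  {m | ∃ μ : F, termCoeff f μ 0 ≠ 0 ∧ μ = ι (μ : ModInt F) 0 + m}

/-- The number `m_α`, namely the smallest nonnegative integer `m` such that
`(x - α)^(ι (μ + ℤ, 0) + m)`, for some `μ`, is a term of the generalized Wronskian at `α` of
`B 0, …, B (r - 1)` (for some, equivalently every, fundamental system at `α`). -/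
def wronskianLevel (ι : ModInt F → ℕ → F) {L : ℕ →₀ F[X]} (B : ℕ → OpQuot K L) (α : K) : ℕ :=
  sInf {m | ∃ b : Fin (ord L) → Solution L α, IsFundamentalSystem b ∧
    m ∈ levels ι (genWronskian b B)}

/-! ### The algorithm -/

open scoped Classical in
/-- The squarefree part of the leading coefficient of `L`, i.e. the product of its monic irreducible
factors. -/
def sqfreePart (L : ℕ →₀ F[X]) : F[X] := UniqueFactorizationMonoid.radical (lead L)

/-- `e` is the smallest integer such that `(x - α)^e b_i` is integral for all elements `b_i` of a
fundamental system of `L` at `α`. -/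
def IsStartExponent (ι : ModInt F → ℕ → F) (L : ℕ →₀ F[X]) (α : K) (e : ℤ) : Prop :=
  ∃ b : Fin (ord L) → Solution L α, IsFundamentalSystem b ∧
    IsLeast {k : ℤ | ∀ i, IsIntegralSeries ι (expand α ((RatFunc.X - RatFunc.C α) ^ k) * (b i).1)} e

/-- A configuration of the algorithm: the index `stage` of the basis element which is being
computed, the current values of `B 0, …, B (r - 1)` (the values `B i` with `i ≥ r = ord L` play no
role), and whether the algorithm has returned. -/
structure Config (K : Type*) [Field K] [Algebra F K] (L : ℕ →₀ F[X]) where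
  stage : ℕ
  B : ℕ → OpQuot K L
  returned : Bool

open scoped Classical in
/-- The initial configurations: `B 0 = ∏ (x - α)^(e α)`, where `α` runs over the roots of the leading
coefficient and `e α` is the corresponding start exponent.  The elements that are computed in later
stages are initialized by `B i = s^i D^i B 0`. -/
def IsInitial (ι : ModInt F → ℕ → F) (L : ℕ →₀ F[X]) (c : Config K L) : Prop :=
  c.stage = 0 ∧ c.returned = false ∧
    ∃ e : K → ℤ, (∀ α ∈ ((lead L).aroots K).toFinset, IsStartExponent ι L α (e α)) ∧
      ∀ i, c.B i = polyEmb F K (sqfreePart L) ^ i • quotD^[i] ((leftIdeal K L).mkQ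
        (Finsupp.single 0 (∏ α ∈ ((lead L).aroots K).toFinset,
          (RatFunc.X - RatFunc.C α) ^ (e α))))

/-- The `K[x]`-module `K[x] B 0 + ⋯ + K[x] B d`. -/
def spanUpTo {L : ℕ →₀ F[X]} (B : ℕ → OpQuot K L) (d : ℕ) : Submodule K[X] (OpQuot K L) :=
  Submodule.span K[X] (B '' Set.Iic d)

/-- The set `E` of the integral elements of order at most `d` that do not belong to
`K[x] B 0 + ⋯ + K[x] B d`. -/
def missing (ι : ModInt F → ℕ → F) {L : ℕ →₀ F[X]} (B : ℕ → OpQuot K L) (d : ℕ) :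
    Set (OpQuot K L) :=
  {A | IsIntegralElement ι A ∧ OrdLE A d} \ (spanUpTo B d : Set (OpQuot K L))

/-- One execution of the body of the while loop in stage `d ≥ 1`: an element of `E` of the form
`p⁻¹ (a 0 B 0 + ⋯ + a (d - 1) B (d - 1) + B d)`, where `a 0, …, a (d - 1), p` belong to `F[x]`, is
chosen, and `B d` is replaced by it. -/
def IsUpdate (ι : ModInt F → ℕ → F) {L : ℕ →₀ F[X]} (p : F[X]) (c c' : Config K L) : Prop :=
  c.returned = false ∧ 0 < c.stage ∧ p ≠ 0 ∧
    ∃ (a : ℕ → F[X]) (A : OpQuot K L), A ∈ missing ι c.B c.stage ∧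
      A = (polyEmb F K p)⁻¹ •
        (∑ i ∈ Finset.range c.stage, polyEmb F K (a i) • c.B i + c.B c.stage) ∧
      c' = ⟨c.stage, Function.update c.B c.stage A, false⟩

/-- The work of the current stage is done: there is nothing to do in stage `0`, and in a stage
`d ≥ 1` the condition `E ≠ ∅` of the while loop is violated. -/
def StageDone (ι : ModInt F → ℕ → F) {L : ℕ →₀ F[X]} (c : Config K L) : Prop :=
  c.returned = false ∧ (0 < c.stage → missing ι c.B c.stage = ∅)

/-- The transition from stage `d - 1` to stage `d ≤ r - 1`, in which `B d` is set to
`s D B (d - 1)`. -/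
def IsNextStage (ι : ModInt F → ℕ → F) {L : ℕ →₀ F[X]} (c c' : Config K L) : Prop :=
  StageDone ι c ∧ c.stage + 1 < ord L ∧
    c' = ⟨c.stage + 1, Function.update c.B (c.stage + 1)
      (polyEmb F K (sqfreePart L) • quotD (c.B c.stage)), false⟩

/-- The algorithm returns `B 0, …, B (r - 1)` when stage `r - 1` is done. -/
def IsReturn (ι : ModInt F → ℕ → F) {L : ℕ →₀ F[X]} (c c' : Config K L) : Prop :=
  StageDone ι c ∧ c.stage + 1 = ord L ∧ c' = ⟨c.stage, c.B, true⟩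

/-- One step of the algorithm. -/
def Step (ι : ModInt F → ℕ → F) {L : ℕ →₀ F[X]} (c c' : Config K L) : Prop :=
  (∃ p, IsUpdate ι p c c') ∨ IsNextStage ι c c' ∨ IsReturn ι c c'

/-- The configurations that occur in executions of the algorithm. -/
def Reachable (ι : ModInt F → ℕ → F) {L : ℕ →₀ F[X]} (c : Config K L) : Prop :=
  ∃ c₀, IsInitial ι L c₀ ∧ Relation.ReflTransGen (Step ι) c₀ c

/-- `Q` contains exactly one root of every irreducible factor of the leading coefficient of `L`,
and nothing else. -/
def IsRootSystem (L : ℕ →₀ F[X]) (Q : Finset K) : Prop :=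
  (∀ p : F[X], Irreducible p → p ∣ lead L → ∃! α, α ∈ Q ∧ aeval α p = 0) ∧
    ∀ α ∈ Q, aeval α (lead L) = 0

end Action

end

end IntegralBasis

namespace IntegralBasis

noncomputable section

/-! ### Terms of series -/

section Terms

variable {F K : Type*} [Field F] [CharZero F] [Field K]

/-! At every moment `B i` is represented by an operator of order `i` with a nonzero leading
coefficient `lc i`. Hence the matrix of the `B i · b j` is a lower triangular matrix times the
classical Wronskian matrix, and `W = (∏ lc i) * w` with the classical Wronskian `w`
(`genWronskian_eq`). All assertions about `W` come from this formula. The factor `w` is nonzero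
(`det_wronskianMatrix_ne_zero`) and satisfies Abel's first order equation, so `W` is
hyperexponential. A hyperexponential series with exponents in one class modulo `ℤ` has no logarithms
and is determined by its equation up to a constant. Thus `W` is a power of `x - α` times an
invertible power series, and dividing one `lc i` by `p` lowers `m_α` by exactly the multiplicity of
`α` in `p` (`wronskianLevel_add_rootMultiplicity`). Integrality of `W` is the subadditivity of `ι`.

At an ordinary point the solutions are power series and `w` has a nonzero constant term, so `m_α =
0` initially; since no level ever increases, this persists. In an update `p` is not constant, as
otherwise the new element would lie in the span of the old ones. Its roots can only be roots of the
leading coefficient of `L`, because a positive drop needs a positive level. The sum of the levels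
over these finitely many roots therefore bounds the number of updates.

The algorithm does not get stuck for two reasons. An element missing from the span can be modified
to have a simple pole at a single point: some `(x - α)⁻¹ (∑ a i B i + B d)` with constants `a i` is
integral at `α` (`exists_pole`). This works because the elements of order below `d` are already
spanned. At stage `0`, where no loop is executed, the minimality of `e α` excludes such a pole.
Secondly, the constants can be taken in `F[x]/(p)`, where `p` is the minimal polynomial of `α`: a
linear map applied to the coefficients of series commutes with operators defined over the small
field (`mapCoeff_act`). Lifted to polynomials, the same constants work at all conjugates of `α`,
which gives an integral element with denominator `p` (`exists_rational_pole`,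
`isIntegralElement_of_poles`). The descent needs every `B i` to be defined over `F(x)`; for `B 0`
this holds since `e` is constant on conjugates.

Finally, the invariant records that `s^d c₀` is a polynomial multiple `q` of the current `lc d`. So
replacing the initial value `s^(d+1) D^(d+1) B 0` by `s D B d` divides the leading coefficient by
the polynomial `q`, and no level increases. -/

theorem LogSeries.ext_termCoeff {f g : LogSeries F K}
    (h : ∀ μ j, termCoeff f μ j = termCoeff g μ j) : f = g := by
  ext j μ
  exact h μ j

@[simp] theorem termCoeff_zero (μ : F) (j : ℕ) : termCoeff (0 : LogSeries F K) μ j = 0 := rfl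

@[simp] theorem termCoeff_add (f g : LogSeries F K) (μ : F) (j : ℕ) :
    termCoeff (f + g) μ j = termCoeff f μ j + termCoeff g μ j := by
  simp [termCoeff]

@[simp] theorem termCoeff_neg (f : LogSeries F K) (μ : F) (j : ℕ) :
    termCoeff (-f) μ j = -termCoeff f μ j := by
  simp [termCoeff]

@[simp] theorem termCoeff_smul (c : K) (f : LogSeries F K) (μ : F) (j : ℕ) :
    termCoeff (c • f) μ j = c * termCoeff f μ j := by
  simp [termCoeff]

theorem termCoeff_sum {ι : Type*} (s : Finset ι) (f : ι → LogSeries F K) (μ : F) (j : ℕ) :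
    termCoeff (∑ i ∈ s, f i) μ j = ∑ i ∈ s, termCoeff (f i) μ j := by
  classical
  induction s using Finset.induction_on with
  | empty => simp
  | insert a s ha ih => rw [Finset.sum_insert ha, Finset.sum_insert ha, termCoeff_add, ih]

theorem exists_termCoeff_ne_zero {f : LogSeries F K} (hf : f ≠ 0) :
    ∃ μ j, termCoeff f μ j ≠ 0 := by
  by_contra! h
  exact hf (LogSeries.ext_termCoeff fun μ j => by rw [h, termCoeff_zero])

theorem coeff_mul_ne_zero {f g : HahnSeries (Expo F) K} {μ : Expo F} (h : (f * g).coeff μ ≠ 0) :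
    ∃ μ₁ μ₂ : Expo F, f.coeff μ₁ ≠ 0 ∧ g.coeff μ₂ ≠ 0 ∧ μ = μ₁ + μ₂ := by
  obtain ⟨a, ha, b, hb, hab⟩ := Set.mem_add.mp (HahnSeries.support_mul_subset h)
  exact ⟨a, b, ha, hb, hab.symm⟩

theorem termCoeff_mul_ne_zero {f g : LogSeries F K} {μ : F} {j : ℕ}
    (h : termCoeff (f * g) μ j ≠ 0) :
    ∃ (μ₁ μ₂ : F) (j₁ j₂ : ℕ), termCoeff f μ₁ j₁ ≠ 0 ∧ termCoeff g μ₂ j₂ ≠ 0 ∧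
      μ = μ₁ + μ₂ ∧ j = j₁ + j₂ := by
  rw [termCoeff, Polynomial.coeff_mul, HahnSeries.coeff_sum] at h
  obtain ⟨⟨j₁, j₂⟩, hj, hne⟩ := Finset.exists_ne_zero_of_sum_ne_zero h
  obtain ⟨μ₁, μ₂, h1, h2, h3⟩ := coeff_mul_ne_zero hne
  exact ⟨μ₁, μ₂, j₁, j₂, h1, h2, h3, (Finset.HasAntidiagonal.mem_antidiagonal.mp hj).symm⟩

theorem termCoeff_C (h : HahnSeries (Expo F) K) (μ : F) (j : ℕ) :
    termCoeff (Polynomial.C h) μ j = if j = 0 then h.coeff (Expo.of μ) else 0 := by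
  rw [termCoeff, Polynomial.coeff_C]
  split_ifs <;> simp

/-- The power `(x - α)^ν`. -/
def tpow (ν : F) : LogSeries F K := Polynomial.C (HahnSeries.single (Expo.of ν) 1)

theorem termCoeff_tpow_mul (ν : F) (f : LogSeries F K) (μ : F) (j : ℕ) :
    termCoeff (tpow ν * f) μ j = termCoeff f (μ - ν) j := by
  rw [termCoeff, tpow, Polynomial.coeff_C_mul, HahnSeries.coeff_single_mul, one_mul]
  rfl

theorem termCoeff_tpow (ν μ : F) (j : ℕ) :
    termCoeff (tpow ν : LogSeries F K) μ j ≠ 0 → μ = ν ∧ j = 0 := by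
  rw [tpow, termCoeff_C]
  intro h
  by_cases hj : j = 0
  · rw [if_pos hj] at h
    have h1 : Expo.of μ = Expo.of ν := HahnSeries.eq_of_mem_support_single h
    exact ⟨h1, hj⟩
  · rw [if_neg hj] at h
    exact absurd rfl h

theorem tpow_zero : (tpow (0 : F) : LogSeries F K) = 1 := rfl

theorem tpow_add (μ ν : F) : (tpow (μ + ν) : LogSeries F K) = tpow μ * tpow ν := by
  rw [tpow, tpow, tpow, ← Polynomial.C_mul, HahnSeries.single_mul_single, mul_one]
  rfl

theorem termCoeff_derivative (f : LogSeries F K) (μ : F) (j : ℕ) :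
    termCoeff (derivative f) μ j = ((j : K) + 1) * termCoeff f μ (j + 1) := by
  rw [termCoeff, Polynomial.coeff_derivative, termCoeff]
  have : ((j : HahnSeries (Expo F) K) + 1) = HahnSeries.C ((j : K) + 1) := by
    rw [map_add, map_one, map_natCast]
  rw [this, mul_comm, HahnSeries.C_mul_eq_smul, HahnSeries.coeff_smul, smul_eq_mul]

theorem derivative_expand_mul (α : K) (c : RatFunc K) (f : LogSeries F K) :
    derivative (expand α c * f) = expand α c * derivative f := by
  rw [derivative_mul]
  have : derivative (expand α c : LogSeries F K) = 0 := by
    simp only [expand, RingHom.comp_apply, derivative_C]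
  rw [this, zero_mul, zero_add]

variable [Algebra F K]

theorem termCoeff_D (f : LogSeries F K) (μ : F) (j : ℕ) :
    termCoeff (D f) μ j = algebraMap F K (μ + 1) * termCoeff f (μ + 1) j +
      ((j : K) + 1) * termCoeff f (μ + 1) (j + 1) := by
  have h := termCoeff_tpow_mul (-1 : F) (thetaCoeffs f + derivative f) μ j
  rw [sub_neg_eq_add, termCoeff_add, termCoeff_derivative] at h
  rw [D_apply]
  refine h.trans ?_
  congr 1
  rw [termCoeff, coeff_thetaCoeffs]
  rfl

theorem derivative_D (f : LogSeries F K) : derivative (D f) = D (derivative f) := by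
  apply LogSeries.ext_termCoeff
  intro μ j
  simp only [termCoeff_D, termCoeff_derivative]
  push_cast
  ring

theorem derivative_D_iterate (f : LogSeries F K) (n : ℕ) :
    derivative (D^[n] f) = D^[n] (derivative f) := by
  induction n with
  | zero => rfl
  | succ n ih => rw [Function.iterate_succ_apply', derivative_D, ih, Function.iterate_succ_apply']

theorem termCoeff_tpow_one_mul_D (f : LogSeries F K) (μ : F) (j : ℕ) :
    termCoeff (tpow 1 * D f) μ j = algebraMap F K μ * termCoeff f μ j +
      termCoeff (derivative f) μ j := by
  rw [termCoeff_tpow_mul, termCoeff_D, termCoeff_derivative, sub_add_cancel]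

theorem tpow_one_mul_D (f : LogSeries F K) :
    tpow 1 * D f = thetaCoeffs f + derivative f := by
  rw [D_apply, ← mul_assoc]
  change tpow 1 * tpow (-1) * _ = _
  rw [← tpow_add, add_neg_cancel, tpow_zero, one_mul]

end Terms

/-! ### Power series as generalized series -/

section PowerSeriesEmbedding

variable {F K : Type*} [Field F] [CharZero F] [Field K]

/-- Power series in `x - α` as series without logarithms. -/
def psH : PowerSeries K →+* HahnSeries (Expo F) K :=
  (HahnSeries.embDomainRingHom (intExpo : ℤ →+ Expo F) intExpo_injective intExpo_le).comp
    (HahnSeries.ofPowerSeries ℤ K)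

theorem coeff_psH (v : PowerSeries K) (n : ℕ) :
    (psH v : HahnSeries (Expo F) K).coeff (Expo.of (n : F)) = PowerSeries.coeff n v := by
  have h : (Expo.of (n : F)) = intExpo (n : ℤ) := by
    change (n : F) = ((n : ℤ) : F)
    push_cast; rfl
  rw [h]
  exact HahnSeries.embDomain_coeff.trans (HahnSeries.ofPowerSeries_apply_coeff v n)

theorem coeff_psH_ne_zero {v : PowerSeries K} {μ : Expo F}
    (h : (psH v : HahnSeries (Expo F) K).coeff μ ≠ 0) : ∃ n : ℕ, μ = Expo.of (n : F) := by
  by_contra! hn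
  apply h
  by_cases hμ : ∃ m : ℤ, intExpo m = μ
  · obtain ⟨m, rfl⟩ := hμ
    refine HahnSeries.embDomain_coeff.trans ?_
    rw [HahnSeries.ofPowerSeries_apply]
    refine HahnSeries.embDomain_notin_image_support ?_
    rintro ⟨n, _, hnm⟩
    refine hn n ?_
    rw [← hnm]
    change (((n : ℕ) : ℤ) : F) = (n : F)
    push_cast; rfl
  · refine HahnSeries.embDomain_of_notMem_range ?_
    rintro ⟨m, hm⟩
    exact hμ ⟨m, hm⟩

/-- Power series in `x - α` as generalized series. -/
def psEmb : PowerSeries K →+* LogSeries F K := Polynomial.C.comp psH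

theorem termCoeff_psEmb_ne_zero {v : PowerSeries K} {μ : F} {j : ℕ}
    (h : termCoeff (psEmb v : LogSeries F K) μ j ≠ 0) : (∃ n : ℕ, μ = n) ∧ j = 0 := by
  rw [psEmb, RingHom.comp_apply, termCoeff_C] at h
  by_cases hj : j = 0
  · rw [if_pos hj] at h
    exact ⟨coeff_psH_ne_zero h, hj⟩
  · rw [if_neg hj] at h
    exact absurd rfl h

/-- If all exponents of `f` belong to `ν + ℕ`, the same holds for `v * f`. -/
theorem exponents_psEmb_mul {f : LogSeries F K} {ν : F}
    (hf : ∀ μ j, termCoeff f μ j ≠ 0 → ∃ n : ℕ, μ = ν + n) (v : PowerSeries K) :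
    ∀ μ j, termCoeff (psEmb v * f) μ j ≠ 0 → ∃ n : ℕ, μ = ν + n := by
  intro μ j h
  obtain ⟨μ₁, μ₂, j₁, j₂, h1, h2, rfl, rfl⟩ := termCoeff_mul_ne_zero h
  obtain ⟨⟨n, rfl⟩, -⟩ := termCoeff_psEmb_ne_zero h1
  obtain ⟨m, rfl⟩ := hf _ _ h2
  exact ⟨n + m, by push_cast; ring⟩

theorem psEmb_C (c : K) : (psEmb (PowerSeries.C c) : LogSeries F K) = algebraMap K _ c := by
  rw [psEmb, psH, RingHom.comp_apply, RingHom.comp_apply, HahnSeries.ofPowerSeries_C,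
    HahnSeries.embDomainRingHom_C]
  rfl

theorem psEmb_X : (psEmb PowerSeries.X : LogSeries F K) = tpow 1 := by
  rw [psEmb, psH, RingHom.comp_apply, RingHom.comp_apply, HahnSeries.ofPowerSeries_X, tpow]
  congr 1
  refine HahnSeries.embDomain_single.trans ?_
  have h1 : (intExpo 1 : Expo F) = Expo.of 1 := Int.cast_one (R := F)
  rw [← h1]; rfl

/-- The lowest coefficients of a product with a power series. -/
theorem termCoeff_psEmb_mul_lowest {f : LogSeries F K} {ν : F}
    (hf : ∀ μ j, termCoeff f μ j ≠ 0 → ∃ n : ℕ, μ = ν + n) (v : PowerSeries K) (j : ℕ) :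
    termCoeff (psEmb v * f) ν j = PowerSeries.constantCoeff v * termCoeff f ν j := by
  obtain ⟨w, hw⟩ : ∃ w, v = PowerSeries.X * w + PowerSeries.C (PowerSeries.constantCoeff v) := by
    obtain ⟨w, hw⟩ := PowerSeries.X_dvd_iff.mpr
      (show PowerSeries.constantCoeff (v - PowerSeries.C (PowerSeries.constantCoeff v)) = 0 by simp)
    exact ⟨w, by rw [← hw]; ring⟩
  have h0 : termCoeff (psEmb w * f) (ν - 1) j = 0 := by
    by_contra h
    obtain ⟨n, hn⟩ := exponents_psEmb_mul hf w _ _ h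
    have : ((n + 1 : ℕ) : F) = 0 := by push_cast; linear_combination -hn
    exact Nat.succ_ne_zero n (Nat.cast_eq_zero.mp this)
  conv_lhs => rw [hw]
  rw [map_add, map_mul, psEmb_C, psEmb_X, add_mul, mul_assoc, termCoeff_add, termCoeff_tpow_mul,
    h0, zero_add, ← Algebra.smul_def, termCoeff_smul]

/-- A nonzero series without logarithms whose exponents are congruent modulo `ℤ` is, up to a power
of `x - α`, an invertible power series. -/
theorem exists_eq_single_mul_psH {h : HahnSeries (Expo F) K} (h0 : h ≠ 0) {ν : F}
    (hν : ∀ μ : F, h.coeff (Expo.of μ) ≠ 0 → ∃ n : ℤ, μ = ν + n) :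
    ∃ (ν₀ : F) (v : PowerSeries K), PowerSeries.constantCoeff v ≠ 0 ∧ (∃ n : ℤ, ν₀ = ν + n) ∧
      h = HahnSeries.single (Expo.of ν₀) 1 * psH v := by
  obtain ⟨ν₀, hmin⟩ := h.isPWO_support.exists_minimal (HahnSeries.support_nonempty_iff.mpr h0)
  have hν₀ : h.coeff ν₀ ≠ 0 := hmin.1
  obtain ⟨n₀, hn₀⟩ : ∃ n : ℤ, ν₀.val = ν + n := hν ν₀ hν₀
  -- Exponents in one class modulo `ℤ` are totally ordered, so the minimal exponent is the least
  -- one.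
  have hsupp : ∀ μ : Expo F, h.coeff μ ≠ 0 → ∃ n : ℕ, μ = ν₀ + Expo.of (n : F) := by
    intro μ hμ
    obtain ⟨m, hm⟩ : ∃ n : ℤ, μ.val = ν + n := hν μ hμ
    rcases le_total m n₀ with hle | hle
    · obtain ⟨k, rfl⟩ := Int.le.dest hle
      have hle : μ ≤ ν₀ := by
        refine ⟨k, ?_⟩
        rw [hn₀, hm]; push_cast; ring
      have := hmin.2 hμ hle
      refine ⟨0, ?_⟩
      rw [le_antisymm hle this]
      change ν₀.val = ν₀.val + ((0 : ℕ) : F)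
      simp
    · obtain ⟨k, rfl⟩ := Int.le.dest hle
      refine ⟨k, ?_⟩
      change μ.val = ν₀.val + (k : F)
      rw [hn₀, hm]; push_cast; ring
  refine ⟨ν₀, PowerSeries.mk fun n => h.coeff (ν₀ + Expo.of (n : F)), ?_, ⟨n₀, hn₀⟩, ?_⟩
  · rw [← PowerSeries.coeff_zero_eq_constantCoeff_apply, PowerSeries.coeff_mk]
    have : ν₀ + Expo.of ((0 : ℕ) : F) = ν₀ := by
      change ν₀.val + ((0 : ℕ) : F) = ν₀.val
      simp
    rwa [this]
  · ext μ
    change _ = (HahnSeries.single (ν₀ : Expo F) (1 : K) * _).coeff μ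
    rw [HahnSeries.coeff_single_mul, one_mul]
    by_cases hμ : ∃ n : ℕ, μ = ν₀ + Expo.of (n : F)
    · obtain ⟨n, rfl⟩ := hμ
      rw [add_sub_cancel_left, coeff_psH, PowerSeries.coeff_mk]
    · rw [not_not.mp (mt (hsupp μ) hμ)]
      symm
      by_contra hc
      obtain ⟨n, hn⟩ := coeff_psH_ne_zero hc
      exact hμ ⟨n, by rw [← hn]; abel⟩

theorem isUnit_single (μ : Expo F) : IsUnit (HahnSeries.single μ (1 : K)) :=
  IsUnit.of_mul_eq_one (HahnSeries.single (-μ) 1) (by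
    rw [HahnSeries.single_mul_single, add_neg_cancel, mul_one, HahnSeries.single_zero_one])

/-- The order on exponents is only partial, so nonzero series need not be invertible; those with
exponents in one class are, and this is what allows division below. -/
theorem isUnit_hahnSeries_of_coset {h : HahnSeries (Expo F) K} (h0 : h ≠ 0) {ν : F}
    (hν : ∀ μ : F, h.coeff (Expo.of μ) ≠ 0 → ∃ n : ℤ, μ = ν + n) : IsUnit h := by
  obtain ⟨ν₀, v, hv, -, rfl⟩ := exists_eq_single_mul_psH h0 hν
  exact (isUnit_single _).mul
    ((PowerSeries.isUnit_iff_constantCoeff.mpr (isUnit_iff_ne_zero.mpr hv)).map _)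

end PowerSeriesEmbedding

/-! ### Homogeneous series -/

section InCoset

variable {F K : Type*} [Field F] [CharZero F] [Field K]

/-- All exponents of `f` are congruent to `ν` modulo `ℤ`. -/
def InCoset (ν : F) (f : LogSeries F K) : Prop :=
  ∀ μ j, termCoeff f μ j ≠ 0 → ∃ n : ℤ, μ = ν + n

theorem IsPure.exists_inCoset {f : LogSeries F K} (hf : IsPure f) : ∃ ν, InCoset ν f := by
  obtain ⟨ν, hν⟩ := hf
  refine ⟨ν, fun μ j h => ?_⟩
  obtain ⟨n, hn⟩ := hν μ j h
  exact ⟨n, by rw [hn]; push_cast; rfl⟩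

theorem InCoset.neg {ν : F} {f : LogSeries F K} (hf : InCoset ν f) : InCoset ν (-f) :=
  fun μ j h => hf μ j (by simpa using h)

theorem InCoset.sum {ν : F} {ι : Type*} (s : Finset ι) {f : ι → LogSeries F K}
    (hf : ∀ i ∈ s, InCoset ν (f i)) : InCoset ν (∑ i ∈ s, f i) := by
  intro μ j h
  rw [termCoeff_sum] at h
  obtain ⟨i, hi, hne⟩ := Finset.exists_ne_zero_of_sum_ne_zero h
  exact hf i hi μ j hne

theorem InCoset.mul {μ ν : F} {f g : LogSeries F K} (hf : InCoset μ f) (hg : InCoset ν g) :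
    InCoset (μ + ν) (f * g) := by
  intro κ j h
  obtain ⟨μ₁, μ₂, j₁, j₂, h1, h2, rfl, rfl⟩ := termCoeff_mul_ne_zero h
  obtain ⟨n, rfl⟩ := hf _ _ h1
  obtain ⟨m, rfl⟩ := hg _ _ h2
  exact ⟨n + m, by push_cast; ring⟩

theorem inCoset_one : InCoset 0 (1 : LogSeries F K) := by
  intro μ j h
  rw [← tpow_zero] at h
  exact ⟨0, by rw [(termCoeff_tpow _ _ _ h).1]; simp⟩

theorem InCoset.prod {ι : Type*} (s : Finset ι) {ν : ι → F} {f : ι → LogSeries F K}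
    (hf : ∀ i ∈ s, InCoset (ν i) (f i)) : InCoset (∑ i ∈ s, ν i) (∏ i ∈ s, f i) := by
  classical
  induction s using Finset.induction_on with
  | empty => simpa using inCoset_one
  | insert a s ha ih =>
    rw [Finset.sum_insert ha, Finset.prod_insert ha]
    exact (hf a (Finset.mem_insert_self _ _)).mul
      (ih fun i hi => hf i (Finset.mem_insert_of_mem hi))

/-- Each term of the determinant takes exactly one entry from every column, so all terms have the
same class of exponents even if the columns have different ones. -/
theorem InCoset.det {n : Type*} [Fintype n] [DecidableEq n] {ν : n → F}
    {M : Matrix n n (LogSeries F K)} (h : ∀ i j, InCoset (ν j) (M i j)) :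
    InCoset (∑ j, ν j) M.det := by
  rw [Matrix.det_apply]
  refine InCoset.sum _ fun σ _ => ?_
  have := InCoset.prod Finset.univ fun j _ => h (σ j) j
  rcases Int.units_eq_one_or (Equiv.Perm.sign σ) with hs | hs
  · simpa [hs] using this
  · simpa [hs] using this.neg

theorem InCoset.leadingCoeff_isUnit {ν : F} {f : LogSeries F K} (hf : InCoset ν f) (h0 : f ≠ 0) :
    IsUnit f.leadingCoeff :=
  isUnit_hahnSeries_of_coset (Polynomial.leadingCoeff_ne_zero.mpr h0) fun μ h => hf μ _ h

variable [Algebra F K]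

theorem InCoset.D {ν : F} {f : LogSeries F K} (hf : InCoset ν f) :
    InCoset ν (IntegralBasis.D f) := by
  intro μ j h
  rw [termCoeff_D] at h
  have : ∃ n : ℤ, μ + 1 = ν + n := by
    by_cases h1 : termCoeff f (μ + 1) j = 0
    · refine hf _ (j + 1) fun h2 => h ?_
      rw [h1, h2, mul_zero, mul_zero, add_zero]
    · exact hf _ _ h1
  obtain ⟨n, hn⟩ := this
  exact ⟨n - 1, by push_cast; linear_combination hn⟩

theorem InCoset.D_iterate {ν : F} {f : LogSeries F K} (hf : InCoset ν f) (n : ℕ) :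
    InCoset ν (IntegralBasis.D^[n] f) := by
  induction n with
  | zero => exact hf
  | succ n ih => rw [Function.iterate_succ_apply']; exact ih.D

end InCoset

/-! ### Wronskians of series -/

section Wronskian

variable {F K : Type*} [Field F] [CharZero F] [Field K]

theorem mul_eq_zero_of_isUnit_leadingCoeff {f g : LogSeries F K} (hf : IsUnit f.leadingCoeff)
    (h : f * g = 0) : g = 0 :=
  (mul_left_mem_nonZeroDivisors_eq_zero_iff
    (Polynomial.mem_nonZeroDivisors_of_leadingCoeff hf.mem_nonZeroDivisors)).mp h

variable [Algebra F K]

theorem coeff_theta (h : HahnSeries (Expo F) K) (μ : Expo F) :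
    (theta h).coeff μ = algebraMap F K μ.val * h.coeff μ := rfl

theorem coeff_theta_zero (h : HahnSeries (Expo F) K) : (theta h).coeff 0 = 0 := by
  rw [coeff_theta]
  have : (0 : Expo F).val = (0 : F) := rfl
  rw [this, map_zero, zero_mul]

theorem eq_C_of_theta_eq_zero {h : HahnSeries (Expo F) K} (h0 : theta h = 0) :
    ∃ c : K, h = HahnSeries.C c := by
  refine ⟨h.coeff 0, ?_⟩
  ext μ
  rw [HahnSeries.C_apply, HahnSeries.coeff_single]
  split_ifs with hμ
  · rw [hμ]
  · have h1 : algebraMap F K μ.val * h.coeff μ = 0 := by rw [← coeff_theta, h0]; rfl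
    rcases mul_eq_zero.mp h1 with h2 | h2
    · exact absurd ((map_eq_zero _).mp h2) hμ
    · exact h2

/-- A nonzero constant is the derivative only of a logarithm: `t d/dt` multiplies the coefficient of
`t^0` by zero. This obstruction controls the degrees in the logarithm. -/
theorem theta_ne_C {h : HahnSeries (Expo F) K} {c : K} (h0 : theta h = HahnSeries.C c) : c = 0 := by
  have := coeff_theta_zero h
  rw [h0] at this
  simpa [HahnSeries.C_apply] using this

theorem coeff_tpow_one_mul_D (f : LogSeries F K) (j : ℕ) :
    (tpow 1 * D f).coeff j = theta (f.coeff j) + f.coeff (j + 1) * ((j : HahnSeries (Expo F) K) + 1) := by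
  rw [tpow_one_mul_D, Polynomial.coeff_add, coeff_thetaCoeffs, Polynomial.coeff_derivative]

theorem natDegree_tpow_one_mul_D_le (f : LogSeries F K) :
    (tpow 1 * D f).natDegree ≤ f.natDegree := by
  refine Polynomial.natDegree_le_iff_coeff_eq_zero.mpr fun N hN => ?_
  rw [coeff_tpow_one_mul_D, Polynomial.coeff_eq_zero_of_natDegree_lt hN,
    Polynomial.coeff_eq_zero_of_natDegree_lt (Nat.lt_succ_of_lt hN), map_zero, zero_mul, add_zero]

theorem coeff_tpow_one_mul_D_natDegree (f : LogSeries F K) :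
    (tpow 1 * D f).coeff f.natDegree = theta f.leadingCoeff := by
  rw [coeff_tpow_one_mul_D, Polynomial.coeff_eq_zero_of_natDegree_lt (Nat.lt_succ_self _), zero_mul,
    add_zero, Polynomial.leadingCoeff]

/-- The derivative of the leading coefficient `1` vanishes, so `t D f` has lower degree, and its
next coefficient contains the degree of `f` as a summand. The factor `X` shifts this coefficient to
the degree of `f`, so that degree zero is no exception. -/
theorem monic_X_mul_tpow_mul_D {f : LogSeries F K} (hf : f.Monic) :
    (X * (tpow 1 * D f)).natDegree ≤ f.natDegree ∧
    ∃ y, (X * (tpow 1 * D f)).coeff f.natDegree = theta y + (f.natDegree : HahnSeries (Expo F) K) := by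
  have hlead : (tpow 1 * D f).coeff f.natDegree = 0 := by
    rw [coeff_tpow_one_mul_D_natDegree, hf.leadingCoeff]
    exact theta.map_one_eq_zero
  constructor
  · refine Polynomial.natDegree_le_iff_coeff_eq_zero.mpr fun N hN => ?_
    obtain ⟨N, rfl⟩ : ∃ m, N = m + 1 := ⟨N - 1, by omega⟩
    rw [Polynomial.coeff_X_mul]
    rcases (Nat.lt_succ_iff.mp hN).eq_or_lt with h | h
    · rw [← h, hlead]
    · exact Polynomial.coeff_eq_zero_of_natDegree_lt
        ((natDegree_tpow_one_mul_D_le f).trans_lt h)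
  · rcases Nat.eq_zero_or_pos f.natDegree with h | h
    · exact ⟨0, by rw [h]; simp⟩
    · obtain ⟨q, hq⟩ : ∃ m, f.natDegree = m + 1 := ⟨f.natDegree - 1, by omega⟩
      refine ⟨f.coeff q, ?_⟩
      rw [hq, Polynomial.coeff_X_mul, coeff_tpow_one_mul_D, ← hq, Polynomial.coeff_natDegree,
        hf.leadingCoeff, one_mul, hq]
      push_cast; rfl

/-- Comparison of the top coefficients gives `theta yb + deg b = theta ya + deg a`, and the
coefficient of `t^0` sees only the degrees. -/
theorem natDegree_eq_of_monic {a b : LogSeries F K} (ha : a.Monic) (hb : b.Monic)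
    (h : a * D b = b * D a) : b.natDegree = a.natDegree := by
  have : CharZero K := charZero_of_injective_algebraMap (algebraMap F K).injective
  obtain ⟨da, ya, hya⟩ := monic_X_mul_tpow_mul_D ha
  obtain ⟨db, yb, hyb⟩ := monic_X_mul_tpow_mul_D hb
  have h1 := Polynomial.coeff_mul_add_eq_of_natDegree_le (le_refl a.natDegree) db
  have h2 := Polynomial.coeff_mul_add_eq_of_natDegree_le (le_refl b.natDegree) da
  have h3 : a * (X * (tpow 1 * D b)) = b * (X * (tpow 1 * D a)) := by
    linear_combination (X * tpow 1) * h
  rw [h3, add_comm, h2, Polynomial.coeff_natDegree, Polynomial.coeff_natDegree, ha, hb, hya,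
    hyb, one_mul, one_mul] at h1
  have h4 := congrArg (fun z : HahnSeries (Expo F) K => z.coeff 0) h1
  simp only [HahnSeries.coeff_add, coeff_theta_zero, zero_add] at h4
  rw [← map_natCast HahnSeries.C, ← map_natCast HahnSeries.C, HahnSeries.C_apply,
    HahnSeries.C_apply, HahnSeries.coeff_single_same, HahnSeries.coeff_single_same] at h4
  exact_mod_cast h4.symm

theorem theta_mul_eq_zero {x y v : HahnSeries (Expo F) K} (hv : v * x = 1)
    (h : x * theta y = y * theta x) : theta (v * y) = 0 := by
  have h1 : v * theta x + x * theta v = 0 := by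
    have := congrArg theta hv
    rwa [Derivation.leibniz, smul_eq_mul, smul_eq_mul, theta.map_one_eq_zero] at this
  rw [Derivation.leibniz, smul_eq_mul, smul_eq_mul]
  linear_combination v ^ 2 * h - (v * theta y + y * theta v) * hv + y * v * h1

theorem mul_D_mul_eq {x y : LogSeries F K} (h : x * D y = y * D x) (v : LogSeries F K) :
    (v * x) * D (v * y) = (v * y) * D (v * x) := by
  rw [Derivation.leibniz, Derivation.leibniz, smul_eq_mul, smul_eq_mul, smul_eq_mul, smul_eq_mul]
  linear_combination v ^ 2 * h

theorem monic_C_mul {R : Type*} [Semiring R] [Nontrivial R] {w : R} {f : R[X]}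
    (hw : w * f.leadingCoeff = 1) :
    (Polynomial.C w * f).Monic ∧ (Polynomial.C w * f).natDegree = f.natDegree := by
  have hne : w * f.leadingCoeff ≠ 0 := by rw [hw]; exact one_ne_zero
  refine ⟨?_, Polynomial.natDegree_C_mul_of_mul_ne_zero hne⟩
  rw [Polynomial.Monic, Polynomial.leadingCoeff, Polynomial.natDegree_C_mul_of_mul_ne_zero hne,
    Polynomial.coeff_C_mul]
  exact hw

theorem leadingCoeff_mul_theta_eq {a b : LogSeries F K} (h : a * D b = b * D a) :
    a.leadingCoeff * theta b.leadingCoeff = b.leadingCoeff * theta a.leadingCoeff := by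
  have h1 := Polynomial.coeff_mul_add_eq_of_natDegree_le (le_refl a.natDegree)
    (natDegree_tpow_one_mul_D_le b)
  have h2 := Polynomial.coeff_mul_add_eq_of_natDegree_le (le_refl b.natDegree)
    (natDegree_tpow_one_mul_D_le a)
  have h3 : a * (tpow 1 * D b) = b * (tpow 1 * D a) := by linear_combination tpow 1 * h
  rw [h3, add_comm, h2, coeff_tpow_one_mul_D_natDegree, coeff_tpow_one_mul_D_natDegree,
    Polynomial.coeff_natDegree, Polynomial.coeff_natDegree] at h1
  exact h1.symm

theorem theta_mul_leadingCoeff_eq_zero {a b : LogSeries F K} {v : HahnSeries (Expo F) K}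
    (hv : v * a.leadingCoeff = 1) (h : a * D b = b * D a) : theta (v * b.leadingCoeff) = 0 :=
  theta_mul_eq_zero hv (leadingCoeff_mul_theta_eq h)

theorem natDegree_eq_of_leadingCoeff {a b : LogSeries F K} {v : HahnSeries (Expo F) K}
    (hv : v * a.leadingCoeff = 1) (hb : v * b.leadingCoeff = 1) (h : a * D b = b * D a) :
    b.natDegree = a.natDegree := by
  obtain ⟨m1, d1⟩ := monic_C_mul hv
  obtain ⟨m2, d2⟩ := monic_C_mul hb
  rw [← d1, ← d2]
  exact natDegree_eq_of_monic m1 m2 (mul_D_mul_eq h _)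

/-- The quotient of the leading coefficients has derivative zero, hence is a constant. After
division by this constant, one common factor makes both series monic without disturbing the
vanishing of their Wronskian. -/
theorem leadingCoeff_proportional {a b : LogSeries F K} (ha : IsUnit a.leadingCoeff) (hb : b ≠ 0)
    (h : a * D b = b * D a) :
    b.natDegree = a.natDegree ∧ ∃ c : K, b.leadingCoeff = HahnSeries.C c * a.leadingCoeff := by
  obtain ⟨v, hv⟩ := ha.exists_left_inv
  obtain ⟨c, hc⟩ := eq_C_of_theta_eq_zero (theta_mul_leadingCoeff_eq_zero hv h)
  have hbl : b.leadingCoeff = HahnSeries.C c * a.leadingCoeff := by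
    rw [← hc, mul_right_comm, hv, one_mul]
  refine ⟨?_, c, hbl⟩
  have hc0 : c ≠ 0 := by
    rintro rfl
    rw [map_zero, zero_mul, Polynomial.leadingCoeff_eq_zero] at hbl
    exact hb hbl
  have hreg : IsSMulRegular (HahnSeries (Expo F) K) c⁻¹ := fun x y hxy => by
    simpa only [smul_smul, mul_inv_cancel₀ hc0, one_smul] using congrArg (c • ·) hxy
  have hl : (c⁻¹ • b).leadingCoeff = HahnSeries.C c⁻¹ * b.leadingCoeff := by
    rw [Polynomial.leadingCoeff, Polynomial.natDegree_smul_of_smul_regular _ hreg,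
      Polynomial.coeff_smul, HahnSeries.C_mul_eq_smul, Polynomial.leadingCoeff]
  have hu2 : v * (c⁻¹ • b).leadingCoeff = 1 := by
    rw [hl, mul_left_comm, hc, ← map_mul, inv_mul_cancel₀ hc0, map_one]
  rw [← Polynomial.natDegree_smul_of_smul_regular b hreg]
  refine natDegree_eq_of_leadingCoeff hv hu2 ?_
  rw [Derivation.map_smul, mul_smul_comm, smul_mul_assoc, h]

/-- Two series whose Wronskian vanishes are proportional, if the leading coefficient of one of them,
as a polynomial in the logarithm, is invertible. -/
theorem eq_smul_of_mul_D_eq {a b : LogSeries F K} (ha : IsUnit a.leadingCoeff)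
    (h : a * D b = b * D a) : ∃ c : K, b = c • a := by
  by_cases hb : b = 0
  · exact ⟨0, by rw [hb, zero_smul]⟩
  obtain ⟨hd, c, hc⟩ := leadingCoeff_proportional ha hb h
  refine ⟨c, sub_eq_zero.mp ?_⟩
  by_contra hne
  have h' : a * D (b - c • a) = (b - c • a) * D a := by
    rw [map_sub, Derivation.map_smul, mul_sub, sub_mul, h, mul_smul_comm, smul_mul_assoc]
  -- If the difference were nonzero, it would have the same degree as `a`; but `c` was chosen so
  -- that its coefficient in this degree cancels.
  obtain ⟨hd', -⟩ := leadingCoeff_proportional ha hne h'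
  apply hne
  rw [← Polynomial.leadingCoeff_eq_zero, Polynomial.leadingCoeff, hd', Polynomial.coeff_sub,
    Polynomial.coeff_smul, Polynomial.coeff_natDegree, ← hd, Polynomial.coeff_natDegree, hc,
    HahnSeries.C_mul_eq_smul, sub_self]

/-- A homogeneous hyperexponential series has no logarithmic terms. -/
theorem natDegree_eq_zero_of_D_eq {f : LogSeries F K} (hf : IsUnit f.leadingCoeff)
    {g : HahnSeries (Expo F) K} (h : D f = Polynomial.C g * f) : f.natDegree = 0 := by
  have : CharZero K := charZero_of_injective_algebraMap (algebraMap F K).injective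
  by_contra hne
  obtain ⟨q, hq⟩ : ∃ m, f.natDegree = m + 1 := ⟨f.natDegree - 1, by omega⟩
  obtain ⟨v, hv⟩ := hf.exists_left_inv
  set s : HahnSeries (Expo F) K := HahnSeries.single (Expo.of 1) 1 * g with hs
  have h1 : tpow 1 * D f = Polynomial.C s * f := by
    rw [h, hs, Polynomial.C_mul, mul_assoc]; rfl
  have h2 := coeff_tpow_one_mul_D_natDegree f
  rw [h1, Polynomial.coeff_C_mul, Polynomial.coeff_natDegree] at h2
  have h3 := coeff_tpow_one_mul_D f q
  rw [h1, Polynomial.coeff_C_mul, ← hq, Polynomial.coeff_natDegree] at h3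
  have hva : v * theta f.leadingCoeff + f.leadingCoeff * theta v = 0 := by
    have := congrArg theta hv
    rwa [Derivation.leibniz, smul_eq_mul, smul_eq_mul, theta.map_one_eq_zero] at this
  -- With `a` and `b` the two top coefficients of `f`, the equation says `theta a = s a` and `theta
  -- b + (q + 1) a = s b`, so `-b/a` has the nonzero constant derivative `q + 1`.
  have h4 : theta (-(v * f.coeff q)) = HahnSeries.C ((q : K) + 1) := by
    rw [map_neg, Derivation.leibniz, smul_eq_mul, smul_eq_mul, map_add, map_one, map_natCast]
    linear_combination v * h3 + ((q : HahnSeries (Expo F) K) + 1) * hv - v * v * f.coeff q * h2 +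
      (s * v * f.coeff q + f.coeff q * theta v) * hv - v * f.coeff q * hva
  have h5 := theta_ne_C h4
  exact Nat.cast_add_one_ne_zero q h5

/-- The Wronskian matrix of a finite family of series. -/
def wronskianMatrix {n : ℕ} (b : Fin n → LogSeries F K) : Matrix (Fin n) (Fin n) (LogSeries F K) :=
  Matrix.of fun i j => D^[i] (b j)

theorem adjugate_last_last {R : Type*} [CommRing R] {n : ℕ}
    (M : Matrix (Fin (n + 1)) (Fin (n + 1)) R) :
    M.adjugate (Fin.last n) (Fin.last n) = (M.submatrix Fin.castSucc Fin.castSucc).det := by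
  rw [Matrix.adjugate_fin_succ_eq_det_submatrix, ← two_mul, pow_mul, neg_one_sq, one_pow, one_mul]
  simp only [Fin.succAbove_last]

/-- The last column `c` of the adjugate satisfies `M c = 0`. As each row but the first is the
derivative of its predecessor, differentiation shows that `d c` is annihilated by all rows except
possibly the last. A combination of `c` and `d c` with vanishing last entry is then killed by a
block whose determinant is regular. -/
theorem adjugate_mul_D_eq {k R : Type*} [CommRing k] [CommRing R] [Algebra k R]
    (d : Derivation k R R) {n : ℕ} (M : Matrix (Fin (n + 1)) (Fin (n + 1)) R)
    (hM : ∀ (i : Fin n) (j : Fin (n + 1)), d (M i.castSucc j) = M i.succ j)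
    (hdet : M.det = 0)
    (hreg : ∀ g : R, (M.submatrix Fin.castSucc Fin.castSucc).det * g = 0 → g = 0)
    (j : Fin (n + 1)) :
    M.adjugate (Fin.last n) (Fin.last n) * d (M.adjugate j (Fin.last n)) =
      M.adjugate j (Fin.last n) * d (M.adjugate (Fin.last n) (Fin.last n)) := by
  obtain ⟨c, hc⟩ : ∃ c : Fin (n + 1) → R, ∀ j, M.adjugate j (Fin.last n) = c j := ⟨_, fun _ => rfl⟩
  have hrow : ∀ i, ∑ j, M i j * c j = 0 := by
    intro i
    have := congrFun (congrFun (Matrix.mul_adjugate M) i) (Fin.last n)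
    rw [hdet, zero_smul, Matrix.mul_apply] at this
    rw [← Finset.sum_congr rfl fun j _ => congrArg (M i j * ·) (hc j)]
    exact this
  have hder : ∀ i : Fin n, ∑ j, M i.castSucc j * d (c j) = 0 := by
    intro i
    have h1 := congrArg d (hrow i.castSucc)
    rw [map_zero, map_sum] at h1
    simp only [Derivation.leibniz, smul_eq_mul, Finset.sum_add_distrib] at h1
    have h2 : ∑ j, c j * d (M i.castSucc j) = 0 := by
      rw [← hrow i.succ]
      exact Finset.sum_congr rfl fun j _ => by rw [hM, mul_comm]
    rwa [h2, add_zero] at h1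
  simp only [hc]
  obtain ⟨e, he⟩ : ∃ e : Fin (n + 1) → R,
    ∀ j, e j = c (Fin.last n) * d (c j) - c j * d (c (Fin.last n)) := ⟨_, fun _ => rfl⟩
  have he0 : e (Fin.last n) = 0 := by rw [he]; ring
  have hmv : (M.submatrix Fin.castSucc Fin.castSucc).mulVec (fun j => e (Fin.castSucc j)) = 0 := by
    ext1 i
    have h1 : ∑ j, M i.castSucc j * e j = 0 := by
      have : ∀ j, M i.castSucc j * e j = c (Fin.last n) * (M i.castSucc j * d (c j)) -
        d (c (Fin.last n)) * (M i.castSucc j * c j) := fun j => by rw [he]; ring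
      rw [Finset.sum_congr rfl fun j _ => this j, Finset.sum_sub_distrib, ← Finset.mul_sum,
        ← Finset.mul_sum, hder, hrow, mul_zero, mul_zero, sub_zero]
    rw [Fin.sum_univ_castSucc, he0, mul_zero, add_zero] at h1
    exact h1
  rw [← sub_eq_zero, ← he]
  induction j using Fin.lastCases with
  | last => exact he0
  | cast j =>
    have h1 := congrArg (M.submatrix Fin.castSucc Fin.castSucc).adjugate.mulVec hmv
    rw [Matrix.mulVec_mulVec, Matrix.adjugate_mul, Matrix.mulVec_zero, Matrix.smul_mulVec,
      Matrix.one_mulVec] at h1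
    exact hreg _ (congrFun h1 j)

/-- If the Wronskian vanishes, the cofactors of the last row are constant multiples `l j • w` of the
smaller Wronskian `w`, which is nonzero by induction. Expansion along the first row gives the
relation `∑ l j • b j = 0`, while the last constant is `1`. Homogeneity of the `b j` makes
cancellation of `w` legitimate. -/
theorem det_wronskianMatrix_ne_zero {n : ℕ} (b : Fin n → LogSeries F K)
    (hb : ∀ j, ∃ ν, InCoset ν (b j)) (hli : LinearIndependent K b) :
    (wronskianMatrix b).det ≠ 0 := by
  induction n with
  | zero => rw [Matrix.det_fin_zero]; exact one_ne_zero
  | succ n ih =>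
    intro hdet
    choose ν hν using hb
    obtain ⟨w, hw⟩ : ∃ w, (wronskianMatrix (b ∘ Fin.castSucc)).det = w := ⟨_, rfl⟩
    have hw0 : w ≠ 0 := hw ▸ ih _ (fun j => ⟨_, hν j.castSucc⟩)
      (hli.comp _ (Fin.castSucc_injective n))
    have hwu : IsUnit w.leadingCoeff := by
      refine InCoset.leadingCoeff_isUnit (ν := ∑ j, ν (Fin.castSucc j)) ?_ hw0
      rw [← hw]
      exact InCoset.det fun i j => (hν (Fin.castSucc j)).D_iterate i
    have hsub : (wronskianMatrix b).submatrix Fin.castSucc Fin.castSucc =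
      wronskianMatrix (b ∘ Fin.castSucc) := rfl
    have hadj : (wronskianMatrix b).adjugate (Fin.last n) (Fin.last n) = w := by
      rw [adjugate_last_last, hsub, hw]
    have hprop : ∀ j, ∃ l : K, (wronskianMatrix b).adjugate j (Fin.last n) = l • w := by
      intro j
      refine eq_smul_of_mul_D_eq hwu ?_
      have := adjugate_mul_D_eq D (wronskianMatrix b)
        (fun i j => (Function.iterate_succ_apply' D i (b j)).symm) hdet
        (fun g hg => mul_eq_zero_of_isUnit_leadingCoeff (hw ▸ hwu) (hsub ▸ hg)) j
      rwa [hadj] at this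
    choose l hl using hprop
    have h0 : ∑ j, b j * (wronskianMatrix b).adjugate j (Fin.last n) = 0 := by
      have := congrFun (congrFun (Matrix.mul_adjugate (wronskianMatrix b)) 0) (Fin.last n)
      rw [hdet, zero_smul, Matrix.mul_apply] at this
      exact this
    have h1 : w * ∑ j, l j • b j = 0 := by
      rw [← h0, Finset.mul_sum]
      refine Finset.sum_congr rfl fun j _ => ?_
      rw [hl j, mul_smul_comm, mul_smul_comm, mul_comm]
    have h2 := Fintype.linearIndependent_iff.mp hli l
      (mul_eq_zero_of_isUnit_leadingCoeff hwu h1) (Fin.last n)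
    have h3 := hl (Fin.last n)
    rw [h2, zero_smul, hadj] at h3
    exact hw0 h3

end Wronskian

/-! ### Solutions -/

section ExponentsFrom

variable {F K : Type*} [Field F] [CharZero F] [Field K]

/-- All exponents of `f` belong to `ν + ℕ`. -/
def ExponentsFrom (ν : F) (f : LogSeries F K) : Prop :=
  ∀ μ j, termCoeff f μ j ≠ 0 → ∃ n : ℕ, μ = ν + n

theorem ExponentsFrom.sum {ν : F} {ι : Type*} (s : Finset ι) {f : ι → LogSeries F K}
    (hf : ∀ i ∈ s, ExponentsFrom ν (f i)) : ExponentsFrom ν (∑ i ∈ s, f i) := by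
  intro μ j h
  rw [termCoeff_sum] at h
  obtain ⟨i, hi, hne⟩ := Finset.exists_ne_zero_of_sum_ne_zero h
  exact hf i hi μ j hne

theorem ExponentsFrom.mul {μ ν : F} {f g : LogSeries F K} (hf : ExponentsFrom μ f)
    (hg : ExponentsFrom ν g) : ExponentsFrom (μ + ν) (f * g) := by
  intro κ j h
  obtain ⟨μ₁, μ₂, j₁, j₂, h1, h2, rfl, rfl⟩ := termCoeff_mul_ne_zero h
  obtain ⟨n, rfl⟩ := hf _ _ h1
  obtain ⟨m, rfl⟩ := hg _ _ h2
  exact ⟨n + m, by push_cast; ring⟩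

theorem ExponentsFrom.prod {ι : Type*} (s : Finset ι) {f : ι → LogSeries F K}
    (hf : ∀ i ∈ s, ExponentsFrom 0 (f i)) : ExponentsFrom 0 (∏ i ∈ s, f i) := by
  classical
  induction s using Finset.induction_on with
  | empty =>
    intro μ j h
    rw [Finset.prod_empty, ← tpow_zero] at h
    exact ⟨0, by rw [(termCoeff_tpow _ _ _ h).1]; simp⟩
  | insert a s ha ih =>
    rw [Finset.prod_insert ha, ← add_zero (0 : F)]
    exact (hf a (Finset.mem_insert_self _ _)).mul
      (ih fun i hi => hf i (Finset.mem_insert_of_mem hi))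

theorem ExponentsFrom.det {n : Type*} [Fintype n] [DecidableEq n]
    {M : Matrix n n (LogSeries F K)} (h : ∀ i j, ExponentsFrom 0 (M i j)) :
    ExponentsFrom 0 M.det := by
  rw [Matrix.det_apply]
  refine ExponentsFrom.sum _ fun σ _ => ?_
  have := ExponentsFrom.prod Finset.univ fun j _ => h (σ j) j
  rcases Int.units_eq_one_or (Equiv.Perm.sign σ) with hs | hs
  · simpa [hs] using this
  · intro μ j h
    exact this μ j (by simpa [hs] using h)

theorem ExponentsFrom.derivative {ν : F} {f : LogSeries F K} (hf : ExponentsFrom ν f) :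
    ExponentsFrom ν (Polynomial.derivative f) := fun μ j h =>
  hf μ (j + 1) fun h0 => h (by rw [termCoeff_derivative, h0, mul_zero])

theorem ExponentsFrom.succ {ι : Type*} {y : ι → LogSeries F K} {ν : F}
    (h : ∀ i, ExponentsFrom ν (y i))
    (h0 : ∀ i j, termCoeff (y i) ν j = 0) : ∀ i, ExponentsFrom (ν + 1) (y i) := by
  intro i μ j hne
  obtain ⟨n, rfl⟩ := h i μ j hne
  cases n with
  | zero => exact absurd (h0 i j) (by simpa using hne)
  | succ n => exact ⟨n, by push_cast; ring⟩

variable [Algebra F K]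

theorem ExponentsFrom.D {ν : F} {f : LogSeries F K} (hf : ExponentsFrom ν f) :
    ExponentsFrom (ν - 1) (IntegralBasis.D f) := by
  intro μ j h
  rw [termCoeff_D] at h
  have : ∃ n : ℕ, μ + 1 = ν + n := by
    by_cases h1 : termCoeff f (μ + 1) j = 0
    · refine hf _ (j + 1) fun h2 => h ?_
      rw [h1, h2, mul_zero, mul_zero, add_zero]
    · exact hf _ _ h1
  obtain ⟨n, hn⟩ := this
  exact ⟨n, by linear_combination hn⟩

theorem ExponentsFrom.exists_D_iterate {ν : F} {f : LogSeries F K} (hf : ExponentsFrom ν f)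
    (n : ℕ) : ∃ ν', ∀ i < n, ExponentsFrom ν' (IntegralBasis.D^[i] f) := by
  have key : ∀ i : ℕ, ExponentsFrom (ν - i) (IntegralBasis.D^[i] f) := by
    intro i
    induction i with
    | zero => simpa using hf
    | succ i ih =>
      rw [Function.iterate_succ_apply']
      have := ih.D
      rwa [sub_sub, ← Nat.cast_succ] at this
  refine ⟨ν - n, fun i hi μ j h => ?_⟩
  obtain ⟨m, rfl⟩ := key i μ j h
  obtain ⟨k, rfl⟩ := Nat.exists_eq_add_of_lt hi
  exact ⟨m + k + 1, by push_cast; ring⟩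

/-! ### Systems of first order equations without a pole -/

section Ordinary

variable {ι : Type*} {y : ι → LogSeries F K}

/-- The hypothesis `hD` expresses that the system has no pole: differentiation does not lower a
common bound for the exponents. So the coefficients of `t^(ν - 1)` in the derivatives vanish,
whatever the system is. -/
theorem lowest_coeff_eq
    (hD : ∀ ν : F, (∀ i, ExponentsFrom ν (y i)) → ∀ i, ExponentsFrom ν (IntegralBasis.D (y i)))
    {ν : F} (h : ∀ i, ExponentsFrom ν (y i)) (i : ι) (j : ℕ) :
    algebraMap F K ν * termCoeff (y i) ν j + ((j : K) + 1) * termCoeff (y i) ν (j + 1) = 0 := by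
  have h1 : termCoeff (IntegralBasis.D (y i)) (ν - 1) j = 0 := by
    by_contra hne
    obtain ⟨n, hn⟩ := hD ν h i _ _ hne
    have : ((n + 1 : ℕ) : F) = 0 := by push_cast; linear_combination -hn
    exact Nat.succ_ne_zero n (Nat.cast_eq_zero.mp this)
  rwa [termCoeff_D, sub_add_cancel] at h1

theorem lowest_coeff_eq_zero
    (hD : ∀ ν : F, (∀ i, ExponentsFrom ν (y i)) → ∀ i, ExponentsFrom ν (IntegralBasis.D (y i)))
    {ν : F} (hν : ν ≠ 0) (h : ∀ i, ExponentsFrom ν (y i)) (i : ι) (j : ℕ) :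
    termCoeff (y i) ν j = 0 := by
  -- Downward induction on the power of the logarithm, starting above the degree.
  have key : ∀ m j, (y i).natDegree < j + m → termCoeff (y i) ν j = 0 := by
    intro m
    induction m with
    | zero =>
      intro j hj
      rw [termCoeff, Polynomial.coeff_eq_zero_of_natDegree_lt (by simpa using hj)]; rfl
    | succ m ih =>
      intro j hj
      have h1 := lowest_coeff_eq hD h i j
      rw [ih (j + 1) (by omega), mul_zero, add_zero] at h1
      exact (mul_eq_zero.mp h1).resolve_left (by simpa using hν)
  exact key ((y i).natDegree + 1) j (by omega)

theorem ExponentsFrom.add_nat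
    (hD : ∀ ν : F, (∀ i, ExponentsFrom ν (y i)) → ∀ i, ExponentsFrom ν (IntegralBasis.D (y i)))
    {ν : F} (h : ∀ i, ExponentsFrom ν (y i)) (n : ℕ)
    (hν : ∀ m < n, ν + (m : F) ≠ 0) : ∀ i, ExponentsFrom (ν + n) (y i) := by
  induction n with
  | zero => simpa using h
  | succ n ih =>
    have h1 := ih fun m hm => hν m (Nat.lt_succ_of_lt hm)
    rw [Nat.cast_succ, ← add_assoc]
    exact ExponentsFrom.succ h1 (lowest_coeff_eq_zero hD (hν n (Nat.lt_succ_self n)) h1)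

theorem eq_zero_of_exponentsFrom
    (hD : ∀ ν : F, (∀ i, ExponentsFrom ν (y i)) → ∀ i, ExponentsFrom ν (IntegralBasis.D (y i)))
    {ν : F} (h : ∀ i, ExponentsFrom ν (y i))
    (hν : ∀ m : ℕ, ν + (m : F) ≠ 0) (i : ι) : y i = 0 := by
  apply LogSeries.ext_termCoeff
  intro μ j
  rw [termCoeff_zero]
  by_contra hne
  obtain ⟨n, hn⟩ := h i μ j hne
  obtain ⟨m, hm⟩ := ExponentsFrom.add_nat hD h (n + 1) (fun m _ => hν m) i μ j hne
  have : ((m + 1 : ℕ) : F) = 0 := by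
    push_cast at hm ⊢
    linear_combination hn - hm
  exact Nat.succ_ne_zero m (Nat.cast_eq_zero.mp this)

/-- The solutions of a system of first order equations without a pole have no terms with exponents
outside `ℕ`. -/
theorem exponentsFrom_zero
    (hD : ∀ ν : F, (∀ i, ExponentsFrom ν (y i)) → ∀ i, ExponentsFrom ν (IntegralBasis.D (y i)))
    {ν : F} (h : ∀ i, ExponentsFrom ν (y i)) :
    ∀ i, ExponentsFrom 0 (y i) := by
  by_cases hν : ∃ m : ℕ, ν + (m : F) = 0
  · obtain ⟨m, hm⟩ := hν
    rw [← hm]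
    refine ExponentsFrom.add_nat hD h m fun k hk h0 => ?_
    have : (m : F) = k := by linear_combination hm - h0
    exact hk.ne (Nat.cast_injective this).symm
  · push Not at hν
    intro i μ j hne
    rw [eq_zero_of_exponentsFrom hD h hν i] at hne
    exact absurd rfl hne

/-- For `ν = 0` the lowest coefficient relation reduces to `(j + 1) c_(j+1) = 0`: only the constant
term survives, which plays the role of an initial value. -/
theorem termCoeff_zero_succ
    (hD : ∀ ν : F, (∀ i, ExponentsFrom ν (y i)) → ∀ i, ExponentsFrom ν (IntegralBasis.D (y i)))
    (h : ∀ i, ExponentsFrom 0 (y i)) (i : ι) (j : ℕ) :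
    termCoeff (y i) 0 (j + 1) = 0 := by
  have : CharZero K := charZero_of_injective_algebraMap (algebraMap F K).injective
  have h1 := lowest_coeff_eq hD h i j
  rw [map_zero, zero_mul, zero_add] at h1
  exact (mul_eq_zero.mp h1).resolve_left (Nat.cast_add_one_ne_zero j)

/-- Uniqueness for given initial values: once the constant terms vanish, all exponents are at least
`1`, and then there is no exponent to start from. -/
theorem eq_zero_of_termCoeff_zero
    (hD : ∀ ν : F, (∀ i, ExponentsFrom ν (y i)) → ∀ i, ExponentsFrom ν (IntegralBasis.D (y i)))
    (h : ∀ i, ExponentsFrom 0 (y i))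
    (h0 : ∀ i, termCoeff (y i) 0 0 = 0) (i : ι) : y i = 0 := by
  refine eq_zero_of_exponentsFrom hD (ExponentsFrom.succ h fun i j => ?_) (fun m => ?_) i
  · cases j with
    | zero => exact h0 i
    | succ j => exact termCoeff_zero_succ hD h i j
  · rw [zero_add, add_comm]
    exact Nat.cast_add_one_ne_zero m

end Ordinary

end ExponentsFrom

/-! ### Derivatives of determinants and Abel's identity -/

section Determinants

theorem derivation_prod {k R ι : Type*} [CommRing k] [CommRing R] [Algebra k R] [DecidableEq ι]
    (d : Derivation k R R) (s : Finset ι) (f : ι → R) :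
    d (∏ i ∈ s, f i) = ∑ i ∈ s, d (f i) * ∏ j ∈ s.erase i, f j := by
  induction s using Finset.induction_on with
  | empty => simp
  | insert a s ha ih =>
    rw [Finset.prod_insert ha, Derivation.leibniz, ih, Finset.sum_insert ha,
      Finset.erase_insert ha, smul_eq_mul, smul_eq_mul, add_comm, Finset.mul_sum,
      mul_comm (∏ i ∈ s, f i)]
    congr 1
    refine Finset.sum_congr rfl fun i hi => ?_
    have hia : i ≠ a := fun h => ha (h ▸ hi)
    rw [Finset.erase_insert_of_ne hia.symm, Finset.prod_insert (fun h => ha (Finset.mem_of_mem_erase h))]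
    ring

theorem derivation_det {k R n : Type*} [CommRing k] [CommRing R] [Algebra k R] [DecidableEq n]
    [Fintype n] (d : Derivation k R R) (M : Matrix n n R) :
    d M.det = ∑ i, (M.updateRow i fun j => d (M i j)).det := by
  have hdet : ∀ N : Matrix n n R, N.det =
      ∑ σ : Equiv.Perm n, ((Equiv.Perm.sign σ : ℤ) : R) * ∏ i, N i (σ i) := fun N => by
    rw [← Matrix.det_transpose, Matrix.det_apply']
    rfl
  rw [hdet, map_sum]
  simp only [hdet]
  rw [Finset.sum_comm]
  refine Finset.sum_congr rfl fun σ _ => ?_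
  rw [Derivation.leibniz, Derivation.map_intCast, smul_zero, add_zero, derivation_prod,
    smul_eq_mul, Finset.mul_sum]
  refine Finset.sum_congr rfl fun i _ => ?_
  rw [← Finset.mul_prod_erase Finset.univ _ (Finset.mem_univ i), Matrix.updateRow_self]
  congr 2
  refine Finset.prod_congr rfl fun j hj => ?_
  rw [Matrix.updateRow_ne (Finset.ne_of_mem_erase hj)]

variable {F K : Type*} [Field F] [CharZero F] [Field K] [Algebra F K]

/-- Abel's identity for Wronskians. -/
theorem D_det_wronskianMatrix {n : ℕ} (hn : 0 < n) (b : Fin n → LogSeries F K)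
    (c : Fin n → LogSeries F K) (h : ∀ j, D^[n] (b j) = ∑ i, c i * D^[i] (b j)) :
    D (wronskianMatrix b).det = c ⟨n - 1, by omega⟩ * (wronskianMatrix b).det := by
  rw [derivation_det, Finset.sum_eq_single ⟨n - 1, by omega⟩]
  · have : (fun j => D (wronskianMatrix b ⟨n - 1, by omega⟩ j)) =
        ∑ i, c i • wronskianMatrix b i := by
      ext1 j
      rw [Finset.sum_apply]
      refine Eq.trans ?_ (h j)
      change D (D^[n - 1] (b j)) = _
      rw [← Function.iterate_succ_apply' D, Nat.succ_eq_add_one, Nat.sub_add_cancel hn]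
    rw [this, Matrix.det_updateRow_sum, smul_eq_mul]
  · intro i _ hi
    have hi' : (i : ℕ) + 1 < n := by
      have := i.2
      have h2 : (i : ℕ) ≠ n - 1 := fun h => hi (Fin.ext h)
      omega
    -- Differentiating a row other than the last one produces a copy of the following row, so that
    -- determinant vanishes.
    have hne : i ≠ ⟨i + 1, hi'⟩ := fun h => by simpa using congrArg Fin.val h
    refine Matrix.det_zero_of_row_eq hne ?_
    ext1 j
    rw [Matrix.updateRow_self, Matrix.updateRow_ne hne.symm]
    exact (Function.iterate_succ_apply' D i (b j)).symm
  · intro h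
    exact absurd (Finset.mem_univ _) h

theorem det_eq_zero_of_vecMul_eq_zero {R n : Type*} [CommRing R] [DecidableEq n] [Fintype n]
    {M : Matrix n n R} {v : n → R} (h : Matrix.vecMul v M = 0) {i : n} (hi : IsUnit (v i)) :
    M.det = 0 := by
  have h1 := congrArg (fun w => Matrix.vecMul w M.adjugate) h
  simp only [Matrix.vecMul_vecMul, Matrix.mul_adjugate, Matrix.zero_vecMul, Matrix.vecMul_smul,
    Matrix.vecMul_one] at h1
  have h2 : M.det * v i = 0 := congrFun h1 i
  exact (hi.mul_left_eq_zero).mp h2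

end Determinants

section SolutionSpace

set_option linter.unusedSectionVars false

variable {F K : Type*} [Field F] [CharZero F] [Field K] [Algebra F K]

/-! ### Expansions of rational functions -/

theorem inCoset_expand (α : K) (c : RatFunc K) : InCoset (0 : F) (expand α c) := by
  intro μ j h
  rw [expand, RingHom.comp_apply, termCoeff_C] at h
  by_cases hj : j = 0
  · rw [if_pos hj] at h
    by_contra hn
    apply h
    refine HahnSeries.embDomain_of_notMem_range ?_
    rintro ⟨m, hm⟩
    exact hn ⟨m, by rw [zero_add]; exact hm.symm⟩
  · rw [if_neg hj] at h
    exact absurd rfl h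

theorem expand_eq_C (α : K) (c : RatFunc K) :
    ∃ g, (expand α c : LogSeries F K) = Polynomial.C g := ⟨_, rfl⟩

theorem isUnit_expand (α : K) {c : RatFunc K} (hc : c ≠ 0) :
    IsUnit (expand α c : LogSeries F K) := (IsUnit.mk0 c hc).map _

theorem expand_algebraMap (α : K) (p : K[X]) :
    (expand α (algebraMap K[X] (RatFunc K) p) : LogSeries F K) =
      psEmb ((Polynomial.taylor α p : K[X]) : PowerSeries K) :=
  expand_polynomial α p

theorem constantCoeff_taylor (α : K) (p : K[X]) :
    PowerSeries.constantCoeff ((Polynomial.taylor α p : K[X]) : PowerSeries K) = p.eval α := by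
  rw [← PowerSeries.coeff_zero_eq_constantCoeff_apply, Polynomial.coeff_coe, Polynomial.taylor_coeff_zero]

/-- The expansion of a rational function which is regular at `α` is a power series. -/
theorem exists_expand_eq_psEmb (α : K) (p : K[X]) {q : K[X]} (hq : q.eval α ≠ 0) :
    ∃ v : PowerSeries K, PowerSeries.constantCoeff v = p.eval α / q.eval α ∧
      (expand α (algebraMap K[X] (RatFunc K) p / algebraMap K[X] (RatFunc K) q) : LogSeries F K) =
        psEmb v := by
  have hq0 : q ≠ 0 := by rintro rfl; simp at hq
  set u : PowerSeries K := ((Polynomial.taylor α q : K[X]) : PowerSeries K) with hu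
  have huc : PowerSeries.constantCoeff u ≠ 0 := by rwa [hu, constantCoeff_taylor]
  refine ⟨((Polynomial.taylor α p : K[X]) : PowerSeries K) * u⁻¹, ?_, ?_⟩
  · rw [map_mul, PowerSeries.constantCoeff_inv, constantCoeff_taylor, hu, constantCoeff_taylor,
      div_eq_mul_inv]
  · have h1 : (psEmb u : LogSeries F K) = expand α (algebraMap K[X] (RatFunc K) q) :=
      (expand_algebraMap α q).symm
    refine (isUnit_expand (F := F) α (RatFunc.algebraMap_ne_zero hq0)).mul_left_inj.mp ?_
    rw [← map_mul, div_mul_cancel₀ _ (RatFunc.algebraMap_ne_zero hq0), expand_algebraMap, ← h1,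
      ← map_mul, mul_assoc, PowerSeries.inv_mul_cancel _ huc, mul_one]

theorem expand_X_sub_C (α : K) :
    (expand α (RatFunc.X - RatFunc.C α) : LogSeries F K) = tpow 1 := by
  have h1 := expand_X (F := F) α
  have h2 := expand_C (F := F) α α
  rw [RatFunc.algebraMap_X] at h1
  rw [RatFunc.algebraMap_C] at h2
  rw [map_sub, h1, h2, add_sub_cancel_left]
  rfl

theorem X_sub_C_ne_zero (α : K) : (RatFunc.X - RatFunc.C α : RatFunc K) ≠ 0 := by
  rw [← RatFunc.algebraMap_X, ← RatFunc.algebraMap_C, ← map_sub]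
  exact RatFunc.algebraMap_ne_zero (Polynomial.X_sub_C_ne_zero α)

theorem expand_X_sub_C_zpow (α : K) (k : ℤ) :
    (expand α ((RatFunc.X - RatFunc.C α) ^ k) : LogSeries F K) = tpow (k : F) := by
  have hnat : ∀ n : ℕ, (expand α ((RatFunc.X - RatFunc.C α) ^ n) : LogSeries F K) = tpow (n : F) := by
    intro n
    induction n with
    | zero => rw [pow_zero, map_one, Nat.cast_zero, tpow_zero]
    | succ n ih => rw [pow_succ, map_mul, ih, expand_X_sub_C, Nat.cast_succ, tpow_add]
  obtain ⟨n, rfl | rfl⟩ := k.eq_nat_or_neg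
  · rw [zpow_natCast, hnat, Int.cast_natCast]
  · refine (isUnit_expand (F := F) α (pow_ne_zero n (X_sub_C_ne_zero α))).mul_left_inj.mp ?_
    rw [← map_mul, zpow_neg, zpow_natCast,
      inv_mul_cancel₀ (pow_ne_zero n (X_sub_C_ne_zero α)), map_one, hnat, ← tpow_add]
    push_cast
    rw [neg_add_cancel, tpow_zero]

/-! ### The action of operators -/

theorem D_iterate_add (f g : LogSeries F K) (i : ℕ) : D^[i] (f + g) = D^[i] f + D^[i] g :=
  iterate_map_add D i f g

theorem D_iterate_smul (c : K) (f : LogSeries F K) (i : ℕ) : D^[i] (c • f) = c • D^[i] f := by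
  induction i with
  | zero => rfl
  | succ i ih => rw [Function.iterate_succ_apply', ih, Derivation.map_smul, Function.iterate_succ_apply']

theorem act_eq_sum (α : K) (f : LogSeries F K) (P : ℕ →₀ RatFunc K) :
    act α f P = ∑ i ∈ P.support, expand α (P i) * D^[i] f := rfl

theorem act_eq_sum_range (α : K) (f : LogSeries F K) {P : ℕ →₀ RatFunc K} {n : ℕ}
    (hP : ∀ i, n ≤ i → P i = 0) :
    act α f P = ∑ i ∈ Finset.range n, expand α (P i) * D^[i] f := by
  refine Finsupp.sum_of_support_subset P ?_ (fun i c => expand α c * D^[i] f)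
    (fun i _ => by rw [map_zero, zero_mul])
  intro i hi
  rw [Finset.mem_range]
  by_contra h
  exact Finsupp.mem_support_iff.mp hi (hP i (not_lt.mp h))

theorem act_add_right (α : K) (f g : LogSeries F K) (P : ℕ →₀ RatFunc K) :
    act α (f + g) P = act α f P + act α g P := by
  simp only [act_eq_sum, D_iterate_add, mul_add, Finset.sum_add_distrib]

theorem act_smul_right (α : K) (c : K) (f : LogSeries F K) (P : ℕ →₀ RatFunc K) :
    act α (c • f) P = c • act α f P := by
  simp only [act_eq_sum, D_iterate_smul, mul_smul_comm, Finset.smul_sum]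

/-- Differentiation with respect to the logarithm commutes with `d/dx` and with multiplication by
rational functions. It therefore maps solutions to solutions, which is used repeatedly to control
logarithms. -/
theorem derivative_act (α : K) (f : LogSeries F K) (P : ℕ →₀ RatFunc K) :
    derivative (act α f P) = act α (derivative f) P := by
  simp only [act_eq_sum, map_sum, derivative_expand_mul, derivative_D_iterate]

theorem Solution.apply_mkQ {L : ℕ →₀ F[X]} {α : K} (f : Solution L α) (P : ℕ →₀ RatFunc K) :
    f.apply ((leftIdeal K L).mkQ P) = act α f.1 P := rfl

theorem Solution.apply_quotD {L : ℕ →₀ F[X]} {α : K} (f : Solution L α) (A : OpQuot K L) :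
    f.apply (quotD A) = D (f.apply A) := by
  obtain ⟨P, rfl⟩ := (leftIdeal K L).mkQ_surjective A
  rw [quotD_mk, Solution.apply_mkQ, Solution.apply_mkQ, act_dMul]

/-- The derivative of a solution with respect to the logarithm. -/
def Solution.logDeriv {L : ℕ →₀ F[X]} {α : K} (f : Solution L α) : Solution L α :=
  ⟨derivative f.1, by rw [← derivative_act, f.2, derivative_zero]⟩

theorem Solution.apply_logDeriv {L : ℕ →₀ F[X]} {α : K} (f : Solution L α) (A : OpQuot K L) :
    f.logDeriv.apply A = derivative (f.apply A) := by
  obtain ⟨P, rfl⟩ := (leftIdeal K L).mkQ_surjective A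
  exact (derivative_act α f.1 P).symm

theorem Solution.logDeriv_isPure {L : ℕ →₀ F[X]} {α : K} {f : Solution L α} (hf : IsPure f.1) :
    IsPure f.logDeriv.1 := by
  obtain ⟨ν, hν⟩ := hf
  exact ⟨ν, ExponentsFrom.derivative hν⟩

/-! ### The order of an operator -/

variable {L : ℕ →₀ F[X]}

theorem lead_ne_zero (hord : 0 < ord L) : lead L ≠ 0 := by
  have hne : L.support.Nonempty := by
    by_contra h
    rw [Finset.not_nonempty_iff_eq_empty] at h
    simp [ord, h] at hord
  obtain ⟨i, hi, h⟩ := Finset.exists_mem_eq_sup L.support hne id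
  have : ord L = i := h
  rw [lead, this]
  exact Finsupp.mem_support_iff.mp hi

theorem apply_eq_zero_of_ord_lt {i : ℕ} (h : ord L < i) : L i = 0 := by
  by_contra hne
  have : i ≤ ord L := Finset.le_sup (f := id) (Finsupp.mem_support_iff.mpr hne)
  omega

theorem polyEmb_injective : Function.Injective (polyEmb F K) :=
  (RatFunc.algebraMap_injective K).comp (Polynomial.map_injective _ (algebraMap F K).injective)

theorem polyEmb_apply (p : F[X]) :
    polyEmb F K p = algebraMap K[X] (RatFunc K) (p.map (algebraMap F K)) := rfl

theorem polyEmb_ne_zero {p : F[X]} (hp : p ≠ 0) : polyEmb F K p ≠ 0 := by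
  rw [← map_zero (polyEmb F K)]
  exact polyEmb_injective.ne hp

theorem toRat_apply (i : ℕ) : toRat K L i = polyEmb F K (L i) := by
  simp [toRat]

/-- The coefficients of the equation `D^r f = ∑ i, c i D^i f` for the solutions `f` of `L`. -/
def solCoeff (K : Type*) [Field K] [Algebra F K] (L : ℕ →₀ F[X]) (i : ℕ) : RatFunc K :=
  -(polyEmb F K (L i) / polyEmb F K (lead L))

theorem sum_range_solution {α : K} (f : Solution L α) :
    ∑ i ∈ Finset.range (ord L + 1), expand α (toRat K L i) * D^[i] f.1 = 0 := by
  refine (act_eq_sum_range α f.1 fun i hi => ?_).symm.trans f.2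
  rw [toRat_apply, apply_eq_zero_of_ord_lt (by omega), map_zero]

theorem D_iterate_ord (hord : 0 < ord L) {α : K} (f : Solution L α) :
    D^[ord L] f.1 = ∑ i : Fin (ord L), expand α (solCoeff K L i) * D^[i] f.1 := by
  have hl : polyEmb F K (lead L) ≠ 0 := polyEmb_ne_zero (lead_ne_zero hord)
  have h := sum_range_solution f
  rw [Finset.sum_range_succ] at h
  refine (isUnit_expand (F := F) α hl).mul_right_inj.mp ?_
  have h1 : toRat K L (ord L) = polyEmb F K (lead L) := toRat_apply _
  rw [h1] at h
  rw [eq_neg_of_add_eq_zero_right h, Finset.mul_sum, ← Finset.sum_neg_distrib,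
    Finset.sum_range]
  refine Finset.sum_congr rfl fun i _ => ?_
  rw [← mul_assoc, ← map_mul, solCoeff, mul_neg, mul_div_cancel₀ _ hl, map_neg, toRat_apply]
  exact (neg_mul (expand α (polyEmb F K (L i))) (D^[i] f.1)).symm

/-- A fundamental system spans the space of all solutions in `K[[[x - α]]]`. -/
theorem IsFundamentalSystem.mem_span (hord : 0 < ord L) {α : K} {b : Fin (ord L) → Solution L α}
    (hb : IsFundamentalSystem b) (f : Solution L α) (hf : IsPure f.1) :
    f.1 ∈ Submodule.span K (Set.range fun i => (b i).1) := by
  by_contra hspan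
  have hli := (linearIndependent_finSnoc (K := K) (v := fun i => (b i).1)).mpr ⟨hb.2, hspan⟩
  obtain ⟨g, hg⟩ : ∃ g : Fin (ord L + 1) → Solution L α, g = Fin.snoc b f := ⟨_, rfl⟩
  have hgv : (Fin.snoc (fun i => (b i).1) f.1 : Fin (ord L + 1) → LogSeries F K) =
      fun j => (g j).1 := by
    ext1 j
    rw [hg]
    induction j using Fin.lastCases with
    | last => simp
    | cast j => simp
  have hpure : ∀ j, IsPure (g j).1 := by
    intro j
    rw [hg]
    induction j using Fin.lastCases with
    | last => simpa using hf
    | cast j => simpa using hb.1 j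
  rw [hgv] at hli
  -- One more independent solution would have a nonzero Wronskian of size `ord L + 1`, but the
  -- equation is a row relation of that matrix in which the coefficient of the last row is a unit.
  refine det_wronskianMatrix_ne_zero _ (fun j => (hpure j).exists_inCoset) hli ?_
  refine det_eq_zero_of_vecMul_eq_zero (v := fun i => expand α (toRat K L i)) (i := Fin.last _) ?_
    (isUnit_expand α ?_)
  · ext1 j
    refine Eq.trans ?_ (sum_range_solution (g j))
    exact (Finset.sum_range fun i => expand α (toRat K L i) * D^[i] (g j).1).symm
  · rw [Fin.val_last, toRat_apply]
    exact polyEmb_ne_zero (lead_ne_zero hord)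

/-- Since a fundamental system spans all pure solutions and `A · f` is `K`-linear in `f`,
integrality need only be tested on the system. -/
theorem IsFundamentalSystem.apply_induction (hord : 0 < ord L) {α : K}
    {b : Fin (ord L) → Solution L α} (hb : IsFundamentalSystem b) (A : OpQuot K L)
    {p : LogSeries F K → Prop} (h0 : p 0) (hadd : ∀ f g, p f → p g → p (f + g))
    (hsmul : ∀ (c : K) f, p f → p (c • f)) (h : ∀ i, p ((b i).apply A)) (f : Solution L α)
    (hf : IsPure f.1) : p (f.apply A) := by
  obtain ⟨P, rfl⟩ := (leftIdeal K L).mkQ_surjective A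
  rw [Solution.apply_mkQ]
  have hmem := hb.mem_span hord f hf
  generalize f.1 = g at hmem
  induction hmem using Submodule.span_induction with
  | mem x hx =>
    obtain ⟨i, rfl⟩ := hx
    exact h i
  | zero =>
    have := act_smul_right α 0 (0 : LogSeries F K) P
    rw [zero_smul, zero_smul] at this
    rwa [this]
  | add x y _ _ hx hy => rw [act_add_right]; exact hadd _ _ hx hy
  | smul c x _ hx => rw [act_smul_right]; exact hsmul _ _ hx

theorem det_fundamental_ne_zero {α : K} {b : Fin (ord L) → Solution L α}
    (hb : IsFundamentalSystem b) : (wronskianMatrix fun j => (b j).1).det ≠ 0 :=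
  det_wronskianMatrix_ne_zero _ (fun j => (hb.1 j).exists_inCoset) hb.2

theorem D_det_fundamental (hord : 0 < ord L) {α : K} (b : Fin (ord L) → Solution L α) :
    D (wronskianMatrix fun j => (b j).1).det =
      expand α (solCoeff K L (ord L - 1)) * (wronskianMatrix fun j => (b j).1).det :=
  D_det_wronskianMatrix hord _ (fun i => expand α (solCoeff K L i)) fun j => D_iterate_ord hord (b j)

/-! ### Ordinary points -/

theorem eval_map_lead {α : K} (hα : aeval α (lead L) ≠ 0) :
    ((lead L).map (algebraMap F K)).eval α ≠ 0 := by
  rwa [Polynomial.eval_map_algebraMap]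

theorem exists_expand_solCoeff {α : K} (hα : aeval α (lead L) ≠ 0) (i : ℕ) :
    ∃ v : PowerSeries K, (expand α (solCoeff K L i) : LogSeries F K) = psEmb v := by
  obtain ⟨v, -, hv⟩ := exists_expand_eq_psEmb (F := F) α (-((L i).map (algebraMap F K)))
    (eval_map_lead hα)
  refine ⟨v, ?_⟩
  rw [← hv, solCoeff, polyEmb_apply, polyEmb_apply, map_neg (algebraMap K[X] (RatFunc K)), neg_div]

/-- The companion system of `L` has no pole at a point where the leading coefficient does not
vanish; this verifies the hypothesis on first order systems. -/
theorem exponentsFrom_D_of_ordinary (hord : 0 < ord L) {α : K} (hα : aeval α (lead L) ≠ 0)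
    (f : Solution L α) (ν : F) (h : ∀ i : Fin (ord L), ExponentsFrom ν (D^[i] f.1))
    (i : Fin (ord L)) : ExponentsFrom ν (D (D^[i] f.1)) := by
  rw [← Function.iterate_succ_apply' D]
  rcases (Nat.succ_le_of_lt i.2).lt_or_eq with hi | hi
  · exact h ⟨_, hi⟩
  · rw [hi, D_iterate_ord hord]
    refine ExponentsFrom.sum _ fun k _ => ?_
    obtain ⟨v, hv⟩ := exists_expand_solCoeff (F := F) hα k
    rw [hv]
    exact exponents_psEmb_mul (h k) v

theorem exponentsFrom_zero_of_ordinary (hord : 0 < ord L) {α : K} (hα : aeval α (lead L) ≠ 0)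
    (f : Solution L α) (hf : IsPure f.1) (i : Fin (ord L)) : ExponentsFrom 0 (D^[i] f.1) := by
  obtain ⟨ν, hν⟩ := hf
  obtain ⟨ν', hν'⟩ := ExponentsFrom.exists_D_iterate hν (ord L)
  exact exponentsFrom_zero (y := fun i : Fin (ord L) => D^[i] f.1)
    (exponentsFrom_D_of_ordinary hord hα f) (fun i => hν' i i.2) i

/-- The logarithmic derivative of `f` is again a solution. Its initial values are the coefficients
of `t^0 log t` in `f` and its derivatives, which vanish. -/
theorem derivative_eq_zero_of_ordinary (hord : 0 < ord L) {α : K} (hα : aeval α (lead L) ≠ 0)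
    (f : Solution L α) (hf : IsPure f.1) : derivative f.1 = 0 := by
  have h0 := eq_zero_of_termCoeff_zero (y := fun i : Fin (ord L) => D^[i] f.logDeriv.1)
    (exponentsFrom_D_of_ordinary hord hα f.logDeriv)
    (exponentsFrom_zero_of_ordinary hord hα _ (Solution.logDeriv_isPure hf)) ?_ ⟨0, hord⟩
  · exact h0
  · intro i
    change termCoeff (D^[i] (derivative f.1)) 0 0 = 0
    rw [← derivative_D_iterate, termCoeff_derivative]
    have := termCoeff_zero_succ (y := fun i : Fin (ord L) => D^[i] f.1)
      (exponentsFrom_D_of_ordinary hord hα f) (exponentsFrom_zero_of_ordinary hord hα f hf) i 0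
    rw [this, mul_zero]

theorem exponentsFrom_det_of_ordinary (hord : 0 < ord L) {α : K} (hα : aeval α (lead L) ≠ 0)
    {b : Fin (ord L) → Solution L α} (hb : IsFundamentalSystem b) :
    ExponentsFrom 0 (wronskianMatrix fun j => (b j).1).det ∧
      termCoeff (wronskianMatrix fun j => (b j).1).det 0 0 ≠ 0 := by
  have h1 : ExponentsFrom 0 (wronskianMatrix fun j => (b j).1).det :=
    ExponentsFrom.det fun i j => exponentsFrom_zero_of_ordinary hord hα (b j) (hb.1 j) i
  refine ⟨h1, fun h0 => ?_⟩
  -- By Abel's identity the Wronskian alone forms a system of size one without a pole, so a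
  -- vanishing constant term would make it zero.
  refine det_fundamental_ne_zero hb (eq_zero_of_termCoeff_zero
    (y := fun _ : Unit => (wronskianMatrix fun j => (b j).1).det) ?_ (fun _ => h1) (fun _ => h0) ())
  intro ν h i
  rw [D_det_fundamental hord]
  obtain ⟨v, hv⟩ := exists_expand_solCoeff (F := F) hα (ord L - 1)
  rw [hv]
  exact exponents_psEmb_mul (h i) v

end SolutionSpace

section Integrality

set_option linter.unusedSectionVars false

variable {F K : Type*} [Field F] [CharZero F] [Field K] [Algebra F K]
  {ι : ModInt F → ℕ → F}

/-! ### Integral series -/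

theorem modInt_add_int (μ : F) (n : ℤ) : ((μ + n : F) : ModInt F) = (μ : ModInt F) := by
  rw [QuotientAddGroup.eq]
  exact ⟨-n, by simp⟩

theorem modInt_add_nat (μ : F) (n : ℕ) : ((μ + n : F) : ModInt F) = (μ : ModInt F) := by
  have := modInt_add_int μ n
  rwa [Int.cast_natCast] at this

theorem IsIntegralSeries.add {f g : LogSeries F K} (hf : IsIntegralSeries ι f)
    (hg : IsIntegralSeries ι g) : IsIntegralSeries ι (f + g) := by
  intro μ j h
  by_cases h1 : termCoeff f μ j = 0
  · exact hg μ j (by simpa [h1] using h)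
  · exact hf μ j h1

theorem isIntegralSeries_zero : IsIntegralSeries ι (0 : LogSeries F K) :=
  fun _ _ h => absurd rfl h

theorem IsIntegralSeries.neg {f : LogSeries F K} (hf : IsIntegralSeries ι f) :
    IsIntegralSeries ι (-f) := fun μ j h => hf μ j (by simpa using h)

theorem IsIntegralSeries.sub {f g : LogSeries F K} (hf : IsIntegralSeries ι f)
    (hg : IsIntegralSeries ι g) : IsIntegralSeries ι (f - g) := by
  rw [sub_eq_add_neg]
  exact hf.add hg.neg

theorem IsIntegralSeries.sum {β : Type*} (s : Finset β) {f : β → LogSeries F K}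
    (hf : ∀ i ∈ s, IsIntegralSeries ι (f i)) : IsIntegralSeries ι (∑ i ∈ s, f i) := by
  intro μ j h
  rw [termCoeff_sum] at h
  obtain ⟨i, hi, hne⟩ := Finset.exists_ne_zero_of_sum_ne_zero h
  exact hf i hi μ j hne

theorem IsIntegralSeries.smul {f : LogSeries F K} (hf : IsIntegralSeries ι f) (c : K) :
    IsIntegralSeries ι (c • f) := fun μ j h =>
  hf μ j fun h0 => h (by rw [termCoeff_smul, h0, mul_zero])

theorem IsIntegralSeries.mul (hι : IsThreshold ι) {f g : LogSeries F K}
    (hf : IsIntegralSeries ι f) (hg : IsIntegralSeries ι g) : IsIntegralSeries ι (f * g) := by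
  intro κ j h
  obtain ⟨μ₁, μ₂, j₁, j₂, h1, h2, rfl, rfl⟩ := termCoeff_mul_ne_zero h
  obtain ⟨n, hn⟩ := hf _ _ h1
  obtain ⟨m, hm⟩ := hg _ _ h2
  obtain ⟨k, hk⟩ := hι.subadditive μ₁ μ₂ j₁ j₂
  exact ⟨n + m + k, by push_cast; linear_combination hn + hm + hk⟩

theorem isIntegralSeries_of_exponentsFrom_zero (hι : IsThreshold ι) {f : LogSeries F K}
    (hf : ExponentsFrom 0 f) (hd : ∀ μ j, j ≠ 0 → termCoeff f μ j = 0) : IsIntegralSeries ι f := by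
  intro μ j h
  obtain ⟨n, rfl⟩ := hf μ j h
  have hj : j = 0 := by
    by_contra hj
    exact h (hd _ _ hj)
  exact ⟨n, by rw [modInt_add_nat, hj, hι.zero, zero_add, sub_zero]⟩

theorem isIntegralSeries_psEmb (hι : IsThreshold ι) (v : PowerSeries K) :
    IsIntegralSeries ι (psEmb v : LogSeries F K) := by
  refine isIntegralSeries_of_exponentsFrom_zero hι (fun μ j h => ?_) fun μ j hj => ?_
  · obtain ⟨⟨n, hn⟩, -⟩ := termCoeff_psEmb_ne_zero h
    exact ⟨n, by rw [hn, zero_add]⟩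
  · by_contra h
    exact hj (termCoeff_psEmb_ne_zero h).2

theorem isIntegralSeries_one (hι : IsThreshold ι) : IsIntegralSeries ι (1 : LogSeries F K) := by
  rw [← map_one psEmb]
  exact isIntegralSeries_psEmb hι 1

theorem IsIntegralSeries.prod (hι : IsThreshold ι) {β : Type*} (s : Finset β)
    {f : β → LogSeries F K} (hf : ∀ i ∈ s, IsIntegralSeries ι (f i)) :
    IsIntegralSeries ι (∏ i ∈ s, f i) := by
  classical
  induction s using Finset.induction_on with
  | empty => simpa using isIntegralSeries_one hι
  | insert a s ha ih =>
    rw [Finset.prod_insert ha]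
    exact (hf a (Finset.mem_insert_self _ _)).mul hι
      (ih fun i hi => hf i (Finset.mem_insert_of_mem hi))

theorem IsIntegralSeries.det (hι : IsThreshold ι) {n : Type*} [Fintype n] [DecidableEq n]
    {M : Matrix n n (LogSeries F K)} (h : ∀ i j, IsIntegralSeries ι (M i j)) :
    IsIntegralSeries ι M.det := by
  rw [Matrix.det_apply]
  refine IsIntegralSeries.sum _ fun σ _ => ?_
  have := IsIntegralSeries.prod hι Finset.univ fun j _ => h (σ j) j
  rcases Int.units_eq_one_or (Equiv.Perm.sign σ) with hs | hs
  · simpa [hs] using this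
  · simpa [hs] using this.neg

/-! ### Lowest terms -/

/-- The exponents of `f` belong to `ν + ℕ`, and `(x - α)^ν` occurs in `f`. -/
def HasLowest (ν : F) (f : LogSeries F K) : Prop :=
  ExponentsFrom ν f ∧ termCoeff f ν 0 ≠ 0

theorem HasLowest.psEmb_mul {ν : F} {f : LogSeries F K} (hf : HasLowest ν f) {v : PowerSeries K}
    (hv : PowerSeries.constantCoeff v ≠ 0) : HasLowest ν (psEmb v * f) :=
  ⟨exponents_psEmb_mul hf.1 v, by
    rw [termCoeff_psEmb_mul_lowest hf.1]
    exact mul_ne_zero hv hf.2⟩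

theorem HasLowest.tpow_mul {ν : F} {f : LogSeries F K} (hf : HasLowest ν f) (κ : F) :
    HasLowest (ν + κ) (tpow κ * f) := by
  refine ⟨fun μ j h => ?_, ?_⟩
  · rw [termCoeff_tpow_mul] at h
    obtain ⟨n, hn⟩ := hf.1 _ _ h
    exact ⟨n, by linear_combination hn⟩
  · rw [termCoeff_tpow_mul, add_sub_cancel_right]
    exact hf.2

theorem expand_polynomial_factor (α : K) {q : K[X]} (hq : q ≠ 0) :
    ∃ v : PowerSeries K, PowerSeries.constantCoeff v ≠ 0 ∧
      (expand α (algebraMap K[X] (RatFunc K) q) : LogSeries F K) =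
        tpow (q.rootMultiplicity α : F) * psEmb v := by
  obtain ⟨q₁, h1, h2⟩ := Polynomial.exists_eq_pow_rootMultiplicity_mul_and_not_dvd q hq α
  refine ⟨((Polynomial.taylor α q₁ : K[X]) : PowerSeries K), ?_, ?_⟩
  · rw [constantCoeff_taylor]
    exact fun h => h2 (Polynomial.dvd_iff_isRoot.mpr h)
  · have h3 := expand_X_sub_C_zpow (F := F) α (q.rootMultiplicity α)
    rw [zpow_natCast, Int.cast_natCast] at h3
    rw [← h3, ← expand_algebraMap, ← map_mul, ← RatFunc.algebraMap_X, ← RatFunc.algebraMap_C,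
      ← map_sub, ← map_pow, ← map_mul, ← h1]

theorem HasLowest.expand_mul {ν : F} {f : LogSeries F K} (hf : HasLowest ν f) (α : K) {q : K[X]}
    (hq : q ≠ 0) :
    HasLowest (ν + (q.rootMultiplicity α : F)) (expand α (algebraMap K[X] (RatFunc K) q) * f) := by
  obtain ⟨v, hv, h⟩ := expand_polynomial_factor (F := F) α hq
  rw [h, mul_assoc]
  exact (hf.psEmb_mul hv).tpow_mul _

theorem exists_hasLowest {ν : F} {f : LogSeries F K} (h0 : f ≠ 0) (hf : InCoset ν f)
    (hd : f.natDegree = 0) : ∃ ν₀, HasLowest ν₀ f := by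
  rw [Polynomial.eq_C_of_natDegree_eq_zero hd] at h0 ⊢
  have hc0 : f.coeff 0 ≠ 0 := fun h => h0 (by rw [h, Polynomial.C_0])
  obtain ⟨ν₀, v, hv, -, hh⟩ := exists_eq_single_mul_psH hc0 fun μ h => hf μ 0 h
  refine ⟨ν₀, ?_⟩
  have h1 : HasLowest (0 : F) (1 : LogSeries F K) := by
    refine ⟨fun μ j h => ?_, ?_⟩
    · rw [← tpow_zero] at h
      exact ⟨0, by rw [(termCoeff_tpow _ _ _ h).1]; simp⟩
    · change termCoeff (Polynomial.C 1) 0 0 ≠ 0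
      rw [termCoeff_C, if_pos rfl]
      change (1 : HahnSeries (Expo F) K).coeff 0 ≠ 0
      simp [HahnSeries.coeff_one]
  have h2 := (h1.psEmb_mul hv).tpow_mul ν₀
  rw [zero_add, mul_one] at h2
  rw [hh, Polynomial.C_mul]
  exact h2

theorem HasLowest.isLeast_levels {ν : F} {f : LogSeries F K} (h : HasLowest ν f)
    (hf : IsIntegralSeries ι f) :
    ∃ m : ℕ, ν = ι (ν : ModInt F) 0 + m ∧ IsLeast (levels ι f) m := by
  obtain ⟨m, hm⟩ := hf _ _ h.2
  have hm' : ν = ι (ν : ModInt F) 0 + m := by linear_combination hm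
  refine ⟨m, hm', ⟨ν, h.2, hm'⟩, ?_⟩
  rintro k ⟨μ, hμ, hk⟩
  obtain ⟨n, rfl⟩ := h.1 _ _ hμ
  rw [modInt_add_nat] at hk
  have : ((m + n : ℕ) : F) = k := by push_cast; linear_combination hk - hm'
  have := Nat.cast_injective this
  omega

/-! ### Generalized Wronskians -/

variable {L : ℕ →₀ F[X]}

/-- `A · f` is integral for all solutions `f` at `α`. -/
def IsIntegralAt (ι : ModInt F → ℕ → F) (α : K) (A : OpQuot K L) : Prop :=
  ∀ f : Solution L α, IsPure f.1 → IsIntegralSeries ι (f.apply A)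

/-- `B i` is represented by an operator of order `i` with leading coefficient `lc i`. -/
def IsTriangular (B : ℕ → OpQuot K L) (lc : ℕ → RatFunc K) : Prop :=
  ∀ i < ord L, ∃ P : ℕ →₀ RatFunc K, (∀ k, i < k → P k = 0) ∧ P i = lc i ∧
    (leftIdeal K L).mkQ P = B i

/-- The coefficients of the representing operators form a lower triangular matrix with diagonal
`lc`, which multiplies the classical Wronskian matrix from the left. -/
theorem genWronskian_eq {B : ℕ → OpQuot K L} {lc : ℕ → RatFunc K} (hB : IsTriangular B lc) {α : K}
    (b : Fin (ord L) → Solution L α) :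
    genWronskian b B =
      expand α (∏ i : Fin (ord L), lc i) * (wronskianMatrix fun j => (b j).1).det := by
  choose P hP hlc hmk using fun i : Fin (ord L) => hB i i.2
  have hmul : (Matrix.of fun i j : Fin (ord L) => (b j).apply (B i)) =
      (Matrix.of fun i k : Fin (ord L) => (expand α (P i k) : LogSeries F K)) *
        wronskianMatrix fun j => (b j).1 := by
    ext1 i j
    rw [Matrix.mul_apply, Matrix.of_apply, ← hmk, Solution.apply_mkQ,
      act_eq_sum_range α _ fun k hk => hP i k (lt_of_lt_of_le i.2 hk)]
    exact Finset.sum_range fun k => expand α (P i k) * D^[k] (b j).1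
  rw [genWronskian, hmul, Matrix.det_mul, Matrix.det_of_isLowerTriangular, map_prod]
  · congr 1
    exact Finset.prod_congr rfl fun i _ => by rw [Matrix.of_apply, hlc]
  · intro i k hik
    rw [Matrix.of_apply, hP i k (by simpa using hik), map_zero]

theorem genWronskian_ne_zero {B : ℕ → OpQuot K L} {lc : ℕ → RatFunc K} (hB : IsTriangular B lc)
    (hlc : ∀ i < ord L, lc i ≠ 0) {α : K} {b : Fin (ord L) → Solution L α}
    (hb : IsFundamentalSystem b) : genWronskian b B ≠ 0 := by
  rw [genWronskian_eq hB]
  have hu : IsUnit (expand α (∏ i : Fin (ord L), lc i) : LogSeries F K) :=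
    isUnit_expand α (Finset.prod_ne_zero_iff.mpr fun i _ => hlc i i.2)
  exact fun h => det_fundamental_ne_zero hb ((hu.mul_right_eq_zero).mp h)

/-- The factor `g` is the logarithmic derivative of `∏ lc i` plus the coefficient in Abel's
identity, neither of which involves `α`. -/
theorem D_genWronskian (hord : 0 < ord L) {B : ℕ → OpQuot K L} {lc : ℕ → RatFunc K}
    (hB : IsTriangular B lc) (hlc : ∀ i < ord L, lc i ≠ 0) :
    ∃ g : RatFunc K, ∀ (α : K) (b : Fin (ord L) → Solution L α),
      D (genWronskian b B) = expand α g * genWronskian b B := by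
  set c : RatFunc K := ∏ i : Fin (ord L), lc i with hc
  have hc0 : c ≠ 0 := Finset.prod_ne_zero_iff.mpr fun i _ => hlc i i.2
  refine ⟨ratDeriv c / c + solCoeff K L (ord L - 1), fun α b => ?_⟩
  rw [genWronskian_eq hB, Derivation.leibniz, D_det_fundamental hord, D_expand, smul_eq_mul,
    smul_eq_mul]
  have h1 : (expand α (ratDeriv c) : LogSeries F K) = expand α (ratDeriv c / c) * expand α c := by
    rw [← map_mul, div_mul_cancel₀ _ hc0]
  rw [h1, map_add]
  ring

theorem inCoset_genWronskian {B : ℕ → OpQuot K L} {lc : ℕ → RatFunc K} (hB : IsTriangular B lc)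
    {α : K} {b : Fin (ord L) → Solution L α} (hb : IsFundamentalSystem b) :
    ∃ ν, InCoset ν (genWronskian b B) := by
  choose ν hν using fun j => (hb.1 j).exists_inCoset
  rw [genWronskian_eq hB]
  exact ⟨_, (inCoset_expand α _).mul (InCoset.det fun i j => (hν j).D_iterate i)⟩

theorem isUnit_leadingCoeff_genWronskian {B : ℕ → OpQuot K L} {lc : ℕ → RatFunc K}
    (hB : IsTriangular B lc) (hlc : ∀ i < ord L, lc i ≠ 0) {α : K}
    {b : Fin (ord L) → Solution L α} (hb : IsFundamentalSystem b) :
    IsUnit (genWronskian b B).leadingCoeff := by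
  obtain ⟨ν, hν⟩ := inCoset_genWronskian hB hb
  exact hν.leadingCoeff_isUnit (genWronskian_ne_zero hB hlc hb)

theorem natDegree_genWronskian (hord : 0 < ord L) {B : ℕ → OpQuot K L} {lc : ℕ → RatFunc K}
    (hB : IsTriangular B lc) (hlc : ∀ i < ord L, lc i ≠ 0) {α : K}
    {b : Fin (ord L) → Solution L α} (hb : IsFundamentalSystem b) :
    (genWronskian b B).natDegree = 0 := by
  obtain ⟨g, hg⟩ := D_genWronskian hord hB hlc
  obtain ⟨h, hh⟩ := expand_eq_C (F := F) α g
  exact natDegree_eq_zero_of_D_eq (isUnit_leadingCoeff_genWronskian hB hlc hb) (hh ▸ hg α b)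

theorem exists_hasLowest_genWronskian (hord : 0 < ord L) {B : ℕ → OpQuot K L}
    {lc : ℕ → RatFunc K} (hB : IsTriangular B lc) (hlc : ∀ i < ord L, lc i ≠ 0) {α : K}
    {b : Fin (ord L) → Solution L α} (hb : IsFundamentalSystem b) :
    ∃ ν, HasLowest ν (genWronskian b B) := by
  obtain ⟨ν, hν⟩ := inCoset_genWronskian hB hb
  exact exists_hasLowest (genWronskian_ne_zero hB hlc hb) hν (natDegree_genWronskian hord hB hlc hb)

theorem isIntegralSeries_genWronskian (hι : IsThreshold ι) {B : ℕ → OpQuot K L} {α : K}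
    (hB : ∀ i < ord L, IsIntegralAt ι α (B i))
    {b : Fin (ord L) → Solution L α} (hb : IsFundamentalSystem b) :
    IsIntegralSeries ι (genWronskian b B) :=
  IsIntegralSeries.det hι fun i j => hB i i.2 (b j) (hb.1 j)

/-- Both Wronskians solve the same first order equation, so the second one is a constant multiple of
the first. -/
theorem levels_genWronskian_subset (hord : 0 < ord L) {B : ℕ → OpQuot K L}
    {lc : ℕ → RatFunc K} (hB : IsTriangular B lc) (hlc : ∀ i < ord L, lc i ≠ 0) {α : K}
    {b : Fin (ord L) → Solution L α} (hb : IsFundamentalSystem b)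
    (b' : Fin (ord L) → Solution L α) :
    levels ι (genWronskian b' B) ⊆ levels ι (genWronskian b B) := by
  obtain ⟨g, hg⟩ := D_genWronskian hord hB hlc
  obtain ⟨c, hc⟩ := eq_smul_of_mul_D_eq (isUnit_leadingCoeff_genWronskian hB hlc hb)
    (b := genWronskian b' B) (by rw [hg, hg]; ring)
  rintro m ⟨μ, hμ, hm⟩
  refine ⟨μ, fun h0 => hμ ?_, hm⟩
  rw [hc, termCoeff_smul, h0, mul_zero]

theorem isLeast_wronskianLevel (hι : IsThreshold ι) (hord : 0 < ord L) {B : ℕ → OpQuot K L}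
    {lc : ℕ → RatFunc K} (hB : IsTriangular B lc) (hlc : ∀ i < ord L, lc i ≠ 0) {α : K}
    (hint : ∀ i < ord L, IsIntegralAt ι α (B i))
    {b : Fin (ord L) → Solution L α} (hb : IsFundamentalSystem b) :
    IsLeast (levels ι (genWronskian b B)) (wronskianLevel ι B α) := by
  obtain ⟨ν, hν⟩ := exists_hasLowest_genWronskian hord hB hlc hb
  obtain ⟨m, -, hm⟩ := hν.isLeast_levels (isIntegralSeries_genWronskian hι hint hb)
  -- The definition of the level ranges over all fundamental systems; a single one already gives the
  -- whole set.
  have : {m | ∃ b : Fin (ord L) → Solution L α, IsFundamentalSystem b ∧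
      m ∈ levels ι (genWronskian b B)} = levels ι (genWronskian b B) := by
    ext k
    constructor
    · rintro ⟨b', -, hk⟩
      exact levels_genWronskian_subset hord hB hlc hb b' hk
    · intro hk
      exact ⟨b, hb, hk⟩
  rw [wronskianLevel, this]
  exact ⟨Nat.sInf_mem ⟨m, hm.1⟩, fun k hk => Nat.sInf_le hk⟩

theorem HasLowest.eq_add_wronskianLevel (hι : IsThreshold ι) (hord : 0 < ord L)
    {B : ℕ → OpQuot K L}
    {lc : ℕ → RatFunc K} (hB : IsTriangular B lc) (hlc : ∀ i < ord L, lc i ≠ 0) {α : K}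
    (hint : ∀ i < ord L, IsIntegralAt ι α (B i))
    {b : Fin (ord L) → Solution L α} (hb : IsFundamentalSystem b) {ν : F}
    (hν : HasLowest ν (genWronskian b B)) :
    ν = ι (ν : ModInt F) 0 + wronskianLevel ι B α := by
  obtain ⟨m, hm, hm'⟩ := hν.isLeast_levels (isIntegralSeries_genWronskian hι hint hb)
  rwa [← hm'.unique (isLeast_wronskianLevel hι hord hB hlc hint hb)]

/-- Division of the leading coefficients by a polynomial lowers the level by the multiplicity. -/
theorem wronskianLevel_add_rootMultiplicity (hι : IsThreshold ι) (hord : 0 < ord L) (hL : IsRegular K L)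
    {B B' : ℕ → OpQuot K L} {lc lc' : ℕ → RatFunc K} (hB : IsTriangular B lc)
    (hB' : IsTriangular B' lc') (hlc : ∀ i < ord L, lc i ≠ 0) (hlc' : ∀ i < ord L, lc' i ≠ 0)
    {α : K} (hint : ∀ i < ord L, IsIntegralAt ι α (B i))
    (hint' : ∀ i < ord L, IsIntegralAt ι α (B' i)) {q : K[X]} (hq : q ≠ 0)
    (h : ∏ i : Fin (ord L), lc i =
      algebraMap K[X] (RatFunc K) q * ∏ i : Fin (ord L), lc' i) :
    wronskianLevel ι B' α + q.rootMultiplicity α = wronskianLevel ι B α := by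
  obtain ⟨b, hb⟩ := hL α
  obtain ⟨ν', hν'⟩ := exists_hasLowest_genWronskian hord hB' hlc' hb
  have hν := hν'.expand_mul α hq
  rw [genWronskian_eq hB', ← mul_assoc, ← map_mul, ← h, ← genWronskian_eq hB] at hν
  have h1 := hν.eq_add_wronskianLevel hι hord hB hlc hint hb
  have h2 := hν'.eq_add_wronskianLevel hι hord hB' hlc' hint' hb
  -- The two lowest exponents differ by an integer, so they are compared with the same value of `ι`.
  rw [modInt_add_nat] at h1
  have h3 : ((wronskianLevel ι B' α + q.rootMultiplicity α : ℕ) : F) = wronskianLevel ι B α := by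
    push_cast
    linear_combination h1 - h2
  exact Nat.cast_injective h3

/-- The lowest exponent is `0`, since the classical Wronskian has a nonzero constant term and the
factor `∏ lc i` is a unit at `α`; and `ι` is normalized to `0` there. -/
theorem wronskianLevel_eq_zero_of_ordinary (hι : IsThreshold ι) (hord : 0 < ord L)
    (hL : IsRegular K L) {B : ℕ → OpQuot K L}
    {lc : ℕ → RatFunc K} (hB : IsTriangular B lc) (hlc : ∀ i < ord L, lc i ≠ 0) {α : K}
    (hint : ∀ i < ord L, IsIntegralAt ι α (B i)) (hα : aeval α (lead L) ≠ 0)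
    {v : PowerSeries K} (hv : PowerSeries.constantCoeff v ≠ 0)
    (h : (expand α (∏ i : Fin (ord L), lc i) : LogSeries F K) = psEmb v) :
    wronskianLevel ι B α = 0 := by
  obtain ⟨b, hb⟩ := hL α
  have h1 : HasLowest 0 (genWronskian b B) := by
    rw [genWronskian_eq hB, h]
    exact HasLowest.psEmb_mul (exponentsFrom_det_of_ordinary hord hα hb) hv
  have h2 := h1.eq_add_wronskianLevel hι hord hB hlc hint hb
  rw [hι.zero, zero_add] at h2
  exact (Nat.cast_eq_zero.mp h2.symm)

end Integrality

section IntegralElements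

set_option linter.unusedSectionVars false

variable {F K : Type*} [Field F] [CharZero F] [Field K] [Algebra F K]
  {ι : ModInt F → ℕ → F} {L : ℕ →₀ F[X]}

/-! ### Regular rational functions -/

/-- The expansion of `c` at `α` is a power series. -/
def IsRegularAt (F : Type*) [Field F] [CharZero F] (α : K) (c : RatFunc K) : Prop :=
  ∃ v : PowerSeries K, (expand α c : LogSeries F K) = psEmb v

/-- The expansion of `c` at `α` is an invertible power series. -/
def IsUnitAt (F : Type*) [Field F] [CharZero F] (α : K) (c : RatFunc K) : Prop :=
  ∃ v : PowerSeries K, PowerSeries.constantCoeff v ≠ 0 ∧ (expand α c : LogSeries F K) = psEmb v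

theorem IsUnitAt.isRegularAt {α : K} {c : RatFunc K} (h : IsUnitAt F α c) : IsRegularAt F α c := by
  obtain ⟨v, -, hv⟩ := h
  exact ⟨v, hv⟩

theorem isRegularAt_algebraMap (α : K) (p : K[X]) :
    IsRegularAt F α (algebraMap K[X] (RatFunc K) p) := ⟨_, expand_algebraMap α p⟩

theorem isUnitAt_algebraMap {α : K} {p : K[X]} (hp : p.eval α ≠ 0) :
    IsUnitAt F α (algebraMap K[X] (RatFunc K) p) :=
  ⟨_, by rwa [constantCoeff_taylor], expand_algebraMap α p⟩

theorem IsUnitAt.ne_zero {α : K} {c : RatFunc K} (h : IsUnitAt F α c) : c ≠ 0 := by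
  rintro rfl
  obtain ⟨v, hv, h⟩ := h
  rw [map_zero] at h
  have h1 := termCoeff_psEmb_mul_lowest (F := F) (f := tpow (0 : F)) (ν := 0)
    (fun μ j h => ⟨0, by rw [(termCoeff_tpow _ _ _ h).1]; simp⟩) v 0
  rw [← h, zero_mul, termCoeff_zero, tpow_zero] at h1
  have h2 : termCoeff (1 : LogSeries F K) 0 0 = 1 := by
    change termCoeff (Polynomial.C 1) 0 0 = 1
    rw [termCoeff_C, if_pos rfl]
    change (1 : HahnSeries (Expo F) K).coeff 0 = 1
    simp [HahnSeries.coeff_one]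
  rw [h2, mul_one] at h1
  exact hv h1.symm

theorem IsUnitAt.inv {α : K} {c : RatFunc K} (h : IsUnitAt F α c) : IsUnitAt F α c⁻¹ := by
  have hc := h.ne_zero
  obtain ⟨v, hv, h⟩ := h
  refine ⟨v⁻¹, ?_, (isUnit_expand (F := F) α hc).mul_left_inj.mp ?_⟩
  · rw [PowerSeries.constantCoeff_inv]
    exact inv_ne_zero hv
  · rw [← map_mul, inv_mul_cancel₀ hc, map_one, h, ← map_mul, PowerSeries.inv_mul_cancel _ hv,
      map_one]

theorem IsUnitAt.mul {α : K} {c d : RatFunc K} (hc : IsUnitAt F α c) (hd : IsUnitAt F α d) :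
    IsUnitAt F α (c * d) := by
  obtain ⟨v, hv, h⟩ := hc
  obtain ⟨w, hw, h'⟩ := hd
  exact ⟨v * w, by rw [map_mul]; exact mul_ne_zero hv hw, by rw [map_mul, map_mul, h, h']⟩

theorem isUnitAt_one (α : K) : IsUnitAt F α (1 : RatFunc K) :=
  ⟨1, by rw [map_one]; exact one_ne_zero, by rw [map_one, map_one]⟩

theorem IsUnitAt.pow {α : K} {c : RatFunc K} (hc : IsUnitAt F α c) (n : ℕ) :
    IsUnitAt F α (c ^ n) := by
  induction n with
  | zero => rw [pow_zero]; exact isUnitAt_one α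
  | succ n ih => rw [pow_succ]; exact ih.mul hc

theorem IsUnitAt.zpow {α : K} {c : RatFunc K} (hc : IsUnitAt F α c) (k : ℤ) :
    IsUnitAt F α (c ^ k) := by
  obtain ⟨n, rfl | rfl⟩ := k.eq_nat_or_neg
  · rw [zpow_natCast]; exact hc.pow n
  · rw [zpow_neg, zpow_natCast]; exact (hc.pow n).inv

theorem IsUnitAt.prod {α : K} {β : Type*} (s : Finset β) {c : β → RatFunc K}
    (hc : ∀ i ∈ s, IsUnitAt F α (c i)) : IsUnitAt F α (∏ i ∈ s, c i) := by
  classical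
  induction s using Finset.induction_on with
  | empty => rw [Finset.prod_empty]; exact isUnitAt_one α
  | insert a s ha ih =>
    rw [Finset.prod_insert ha]
    exact (hc a (Finset.mem_insert_self _ _)).mul
      (ih fun i hi => hc i (Finset.mem_insert_of_mem hi))

theorem algebraMap_X_sub_C (α : K) :
    algebraMap K[X] (RatFunc K) (X - C α) = RatFunc.X - RatFunc.C α := by
  rw [map_sub, RatFunc.algebraMap_X, RatFunc.algebraMap_C]

theorem isUnitAt_X_sub_C {α β : K} (h : α ≠ β) : IsUnitAt F α (RatFunc.X - RatFunc.C β) := by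
  rw [← algebraMap_X_sub_C]
  exact isUnitAt_algebraMap (by simpa using sub_ne_zero.mpr h)

/-! ### Integral elements -/

theorem Solution.apply_smul {α : K} (f : Solution L α) (c : RatFunc K) (A : OpQuot K L) :
    f.apply (c • A) = expand α c * f.apply A := by
  rw [LinearMap.map_smulₛₗ, smul_eq_mul]

theorem isIntegralAt_zero (α : K) : IsIntegralAt ι α (0 : OpQuot K L) := fun f _ => by
  rw [map_zero]; exact isIntegralSeries_zero

theorem IsIntegralAt.add {α : K} {A A' : OpQuot K L} (h : IsIntegralAt ι α A)
    (h' : IsIntegralAt ι α A') : IsIntegralAt ι α (A + A') := fun f hf => by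
  rw [map_add]; exact (h f hf).add (h' f hf)

theorem IsIntegralAt.sub {α : K} {A A' : OpQuot K L} (h : IsIntegralAt ι α A)
    (h' : IsIntegralAt ι α A') : IsIntegralAt ι α (A - A') := fun f hf => by
  rw [map_sub]; exact (h f hf).sub (h' f hf)

theorem IsIntegralAt.smul (hι : IsThreshold ι) {α : K} {A : OpQuot K L} (h : IsIntegralAt ι α A)
    {c : RatFunc K} (hc : IsRegularAt F α c) : IsIntegralAt ι α (c • A) := fun f hf => by
  obtain ⟨v, hv⟩ := hc
  rw [Solution.apply_smul, hv]
  exact (isIntegralSeries_psEmb hι v).mul hι (h f hf)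

theorem IsIntegralAt.sum {α : K} {β : Type*} (s : Finset β) {A : β → OpQuot K L}
    (h : ∀ i ∈ s, IsIntegralAt ι α (A i)) : IsIntegralAt ι α (∑ i ∈ s, A i) := by
  classical
  induction s using Finset.induction_on with
  | empty => rw [Finset.sum_empty]; exact isIntegralAt_zero α
  | insert a s ha ih =>
    rw [Finset.sum_insert ha]
    exact (h a (Finset.mem_insert_self _ _)).add (ih fun i hi => h i (Finset.mem_insert_of_mem hi))

theorem IsIntegralAt.of_smul (hι : IsThreshold ι) {α : K} {A : OpQuot K L} {c : RatFunc K}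
    (hc : IsUnitAt F α c) (h : IsIntegralAt ι α (c • A)) : IsIntegralAt ι α A := by
  have := h.smul hι hc.inv.isRegularAt
  rwa [smul_smul, inv_mul_cancel₀ hc.ne_zero, one_smul] at this

theorem sqfreePart_dvd : sqfreePart L ∣ lead L := by
  classical
  unfold sqfreePart
  exact UniqueFactorizationMonoid.radical_dvd_self

theorem exists_dvd_sqfreePart_pow (hord : 0 < ord L) : ∃ n, lead L ∣ sqfreePart L ^ n := by
  classical
  unfold sqfreePart
  exact UniqueFactorizationMonoid.exists_dvd_radical_self_pow (lead_ne_zero hord)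

theorem sqfreePart_ne_zero (hord : 0 < ord L) : sqfreePart L ≠ 0 := fun h =>
  lead_ne_zero hord (zero_dvd_iff.mp (h ▸ sqfreePart_dvd))

theorem aeval_sqfreePart_eq_zero_iff (hord : 0 < ord L) (α : K) :
    aeval α (sqfreePart L) = 0 ↔ aeval α (lead L) = 0 := by
  constructor
  · intro h
    obtain ⟨q, hq⟩ := sqfreePart_dvd (L := L)
    rw [hq, map_mul, h, zero_mul]
  · intro h
    obtain ⟨n, q, hq⟩ := exists_dvd_sqfreePart_pow hord
    have h1 := congrArg (aeval α) hq
    rw [map_pow, map_mul, h, zero_mul] at h1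
    exact eq_zero_of_pow_eq_zero h1

/-- The second hypothesis is not automatic: `ι` need not be monotone in the power of the logarithm,
so lowering that power may destroy integrality. -/
theorem isIntegralSeries_tpow_one_mul_D {g : LogSeries F K} (hg : IsIntegralSeries ι g)
    (hg' : IsIntegralSeries ι (derivative g)) : IsIntegralSeries ι (tpow 1 * D g) := by
  intro μ j h
  rw [termCoeff_tpow_one_mul_D] at h
  by_cases h1 : termCoeff g μ j = 0
  · exact hg' μ j (by simpa [h1] using h)
  · exact hg μ j h1

/-- At an ordinary point, the integral series among the `A · f` are power series. -/
theorem exponentsFrom_zero_apply_of_ordinary (hι : IsThreshold ι) (hord : 0 < ord L) {α : K}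
    (hα : aeval α (lead L) ≠ 0) {A : OpQuot K L} (h : IsIntegralAt ι α A) {f : Solution L α}
    (hf : IsPure f.1) :
    derivative (f.apply A) = 0 ∧ ExponentsFrom 0 (f.apply A) := by
  have hder : derivative (f.apply A) = 0 := by
    obtain ⟨P, rfl⟩ := (leftIdeal K L).mkQ_surjective A
    rw [Solution.apply_mkQ, derivative_act, derivative_eq_zero_of_ordinary hord hα f hf]
    have := act_smul_right α 0 (0 : LogSeries F K) P
    rwa [zero_smul, zero_smul] at this
  refine ⟨hder, fun μ j hne => ?_⟩
  have hcoset : InCoset (0 : F) (f.apply A) := by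
    obtain ⟨P, rfl⟩ := (leftIdeal K L).mkQ_surjective A
    rw [Solution.apply_mkQ, act_eq_sum]
    refine InCoset.sum _ fun i _ => ?_
    have h0 : InCoset (0 : F) f.1 := fun μ j hne => by
      obtain ⟨n, hn⟩ := exponentsFrom_zero_of_ordinary hord hα f hf ⟨0, hord⟩ μ j hne
      exact ⟨n, by rw [hn, Int.cast_natCast]⟩
    rw [← add_zero (0 : F)]
    exact (inCoset_expand α _).mul (h0.D_iterate i)
  have : CharZero K := charZero_of_injective_algebraMap (algebraMap F K).injective
  have hj : j = 0 := by
    by_contra hj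
    obtain ⟨j, rfl⟩ : ∃ m, j = m + 1 := ⟨j - 1, by omega⟩
    have h1 := termCoeff_derivative (f.apply A) μ j
    rw [hder, termCoeff_zero] at h1
    exact hne ((mul_eq_zero.mp h1.symm).resolve_left (Nat.cast_add_one_ne_zero j))
  obtain ⟨m, rfl⟩ := hcoset μ j hne
  obtain ⟨n, hn⟩ := h f hf _ j hne
  rw [modInt_add_int, hj, hι.zero, sub_zero] at hn
  exact ⟨n, by rw [hn, zero_add]⟩

theorem psEmb_mul_eq_of_constantCoeff {v : PowerSeries K} (hv : PowerSeries.constantCoeff v = 0)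
    (g : LogSeries F K) :
    psEmb v * g = psEmb (PowerSeries.mk fun n => PowerSeries.coeff (n + 1) v) * (tpow 1 * g) := by
  conv_lhs => rw [PowerSeries.eq_X_mul_shift_add_const v, hv, map_zero, add_zero, map_mul, psEmb_X]
  ring

/-- At a root of the leading coefficient, `s` supplies the factor `x - α` that compensates for the
differentiation. At an ordinary point the series `A · f` are power series, and so are their
derivatives. -/
theorem IsIntegralAt.sqfreePart_smul_quotD (hι : IsThreshold ι) (hord : 0 < ord L) {α : K}
    {A : OpQuot K L} (h : IsIntegralAt ι α A) :
    IsIntegralAt ι α (polyEmb F K (sqfreePart L) • quotD A) := by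
  intro f hf
  rw [Solution.apply_smul, Solution.apply_quotD, polyEmb_apply, expand_algebraMap]
  by_cases hα : aeval α (lead L) = 0
  · have h0 : PowerSeries.constantCoeff ((Polynomial.taylor α
        ((sqfreePart L).map (algebraMap F K)) : K[X]) : PowerSeries K) = 0 := by
      rw [constantCoeff_taylor, Polynomial.eval_map_algebraMap]
      exact (aeval_sqfreePart_eq_zero_iff hord α).mpr hα
    rw [psEmb_mul_eq_of_constantCoeff h0]
    refine (isIntegralSeries_psEmb hι _).mul hι (isIntegralSeries_tpow_one_mul_D (h f hf) ?_)
    -- The logarithmic derivative of `A · f` is `A` applied to another solution, hence integral.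
    rw [← Solution.apply_logDeriv]
    exact h _ (Solution.logDeriv_isPure hf)
  · refine (isIntegralSeries_psEmb hι _).mul hι ?_
    obtain ⟨hder, hexp⟩ := exponentsFrom_zero_apply_of_ordinary hι hord hα h hf
    have hterm : ∀ μ j, termCoeff (D (f.apply A)) μ j =
        algebraMap F K (μ + 1) * termCoeff (f.apply A) (μ + 1) j := by
      intro μ j
      rw [termCoeff_D, ← termCoeff_derivative, hder, termCoeff_zero, add_zero]
    have : CharZero K := charZero_of_injective_algebraMap (algebraMap F K).injective
    refine isIntegralSeries_of_exponentsFrom_zero hι (fun μ j hne => ?_) fun μ j hj => ?_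
    · rw [hterm] at hne
      obtain ⟨n, hn⟩ := hexp _ _ (right_ne_zero_of_mul hne)
      cases n with
      | zero =>
        rw [hn] at hne
        simp at hne
      | succ n => exact ⟨n, by push_cast at hn; linear_combination hn⟩
    · obtain ⟨j, rfl⟩ : ∃ m, j = m + 1 := ⟨j - 1, by omega⟩
      have h1 := termCoeff_derivative (f.apply A) (μ + 1) j
      rw [hder, termCoeff_zero] at h1
      rw [hterm, (mul_eq_zero.mp h1.symm).resolve_left (Nat.cast_add_one_ne_zero j), mul_zero]

/-! ### Start exponents -/

theorem IsThreshold.exists_int (hι : IsThreshold ι) (ν : F) (j : ℕ) :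
    ∃ z : ℤ, ι (ν : ModInt F) j = ν + z := by
  obtain ⟨z, hz⟩ := QuotientAddGroup.eq.mp (hι.mem_coset ν j).symm
  refine ⟨z, ?_⟩
  have : (z : F) = -ν + ι (ν : ModInt F) j := hz
  rw [this]; ring

theorem IsPure.exists_isIntegralSeries_tpow_mul (hι : IsThreshold ι) {f : LogSeries F K}
    (hf : IsPure f) : ∃ k₀ : ℤ, ∀ k : ℤ, k₀ ≤ k → IsIntegralSeries ι (tpow (k : F) * f) := by
  obtain ⟨ν, hν⟩ := hf
  choose z hz using hι.exists_int ν
  -- Only finitely many powers of the logarithm occur, and the sum of absolute values dominates each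
  -- of the shifts `z j`.
  refine ⟨∑ j ∈ Finset.range (f.natDegree + 1), |z j|, fun k hk μ j h => ?_⟩
  rw [termCoeff_tpow_mul] at h
  obtain ⟨n, hn⟩ := hν _ _ h
  have hj : j ∈ Finset.range (f.natDegree + 1) := by
    rw [Finset.mem_range, Nat.lt_succ_iff]
    refine Polynomial.le_natDegree_of_ne_zero fun h0 => h ?_
    rw [termCoeff, h0]; rfl
  have hle : z j ≤ k := (le_abs_self _).trans
    ((Finset.single_le_sum (fun i _ => abs_nonneg (z i)) hj).trans hk)
  obtain ⟨m, rfl⟩ := Int.le.dest hle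
  refine ⟨n + m, ?_⟩
  have hμ : μ = ν + ((n + (z j + m) : ℤ) : F) := by
    push_cast at hn ⊢
    linear_combination hn
  rw [hμ, modInt_add_int, hz]
  push_cast
  ring

theorem bddBelow_isIntegralSeries_tpow_mul (hι : IsThreshold ι) {f : LogSeries F K}
    (hf : f ≠ 0) : ∃ k₀ : ℤ, ∀ k : ℤ, IsIntegralSeries ι (tpow (k : F) * f) → k₀ ≤ k := by
  obtain ⟨μ, j, h⟩ := exists_termCoeff_ne_zero hf
  obtain ⟨z, hz⟩ := hι.exists_int μ j
  refine ⟨z, fun k hk => ?_⟩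
  obtain ⟨n, hn⟩ := hk (μ + k) j (by rwa [termCoeff_tpow_mul, add_sub_cancel_right])
  rw [modInt_add_int, hz] at hn
  have : ((k - z : ℤ) : F) = ((n : ℤ) : F) := by
    push_cast
    linear_combination hn
  have := Int.cast_injective this
  omega

/-- Large shifts make all the finitely many basis solutions integral, and one nonzero term of one of
them bounds the admissible shifts from below. -/
theorem exists_isStartExponent (hι : IsThreshold ι) (hord : 0 < ord L) (hL : IsRegular K L)
    (α : K) : ∃ e, IsStartExponent ι L α e := by
  obtain ⟨b, hb⟩ := hL α
  have h0 : (b ⟨0, hord⟩).1 ≠ 0 := hb.2.ne_zero ⟨0, hord⟩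
  obtain ⟨k₀, hk₀⟩ := bddBelow_isIntegralSeries_tpow_mul hι h0
  choose k hk using fun i => (hb.1 i).exists_isIntegralSeries_tpow_mul hι
  obtain ⟨e, he, hle⟩ := Int.exists_least_of_bdd
    (P := fun k => ∀ i, IsIntegralSeries ι (expand α ((RatFunc.X - RatFunc.C α) ^ k) * (b i).1))
    ⟨k₀, fun z hz => hk₀ z (by rw [← expand_X_sub_C_zpow α]; exact hz ⟨0, hord⟩)⟩
    ⟨∑ i, |k i|, fun i => by
      rw [expand_X_sub_C_zpow]
      exact hk i _ ((le_abs_self _).trans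
        (Finset.single_le_sum (fun i _ => abs_nonneg (k i)) (Finset.mem_univ i)))⟩
  exact ⟨e, b, hb, he, fun z hz => hle z hz⟩

/-- The class of a rational function. -/
def ofRat (L : ℕ →₀ F[X]) (c : RatFunc K) : OpQuot K L := (leftIdeal K L).mkQ (Finsupp.single 0 c)

theorem Solution.apply_ofRat {α : K} (f : Solution L α) (c : RatFunc K) :
    f.apply (ofRat L c) = expand α c * f.1 := by
  rw [ofRat, Solution.apply_mkQ, act_single]
  rfl

theorem smul_ofRat (c d : RatFunc K) : c • ofRat L d = ofRat L (c * d) := by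
  rw [ofRat, ofRat, ← map_smul, Finsupp.smul_single, smul_eq_mul]

/-- Characterizes the start exponent without a fundamental system, which makes exponents at
different points comparable. -/
theorem IsStartExponent.isLeast (hord : 0 < ord L) {α : K} {e : ℤ} (h : IsStartExponent ι L α e) :
    IsLeast {k : ℤ | IsIntegralAt ι α (ofRat L ((RatFunc.X - RatFunc.C α) ^ k))} e := by
  obtain ⟨b, hb, hmem, hlow⟩ := h
  constructor
  · intro f hf
    refine hb.apply_induction hord _ isIntegralSeries_zero (fun _ _ => IsIntegralSeries.add)
      (fun c _ h => h.smul c) (fun i => ?_) f hf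
    rw [Solution.apply_ofRat]
    exact hmem i
  · intro k hk
    refine hlow fun i => ?_
    rw [← Solution.apply_ofRat]
    exact hk (b i) (hb.1 i)

end IntegralElements

section Poles

set_option linter.unusedSectionVars false

variable {F K : Type*} [Field F] [CharZero F] [Field K] [Algebra F K]
  {ι : ModInt F → ℕ → F} {L : ℕ →₀ F[X]}

/-! ### Modifications of a triangular system -/

theorem polynomial_smul_eq (p : K[X]) (A : OpQuot K L) :
    p • A = algebraMap K[X] (RatFunc K) p • A := (algebraMap_smul (RatFunc K) p A).symm

theorem IsTriangular.update {B : ℕ → OpQuot K L} {lc : ℕ → RatFunc K} (hB : IsTriangular B lc)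
    {d : ℕ} {A : OpQuot K L} {x : RatFunc K}
    (hA : ∃ P : ℕ →₀ RatFunc K, (∀ k, d < k → P k = 0) ∧ P d = x ∧ (leftIdeal K L).mkQ P = A) :
    IsTriangular (Function.update B d A) (Function.update lc d x) := by
  intro i hi
  by_cases hid : i = d
  · subst hid
    rwa [Function.update_self, Function.update_self]
  · rw [Function.update_of_ne hid, Function.update_of_ne hid]
    exact hB i hi

theorem exists_rep_sum {B : ℕ → OpQuot K L} {lc : ℕ → RatFunc K} (hB : IsTriangular B lc)
    {d : ℕ} (hd : d ≤ ord L) (a : ℕ → RatFunc K) :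
    ∃ P : ℕ →₀ RatFunc K, (∀ k, d ≤ k → P k = 0) ∧
      (leftIdeal K L).mkQ P = ∑ i ∈ Finset.range d, a i • B i := by
  induction d with
  | zero => exact ⟨0, fun _ _ => rfl, by rw [map_zero, Finset.sum_range_zero]⟩
  | succ d ih =>
    obtain ⟨P, hP, hPA⟩ := ih (Nat.le_of_succ_le hd)
    obtain ⟨Q, hQ, -, hQB⟩ := hB d hd
    refine ⟨P + a d • Q, fun k hk => ?_, ?_⟩
    · rw [Finsupp.add_apply, Finsupp.smul_apply, hP k (by omega), hQ k (by omega), smul_zero,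
        add_zero]
    · rw [map_add, map_smul, hPA, hQB, Finset.sum_range_succ]

theorem exists_rep_combination {B : ℕ → OpQuot K L} {lc : ℕ → RatFunc K} (hB : IsTriangular B lc)
    {d : ℕ} (hd : d < ord L) (c : RatFunc K) (a : ℕ → RatFunc K) :
    ∃ P : ℕ →₀ RatFunc K, (∀ k, d < k → P k = 0) ∧ P d = c * lc d ∧
      (leftIdeal K L).mkQ P = c • (∑ i ∈ Finset.range d, a i • B i + B d) := by
  obtain ⟨P, hP, hPA⟩ := exists_rep_sum hB hd.le a
  obtain ⟨Q, hQ, hQd, hQB⟩ := hB d hd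
  refine ⟨c • (P + Q), fun k hk => ?_, ?_, ?_⟩
  · rw [Finsupp.smul_apply, Finsupp.add_apply, hP k hk.le, hQ k hk, add_zero, smul_zero]
  · rw [Finsupp.smul_apply, Finsupp.add_apply, hP d le_rfl, hQd, zero_add, smul_eq_mul]
  · rw [map_smul, map_add, hPA, hQB]

theorem dMul_apply_succ (P : ℕ →₀ RatFunc K) (i : ℕ) :
    dMul P (i + 1) = ratDeriv (P (i + 1)) + P i := by
  simp only [dMul, AddMonoidHom.add_apply, Finsupp.add_apply, Finsupp.mapRange.addMonoidHom_apply,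
    Finsupp.mapDomain.addMonoidHom_apply, Finsupp.mapRange_apply]
  rw [Finsupp.mapDomain_apply (f := fun i => i + 1) (fun a b h => Nat.succ_injective h)]

theorem exists_rep_quotD {A : OpQuot K L} {d : ℕ} {x : RatFunc K}
    (h : ∃ P : ℕ →₀ RatFunc K, (∀ k, d < k → P k = 0) ∧ P d = x ∧ (leftIdeal K L).mkQ P = A)
    (c : RatFunc K) :
    ∃ P : ℕ →₀ RatFunc K, (∀ k, d + 1 < k → P k = 0) ∧ P (d + 1) = c * x ∧
      (leftIdeal K L).mkQ P = c • quotD A := by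
  obtain ⟨P, hP, hPd, rfl⟩ := h
  refine ⟨c • dMul P, fun k hk => ?_, ?_, ?_⟩
  · obtain ⟨k, rfl⟩ : ∃ m, k = m + 1 := ⟨k - 1, by omega⟩
    rw [Finsupp.smul_apply, dMul_apply_succ, hP (k + 1) (by omega), hP k (by omega), map_zero,
      add_zero, smul_zero]
  · rw [Finsupp.smul_apply, dMul_apply_succ, hP (d + 1) (by omega), hPd, map_zero, zero_add,
      smul_eq_mul]
  · rw [map_smul, quotD_mk]

theorem prod_update_mul (lc : ℕ → RatFunc K) {d r : ℕ} (hd : d < r) (c : RatFunc K) :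
    ∏ i : Fin r, Function.update lc d (c * lc d) i = c * ∏ i : Fin r, lc i := by
  have : ∀ i : Fin r, Function.update lc d (c * lc d) i =
      (if i = ⟨d, hd⟩ then c else 1) * lc i := by
    intro i
    by_cases hid : i = ⟨d, hd⟩
    · rw [if_pos hid, hid, Function.update_self]
    · rw [if_neg hid, one_mul, Function.update_of_ne fun h => hid (Fin.ext h)]
  rw [Finset.prod_congr rfl fun i _ => this i, Finset.prod_mul_distrib, Finset.prod_ite_eq',
    if_pos (Finset.mem_univ _)]

theorem update_ne_zero {lc : ℕ → RatFunc K} {d r : ℕ} {x : RatFunc K} (hx : x ≠ 0)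
    (hlc : ∀ i < r, lc i ≠ 0) : ∀ i < r, Function.update lc d x i ≠ 0 := by
  intro i hi
  by_cases hid : i = d
  · subst hid; rwa [Function.update_self]
  · rw [Function.update_of_ne hid]; exact hlc i hi

/-! ### Poles -/

/-- The integral elements of order less than `d` belong to `K[x] B 0 + ⋯ + K[x] B (d - 1)`. -/
def SpanBelow (ι : ModInt F → ℕ → F) (B : ℕ → OpQuot K L) (d : ℕ) : Prop :=
  ∀ A : OpQuot K L, IsIntegralElement ι A →
    (∃ P : ℕ →₀ RatFunc K, (∀ k, d ≤ k → P k = 0) ∧ (leftIdeal K L).mkQ P = A) →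
      A ∈ Submodule.span K[X] (B '' Set.Iio d)

/-- The element `(x - α)⁻¹ (a 0 B 0 + ⋯ + a (d - 1) B (d - 1) + B d)`. -/
def poleElement (B : ℕ → OpQuot K L) (d : ℕ) (α : K) (a : ℕ → K) : OpQuot K L :=
  (RatFunc.X - RatFunc.C α)⁻¹ • (∑ i ∈ Finset.range d, RatFunc.C (a i) • B i + B d)

/-- Putting the pole element in the place of `B d` divides the Wronskian by `x - α`, so the level
would drop by one; it is still a natural number afterwards. -/
theorem wronskianLevel_ne_zero_of_pole (hι : IsThreshold ι) (hord : 0 < ord L)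
    (hL : IsRegular K L) {B : ℕ → OpQuot K L} {lc : ℕ → RatFunc K} (hB : IsTriangular B lc)
    (hlc : ∀ i < ord L, lc i ≠ 0) {α : K} (hint : ∀ i < ord L, IsIntegralAt ι α (B i))
    {d : ℕ} (hd : d < ord L) {a : ℕ → K} (h : IsIntegralAt ι α (poleElement B d α a)) :
    wronskianLevel ι B α ≠ 0 := by
  have hx := X_sub_C_ne_zero α
  have h1 := wronskianLevel_add_rootMultiplicity hι hord hL hB
    (hB.update (exists_rep_combination hB hd (RatFunc.X - RatFunc.C α)⁻¹ fun i => RatFunc.C (a i)))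
    hlc (update_ne_zero (mul_ne_zero (inv_ne_zero hx) (hlc d hd)) hlc) hint (fun i hi => ?_)
    (Polynomial.X_sub_C_ne_zero α) (by
      rw [prod_update_mul lc hd, algebraMap_X_sub_C, mul_inv_cancel_left₀ hx])
  · rw [← h1, Polynomial.rootMultiplicity_X_sub_C_self]
    omega
  · by_cases hid : i = d
    · rw [hid, Function.update_self]
      exact h
    · rw [Function.update_of_ne hid]
      exact hint i hi

theorem SpanBelow.exists_sum {B : ℕ → OpQuot K L} {d : ℕ} (h : SpanBelow ι B d) {A : OpQuot K L}
    (hA : IsIntegralElement ι A)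
    (hP : ∃ P : ℕ →₀ RatFunc K, (∀ k, d ≤ k → P k = 0) ∧ (leftIdeal K L).mkQ P = A) :
    ∃ p : ℕ → K[X], A = ∑ i ∈ Finset.range d, p i • B i := by
  have := h A hA hP
  rw [← Finset.coe_range, Submodule.mem_span_image_finset_iff_exists_fun'] at this
  obtain ⟨c, hc⟩ := this
  exact ⟨c, hc.symm⟩

/-- Write `A = q B d + A'` with `A'` of order less than `d`. A polynomial `q` would put `A` into the
span. Otherwise `q` has a pole at some `α`; polynomial multiples and differences turn its
coefficient into `(x - α)⁻¹`, and the hypothesis on lower orders shows that the other coefficients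
are polynomials divided by `x - α`, of which only the values at `α` matter. -/
theorem exists_pole [IsAlgClosed K] (hι : IsThreshold ι) {B : ℕ → OpQuot K L}
    {lc : ℕ → RatFunc K} (hB : IsTriangular B lc) (hlc : ∀ i < ord L, lc i ≠ 0)
    (hint : ∀ i < ord L, IsIntegralElement ι (B i)) {d : ℕ} (hd : d < ord L)
    (hspan : SpanBelow ι B d) {A : OpQuot K L} (hA : A ∈ missing ι B d) :
    ∃ (α : K) (a : ℕ → K), IsIntegralAt ι α (poleElement B d α a) := by
  obtain ⟨⟨hAi, P, hP, hPA⟩, hAs⟩ := hA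
  obtain ⟨Q, hQ, hQd, hQB⟩ := hB d hd
  set q : RatFunc K := P d / lc d with hq
  have hqd : q * lc d = P d := div_mul_cancel₀ _ (hlc d hd)
  obtain ⟨A', hA'⟩ : ∃ A', A' = A - q • B d := ⟨_, rfl⟩
  have hrep : ∀ c : RatFunc K, ∃ R : ℕ →₀ RatFunc K, (∀ k, d ≤ k → R k = 0) ∧
      (leftIdeal K L).mkQ R = c • A' := by
    intro c
    refine ⟨c • (P - q • Q), fun k hk => ?_, ?_⟩
    · rw [Finsupp.smul_apply, Finsupp.sub_apply, Finsupp.smul_apply]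
      rcases hk.eq_or_lt with rfl | hk
      · rw [hQd, smul_eq_mul q, hqd, sub_self, smul_zero]
      · rw [hP k hk, hQ k hk, smul_zero, sub_zero, smul_zero]
    · rw [map_smul, map_sub, map_smul, hPA, hQB, hA']
  have hpoly : ∀ (p : K[X]) (C : OpQuot K L), IsIntegralElement ι C →
      IsIntegralElement ι (algebraMap K[X] (RatFunc K) p • C) := fun p C hC β =>
    IsIntegralAt.smul hι (hC β) (isRegularAt_algebraMap β p)
  have hnum : algebraMap K[X] (RatFunc K) q.num = q * algebraMap K[X] (RatFunc K) q.denom := by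
    have h1 : algebraMap K[X] (RatFunc K) q.denom ≠ 0 := RatFunc.algebraMap_ne_zero q.denom_ne_zero
    rw [← div_eq_iff h1, RatFunc.num_div_denom]
  have hdeg : q.denom.degree ≠ 0 := by
    intro h0
    have h1 : q.denom = 1 :=
      Polynomial.eq_one_of_monic_natDegree_zero q.monic_denom
        (Polynomial.natDegree_eq_of_degree_eq_some h0)
    rw [h1, map_one, mul_one] at hnum
    apply hAs
    have h2 : A' ∈ Submodule.span K[X] (B '' Set.Iio d) := by
      refine hspan A' (fun β => ?_) (by simpa using hrep 1)
      rw [hA', ← hnum]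
      exact IsIntegralAt.sub (hAi β) (hpoly _ _ (hint d hd) β)
    have h3 : A = A' + q.num • B d := by
      rw [polynomial_smul_eq, hnum, hA', sub_add_cancel]
    rw [h3]
    refine Submodule.add_mem _ (Submodule.span_mono (Set.image_mono fun i hi => ?_) h2)
      (Submodule.smul_mem _ _ (Submodule.subset_span ⟨d, Set.mem_Iic.mpr le_rfl, rfl⟩))
    exact Set.mem_Iic.mpr (Set.mem_Iio.mp hi).le
  obtain ⟨α, hα⟩ := IsAlgClosed.exists_root q.denom hdeg
  obtain ⟨m, hm⟩ := Polynomial.dvd_iff_isRoot.mpr hα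
  have hn0 : q.num.eval α ≠ 0 := by
    intro h0
    obtain ⟨u, v, huv⟩ := q.isCoprime_num_denom
    have := congrArg (Polynomial.eval α) huv
    rw [Polynomial.eval_add, Polynomial.eval_mul, Polynomial.eval_mul, h0, hα, mul_zero, mul_zero,
      add_zero, Polynomial.eval_one] at this
    exact zero_ne_one this
  have hx := X_sub_C_ne_zero α
  obtain ⟨x, hxdef⟩ : ∃ x, x = (RatFunc.X - RatFunc.C α : RatFunc K) := ⟨_, rfl⟩
  rw [← hxdef] at hx
  have hsplit : ∀ p : K[X], ∃ h : K[X], algebraMap K[X] (RatFunc K) p =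
      RatFunc.C (p.eval α) + x * algebraMap K[X] (RatFunc K) h := by
    intro p
    obtain ⟨h, hh⟩ := Polynomial.X_sub_C_dvd_sub_C_eval (a := α) (p := p)
    refine ⟨h, ?_⟩
    rw [hxdef, ← algebraMap_X_sub_C, ← map_mul, ← hh, map_sub, RatFunc.algebraMap_C]
    ring
  obtain ⟨n₁, hn₁⟩ := hsplit q.num
  obtain ⟨n₀, hn₀⟩ : ∃ n₀, n₀ = RatFunc.C (q.num.eval α) := ⟨_, rfl⟩
  have hn₀ne : n₀ ≠ 0 := by
    rw [hn₀]
    exact (_root_.map_ne_zero RatFunc.C).mpr hn0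
  -- The cofactor `m` clears everything in the denominator but one factor `x - α`; the residue `n₀`
  -- is nonzero because `q` is in lowest terms.
  have hmq : algebraMap K[X] (RatFunc K) m * q = n₀ * x⁻¹ + algebraMap K[X] (RatFunc K) n₁ := by
    rw [hm, map_mul, algebraMap_X_sub_C, ← hxdef] at hnum
    rw [← hn₀] at hn₁
    have : x * (algebraMap K[X] (RatFunc K) m * q) = n₀ + x * algebraMap K[X] (RatFunc K) n₁ := by
      rw [← hn₁, hnum]; ring
    field_simp
    linear_combination this
  obtain ⟨A₂, hA₂⟩ : ∃ A₂, A₂ = n₀⁻¹ • (algebraMap K[X] (RatFunc K) m • A -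
    algebraMap K[X] (RatFunc K) n₁ • B d) := ⟨_, rfl⟩
  have hA₂i : IsIntegralElement ι A₂ := by
    intro β
    have hc : n₀⁻¹ = algebraMap K[X] (RatFunc K) (C (q.num.eval α)⁻¹) := by
      rw [hn₀, RatFunc.algebraMap_C, map_inv₀]
    rw [hA₂, hc]
    exact hpoly _ _ (fun γ => IsIntegralAt.sub (hpoly _ _ hAi γ) (hpoly _ _ (hint d hd) γ)) β
  have hA₂e : A₂ = x⁻¹ • B d + (n₀⁻¹ * algebraMap K[X] (RatFunc K) m) • A' := by
    rw [hA₂, hA', smul_sub, smul_sub, smul_smul, smul_smul, smul_smul, mul_assoc, hmq, mul_add,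
      add_smul, inv_mul_cancel_left₀ hn₀ne]
    abel
  have hxint : IsIntegralElement ι (x • A₂ - B d) := by
    intro β
    rw [hxdef, ← algebraMap_X_sub_C]
    exact IsIntegralAt.sub (hpoly _ _ hA₂i β) (hint d hd β)
  -- Multiplication by `x - α` and subtraction of `B d` leave an integral element of lower order, so
  -- no partial fractions of the lower coefficients are needed.
  obtain ⟨p, hp⟩ := hspan.exists_sum hxint (by
    obtain ⟨R, hR, hRA⟩ := hrep (x * (n₀⁻¹ * algebraMap K[X] (RatFunc K) m))
    refine ⟨R, hR, ?_⟩
    rw [hRA, hA₂e, smul_add, smul_smul, smul_smul, mul_inv_cancel₀ hx, one_smul, add_sub_cancel_left])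
  choose h hh using fun i => hsplit (p i)
  refine ⟨α, fun i => (p i).eval α, ?_⟩
  -- Modulo `x - α` each polynomial is its value at `α`; the rest contributes polynomial multiples
  -- of the `B i`.
  have hfin : poleElement B d α (fun i => (p i).eval α) =
      A₂ - ∑ i ∈ Finset.range d, algebraMap K[X] (RatFunc K) (h i) • B i := by
    have h1 : A₂ = x⁻¹ • (∑ i ∈ Finset.range d, p i • B i + B d) := by
      rw [← hp, sub_add_cancel, smul_smul, inv_mul_cancel₀ hx, one_smul]
    rw [poleElement, ← hxdef, h1, smul_add, smul_add, add_sub_right_comm, Finset.smul_sum,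
      Finset.smul_sum, ← Finset.sum_sub_distrib]
    congr 1
    refine Finset.sum_congr rfl fun i _ => ?_
    rw [polynomial_smul_eq, smul_smul, smul_smul, ← sub_smul, hh i, mul_add,
      inv_mul_cancel_left₀ hx, add_sub_cancel_right]
  rw [hfin]
  exact IsIntegralAt.sub (hA₂i α) (IsIntegralAt.sum _ fun i hi =>
    hpoly _ _ (hint i ((Finset.mem_range.mp hi).trans hd)) α)

end Poles

section Descent

set_option linter.unusedSectionVars false

/-! ### Change of the coefficient field -/

section RatMap

variable {k A B : Type*} [Field k] [Field A] [Field B]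

/-- The map on rational functions induced by a field homomorphism. -/
def ratMap (τ : k →+* A) : RatFunc k →+* RatFunc A :=
  RatFunc.mapRingHom (Polynomial.mapRingHom τ)
    (nonZeroDivisors_le_comap_nonZeroDivisors_of_injective _
      (Polynomial.map_injective τ τ.injective))

theorem ratMap_algebraMap (τ : k →+* A) (p : k[X]) :
    ratMap τ (algebraMap k[X] (RatFunc k) p) = algebraMap A[X] (RatFunc A) (p.map τ) := by
  have h := RatFunc.map_apply_div (φ := Polynomial.mapRingHom τ)
    (nonZeroDivisors_le_comap_nonZeroDivisors_of_injective _
      (Polynomial.map_injective τ τ.injective)) p 1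
  rw [map_one, map_one, map_one, div_one, div_one] at h
  exact h

theorem ratMap_X (τ : k →+* A) : ratMap τ RatFunc.X = RatFunc.X := by
  rw [← RatFunc.algebraMap_X, ratMap_algebraMap, Polynomial.map_X, RatFunc.algebraMap_X]

theorem ratMap_C (τ : k →+* A) (a : k) : ratMap τ (RatFunc.C a) = RatFunc.C (τ a) := by
  rw [← RatFunc.algebraMap_C, ratMap_algebraMap, Polynomial.map_C, RatFunc.algebraMap_C]

theorem ratMap_id (c : RatFunc k) : ratMap (RingHom.id k) c = c := by
  induction c using RatFunc.induction_on with | f p q _ => ?_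
  rw [map_div₀, ratMap_algebraMap, ratMap_algebraMap, Polynomial.map_id, Polynomial.map_id]

theorem ratMap_comp (τ : k →+* A) (ρ : A →+* B) (c : RatFunc k) :
    ratMap ρ (ratMap τ c) = ratMap (ρ.comp τ) c := by
  induction c using RatFunc.induction_on with | f p q _ => ?_
  simp only [map_div₀, ratMap_algebraMap, Polynomial.map_map]

theorem ratMap_ratDeriv (τ : k →+* A) (c : RatFunc k) :
    ratMap τ (ratDeriv c) = ratDeriv (ratMap τ c) := by
  induction c using RatFunc.induction_on with | f p q hq => ?_
  have hq' : q.map τ ≠ 0 := (Polynomial.map_ne_zero_iff τ.injective).mpr hq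
  rw [ratDeriv_div p q hq, map_div₀ (ratMap τ), map_div₀ (ratMap τ), map_pow]
  simp only [ratMap_algebraMap]
  rw [ratDeriv_div _ _ hq']
  simp only [Polynomial.map_sub, Polynomial.map_mul, Polynomial.derivative_map]

/-- The map on differential operators induced by a field homomorphism. -/
def opMap (τ : k →+* A) : (ℕ →₀ RatFunc k) →+ (ℕ →₀ RatFunc A) :=
  Finsupp.mapRange.addMonoidHom (ratMap τ : RatFunc k →+ RatFunc A)

theorem opMap_apply (τ : k →+* A) (P : ℕ →₀ RatFunc k) (i : ℕ) :
    opMap τ P i = ratMap τ (P i) := rfl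

theorem opMap_single (τ : k →+* A) (i : ℕ) (c : RatFunc k) :
    opMap τ (Finsupp.single i c) = Finsupp.single i (ratMap τ c) :=
  Finsupp.mapRange_single (hf := map_zero (ratMap τ))

theorem opMap_smul (τ : k →+* A) (c : RatFunc k) (P : ℕ →₀ RatFunc k) :
    opMap τ (c • P) = ratMap τ c • opMap τ P := by
  ext i
  simp only [opMap_apply, Finsupp.smul_apply, smul_eq_mul, map_mul]

theorem opMap_id (P : ℕ →₀ RatFunc k) : opMap (RingHom.id k) P = P := by
  ext i
  rw [opMap_apply, ratMap_id]

theorem opMap_comp (τ : k →+* A) (ρ : A →+* B) (P : ℕ →₀ RatFunc k) :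
    opMap ρ (opMap τ P) = opMap (ρ.comp τ) P := by
  ext i
  simp only [opMap_apply, ratMap_comp]

theorem dMul_single (i : ℕ) (c : RatFunc k) :
    dMul (Finsupp.single i c) = Finsupp.single i (ratDeriv c) + Finsupp.single (i + 1) c := by
  simp [dMul]

theorem opMap_dMul (τ : k →+* A) (P : ℕ →₀ RatFunc k) : opMap τ (dMul P) = dMul (opMap τ P) := by
  induction P using Finsupp.induction_linear with
  | zero => simp
  | add P Q hP hQ => simp only [map_add, hP, hQ]
  | single i c =>
    rw [opMap_single, dMul_single, dMul_single, map_add, opMap_single, opMap_single, ratMap_ratDeriv]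

variable [Algebra k A]

theorem polyEmb_eq_ratMap (p : k[X]) :
    polyEmb k A p = ratMap (algebraMap k A) (algebraMap k[X] (RatFunc k) p) :=
  (ratMap_algebraMap _ _).symm

end RatMap

/-! ### Linear maps applied to the coefficients of series -/

section MapCoeff

variable {F A B : Type*} [Field F] [CharZero F] [Field A] [Field B]

/-- The series whose coefficients are the images of the coefficients of `f`. -/
def mapCoeff (φ : A →+ B) (f : LogSeries F A) : LogSeries F B :=
  ∑ j ∈ Finset.range (f.natDegree + 1),
    Polynomial.monomial j ((f.coeff j).map (φ : ZeroHom A B))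

theorem termCoeff_mapCoeff (φ : A →+ B) (f : LogSeries F A) (μ : F) (j : ℕ) :
    termCoeff (mapCoeff φ f) μ j = φ (termCoeff f μ j) := by
  have h : (mapCoeff φ f).coeff j = (f.coeff j).map (φ : ZeroHom A B) := by
    rw [mapCoeff, Polynomial.finsetSum_coeff]
    simp only [Polynomial.coeff_monomial]
    rw [Finset.sum_ite_eq']
    split_ifs with hj
    · rfl
    · rw [Polynomial.coeff_eq_zero_of_natDegree_lt (by simpa using hj)]
      exact (HahnSeries.map_zero _).symm
  rw [termCoeff, h]
  rfl

theorem mapCoeff_add (φ : A →+ B) (f g : LogSeries F A) :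
    mapCoeff φ (f + g) = mapCoeff φ f + mapCoeff φ g :=
  LogSeries.ext_termCoeff fun μ j => by simp only [termCoeff_mapCoeff, termCoeff_add, map_add]

theorem mapCoeff_zero (φ : A →+ B) : mapCoeff φ (0 : LogSeries F A) = 0 :=
  LogSeries.ext_termCoeff fun μ j => by simp only [termCoeff_mapCoeff, termCoeff_zero, map_zero]

theorem mapCoeff_tpow_mul (φ : A →+ B) (ν : F) (f : LogSeries F A) :
    mapCoeff φ (tpow ν * f) = tpow ν * mapCoeff φ f :=
  LogSeries.ext_termCoeff fun μ j => by simp only [termCoeff_mapCoeff, termCoeff_tpow_mul]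

theorem IsPure.mapCoeff {f : LogSeries F A} (hf : IsPure f) (φ : A →+ B) :
    IsPure (mapCoeff φ f) := by
  obtain ⟨ν, hν⟩ := hf
  exact ⟨ν, fun μ j h => hν μ j fun h0 => h (by rw [termCoeff_mapCoeff, h0, map_zero])⟩

theorem IsIntegralSeries.mapCoeff {ι : ModInt F → ℕ → F} {f : LogSeries F A}
    (hf : IsIntegralSeries ι f) (φ : A →+ B) : IsIntegralSeries ι (mapCoeff φ f) :=
  fun μ j h => hf μ j fun h0 => h (by rw [termCoeff_mapCoeff, h0, map_zero])

variable {k : Type*} [Field k] [Algebra F k] [Algebra F A] [Algebra F B] {τ : k →ₐ[F] A}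
  {ρ : k →ₐ[F] B} {φ : A →+ B} {L : ℕ →₀ F[X]}

theorem mapCoeff_D (hφ : ∀ a b, φ (τ a * b) = ρ a * φ b) (f : LogSeries F A) :
    mapCoeff φ (D f) = D (mapCoeff φ f) := by
  have hF : ∀ (a : F) (b : A), φ (algebraMap F A a * b) = algebraMap F B a * φ b := by
    intro a b
    rw [← τ.commutes, hφ, ρ.commutes]
  refine LogSeries.ext_termCoeff fun μ j => ?_
  have h1 := hF ((j : F) + 1) (termCoeff f (μ + 1) (j + 1))
  simp only [map_add, map_natCast, map_one] at h1
  rw [termCoeff_mapCoeff, termCoeff_D, termCoeff_D, map_add, hF, h1, termCoeff_mapCoeff,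
    termCoeff_mapCoeff]

theorem mapCoeff_expand_polynomial (hφ : ∀ a b, φ (τ a * b) = ρ a * φ b) (β : k) (p : k[X])
    (f : LogSeries F A) :
    mapCoeff φ (expand (τ β) (algebraMap A[X] (RatFunc A) (p.map (τ : k →+* A))) * f) =
      expand (ρ β) (algebraMap B[X] (RatFunc B) (p.map (ρ : k →+* B))) * mapCoeff φ f := by
  have hC : ∀ (a : k) (f : LogSeries F A),
      mapCoeff φ (algebraMap A (LogSeries F A) (τ a) * f) =
        algebraMap B (LogSeries F B) (ρ a) * mapCoeff φ f := by
    intro a f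
    refine LogSeries.ext_termCoeff fun μ j => ?_
    rw [← Algebra.smul_def, ← Algebra.smul_def, termCoeff_mapCoeff, termCoeff_smul, termCoeff_smul,
      termCoeff_mapCoeff, hφ]
  induction p using Polynomial.induction_on generalizing f with
  | C a =>
    rw [Polynomial.map_C, Polynomial.map_C, expand_C, expand_C]
    exact hC a f
  | add p q hp hq =>
    simp only [Polynomial.map_add, map_add, add_mul, mapCoeff_add, hp, hq]
  | monomial n a ih =>
    rw [pow_succ, ← mul_assoc]
    generalize Polynomial.C a * Polynomial.X ^ n = q at ih ⊢
    simp only [Polynomial.map_mul, Polynomial.map_X, map_mul]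
    rw [mul_assoc, ih, mul_assoc]
    congr 1
    rw [expand_X, expand_X, add_mul, add_mul, mapCoeff_add, hC]
    congr 1
    exact mapCoeff_tpow_mul φ 1 f

theorem mapCoeff_expand (hφ : ∀ a b, φ (τ a * b) = ρ a * φ b) (β : k) (c : RatFunc k)
    (f : LogSeries F A) :
    mapCoeff φ (expand (τ β) (ratMap (τ : k →+* A) c) * f) =
      expand (ρ β) (ratMap (ρ : k →+* B) c) * mapCoeff φ f := by
  induction c using RatFunc.induction_on with | f p q hq => ?_
  have hq1 : ratMap (τ : k →+* A) (algebraMap k[X] (RatFunc k) q) ≠ 0 :=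
    (_root_.map_ne_zero _).mpr (RatFunc.algebraMap_ne_zero hq)
  have hq2 : ratMap (ρ : k →+* B) (algebraMap k[X] (RatFunc k) q) ≠ 0 :=
    (_root_.map_ne_zero _).mpr (RatFunc.algebraMap_ne_zero hq)
  -- The expansion of the denominator is a unit and may be cancelled, which reduces the claim to
  -- polynomials.
  refine (isUnit_expand (F := F) (ρ β) hq2).mul_right_inj.mp ?_
  rw [← mul_assoc, ← map_mul, ratMap_algebraMap, ← mapCoeff_expand_polynomial hφ, ← mul_assoc,
    ← map_mul, map_div₀, map_div₀, ← ratMap_algebraMap, ← ratMap_algebraMap,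
    mul_div_cancel₀ _ hq1, mul_div_cancel₀ _ hq2, ratMap_algebraMap, ratMap_algebraMap,
    mapCoeff_expand_polynomial hφ]

/-- The hypothesis says that `φ` is `k`-linear when `A` and `B` are viewed as `k`-vector spaces
through `τ` and `ρ`. Multiplicativity is not needed, as an operator over `k` acts at a point of `k`
by scalars from `k`. Both field embeddings and linear functionals are of this kind. -/
theorem mapCoeff_act (hφ : ∀ a b, φ (τ a * b) = ρ a * φ b) (β : k) (P : ℕ →₀ RatFunc k)
    (f : LogSeries F A) :
    mapCoeff φ (act (τ β) f (opMap (τ : k →+* A) P)) =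
      act (ρ β) (mapCoeff φ f) (opMap (ρ : k →+* B) P) := by
  have hD : ∀ i, mapCoeff φ (D^[i] f) = D^[i] (mapCoeff φ f) := by
    intro i
    induction i with
    | zero => rfl
    | succ i ih => rw [Function.iterate_succ_apply', mapCoeff_D hφ, ih, Function.iterate_succ_apply']
  induction P using Finsupp.induction_linear with
  | zero => simp only [map_zero, mapCoeff_zero]
  | add P Q hP hQ => simp only [map_add, mapCoeff_add, hP, hQ]
  | single i c =>
    rw [opMap_single, opMap_single, act_single, act_single, mapCoeff_expand hφ, hD]

theorem opMap_toRat (τ : k →ₐ[F] A) (L : ℕ →₀ F[X]) :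
    opMap (τ : k →+* A) (toRat k L) = toRat A L := by
  ext i
  rw [opMap_apply, toRat_apply, toRat_apply, polyEmb_eq_ratMap, polyEmb_eq_ratMap, ratMap_comp]
  congr 2
  exact τ.comp_algebraMap

/-- The image of a solution under a `k`-linear map of the coefficients. -/
def Solution.mapCoeff (hφ : ∀ a b, φ (τ a * b) = ρ a * φ b) {β : k} (f : Solution L (τ β)) :
    Solution L (ρ β) :=
  ⟨IntegralBasis.mapCoeff φ f.1, by
    rw [← opMap_toRat ρ, ← mapCoeff_act hφ, opMap_toRat τ, f.2, mapCoeff_zero]⟩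

theorem Solution.mapCoeff_apply (hφ : ∀ a b, φ (τ a * b) = ρ a * φ b) {β : k}
    (f : Solution L (τ β)) (P : ℕ →₀ RatFunc k) :
    (f.mapCoeff hφ).apply ((leftIdeal B L).mkQ (opMap (ρ : k →+* B) P)) =
      IntegralBasis.mapCoeff φ (f.apply ((leftIdeal A L).mkQ (opMap (τ : k →+* A) P))) :=
  (mapCoeff_act hφ β P f.1).symm

end MapCoeff

/-! ### Descent of integrality to a smaller coefficient field -/

section Transfer

variable {F k K : Type*} [Field F] [CharZero F] [Field k] [Field K] [Algebra F k] [Algebra F K]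
  {L : ℕ →₀ F[X]} {ι : ModInt F → ℕ → F}

theorem exists_linear_functional (τ : k →ₐ[F] K) {c : K} (hc : c ≠ 0) :
    ∃ φ : K →+ k, (∀ a b, φ (τ a * b) = a * φ b) ∧ φ c ≠ 0 := by
  let _ : Algebra k K := (τ : k →+* K).toAlgebra
  obtain ⟨φ, hφ⟩ : ∃ φ : Module.Dual k K, φ c ≠ 0 := by
    by_contra! h
    exact hc ((Module.forall_dual_apply_eq_zero_iff k c).mp h)
  refine ⟨φ.toAddMonoidHom, fun a b => ?_, hφ⟩
  have := φ.map_smul a b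
  rwa [Algebra.smul_def, smul_eq_mul] at this

/-- A functional not vanishing at `1`, rescaled. It is a left inverse of `τ` by linearity. -/
theorem exists_linear_retraction (τ : k →ₐ[F] K) :
    ∃ φ : K →+ k, (∀ a b, φ (τ a * b) = a * φ b) ∧ φ 1 = 1 := by
  obtain ⟨φ, hφ, h1⟩ := exists_linear_functional τ (one_ne_zero (α := K))
  refine ⟨(AddMonoidHom.mulLeft (φ 1)⁻¹).comp φ, fun a b => ?_, ?_⟩
  · simp only [AddMonoidHom.comp_apply, AddMonoidHom.coe_mulLeft, hφ]
    ring
  · simp only [AddMonoidHom.comp_apply, AddMonoidHom.coe_mulLeft]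
    exact inv_mul_cancel₀ h1

/-- Integrality does not depend on the coefficient field. -/
theorem isIntegralAt_opMap_iff (τ : k →ₐ[F] K) (β : k) (P : ℕ →₀ RatFunc k) :
    IsIntegralAt ι (τ β) ((leftIdeal K L).mkQ (opMap (τ : k →+* K) P)) ↔
      IsIntegralAt ι β ((leftIdeal k L).mkQ P) := by
  constructor
  · intro h f hf μ j hne
    -- Solutions over `k` are embedded into those over `K`; injectivity of `τ` preserves the terms
    -- that occur.
    have hφ : ∀ a b, ((τ : k →+* K) : k →+ K) (AlgHom.id F k a * b) =
        τ a * ((τ : k →+* K) : k →+ K) b := fun a b => map_mul τ a b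
    have h1 := h (Solution.mapCoeff (β := β) hφ f) (hf.mapCoeff _) μ j
    have h2 := Solution.mapCoeff_apply (β := β) hφ f P
    rw [h2, termCoeff_mapCoeff] at h1
    refine h1 fun h0 => hne ?_
    have h3 : opMap ((AlgHom.id F k : k →ₐ[F] k) : k →+* k) P = P := opMap_id P
    rw [h3] at h0
    exact (_root_.map_eq_zero (τ : k →+* K)).mp h0
  · intro h f hf μ j hne
    -- Solutions over `K` are projected to `k` by a functional that does not kill the coefficient
    -- under consideration.
    obtain ⟨φ, hφ, hφne⟩ := exists_linear_functional τ hne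
    have hφ' : ∀ a b, φ (τ a * b) = AlgHom.id F k a * φ b := hφ
    have h1 := h (Solution.mapCoeff (β := β) hφ' f) (hf.mapCoeff _) μ j
    have h2 := Solution.mapCoeff_apply (β := β) hφ' f P
    have h3 : opMap ((AlgHom.id F k : k →ₐ[F] k) : k →+* k) P = P := opMap_id P
    rw [h3] at h2
    have h4 : (Solution.mapCoeff (β := β) hφ' f).apply ((leftIdeal k L).mkQ P) =
      mapCoeff φ (f.apply ((leftIdeal K L).mkQ (opMap (τ : k →+* K) P))) := h2
    have h5 : termCoeff (mapCoeff φ (f.apply ((leftIdeal K L).mkQ (opMap (τ : k →+* K) P)))) μ j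
      ≠ 0 := by rwa [termCoeff_mapCoeff]
    rw [← h4] at h5
    exact h1 h5

theorem expand_RatFunc_C (α a : K) :
    (expand α (RatFunc.C a) : LogSeries F K) = algebraMap K (LogSeries F K) a := by
  rw [← RatFunc.algebraMap_C, expand_C]

/-- If an inhomogeneous linear combination with coefficients in `K` is integral, there is one with
coefficients in `k`. -/
theorem exists_isIntegralAt_combination (τ : k →ₐ[F] K) (β : k) {d : ℕ}
    (P : ℕ → ℕ →₀ RatFunc k) (a : ℕ → K)
    (h : IsIntegralAt ι (τ β) ((leftIdeal K L).mkQ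
      (∑ i ∈ Finset.range d, RatFunc.C (a i) • opMap (τ : k →+* K) (P i) +
        opMap (τ : k →+* K) (P d)))) :
    ∃ a' : ℕ → k, IsIntegralAt ι β ((leftIdeal k L).mkQ
      (∑ i ∈ Finset.range d, RatFunc.C (a' i) • P i + P d)) := by
  obtain ⟨φ, hφ, h1⟩ := exists_linear_retraction τ
  have hφτ : ∀ b, φ (τ b) = b := fun b => by
    have := hφ b 1
    rwa [mul_one, h1, mul_one] at this
  -- On the image of a solution over `k`, the map `φ` turns each coefficient `a i` into `φ (a i)`,
  -- and the coefficient `1` of the last term is preserved by the normalization of `φ`.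
  refine ⟨fun i => φ (a i), fun f hf => ?_⟩
  have hτ : ∀ a b, ((τ : k →+* K) : k →+ K) (AlgHom.id F k a * b) =
      τ a * ((τ : k →+* K) : k →+ K) b := fun a b => map_mul τ a b
  have h2 := (h (Solution.mapCoeff (β := β) hτ f) (hf.mapCoeff _)).mapCoeff φ
  have h3 : ∀ Q : ℕ →₀ RatFunc k, act (τ β) (mapCoeff ((τ : k →+* K) : k →+ K) f.1)
      (opMap (τ : k →+* K) Q) = mapCoeff ((τ : k →+* K) : k →+ K) (act β f.1 Q) := by
    intro Q
    have := Solution.mapCoeff_apply (β := β) hτ f Q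
    have h3 : opMap ((AlgHom.id F k : k →ₐ[F] k) : k →+* k) Q = Q := opMap_id Q
    rw [h3] at this
    exact this
  convert h2 using 1
  refine LogSeries.ext_termCoeff fun μ j => ?_
  rw [termCoeff_mapCoeff, Solution.apply_mkQ, Solution.apply_mkQ]
  change termCoeff (act β f.1 _) μ j =
    φ (termCoeff (act (τ β) (mapCoeff ((τ : k →+* K) : k →+ K) f.1) _) μ j)
  simp only [map_add, map_sum, LinearMap.map_smulₛₗ, h3, termCoeff_add, termCoeff_sum,
    expand_RatFunc_C,
    smul_eq_mul, ← Algebra.smul_def, termCoeff_smul, termCoeff_mapCoeff]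
  congr 1
  · refine Finset.sum_congr rfl fun i _ => ?_
    rw [mul_comm (a i)]
    change _ = φ (τ _ * _)
    rw [hφ, mul_comm]
  · exact (hφτ _).symm

end Transfer

end Descent

section Rational

set_option linter.unusedSectionVars false

variable {F K : Type*} [Field F] [CharZero F] [Field K] [Algebra F K]
  {ι : ModInt F → ℕ → F} {L : ℕ →₀ F[X]}

/-! ### Rationality over the base field -/

/-- `A` is represented by an operator with coefficients in `F(x)`. -/
def IsRational (A : OpQuot K L) : Prop :=
  ∃ P : ℕ →₀ RatFunc F, (leftIdeal K L).mkQ (opMap (algebraMap F K) P) = A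

theorem IsRational.add {A A' : OpQuot K L} (h : IsRational A) (h' : IsRational A') :
    IsRational (A + A') := by
  obtain ⟨P, rfl⟩ := h
  obtain ⟨Q, rfl⟩ := h'
  exact ⟨P + Q, by rw [map_add, map_add]⟩

theorem isRational_zero : IsRational (0 : OpQuot K L) := ⟨0, by rw [map_zero, map_zero]⟩

theorem IsRational.smul {A : OpQuot K L} (h : IsRational A) (c : RatFunc F) :
    IsRational (ratMap (algebraMap F K) c • A) := by
  obtain ⟨P, rfl⟩ := h
  exact ⟨c • P, by rw [opMap_smul, map_smul]⟩

theorem IsRational.polyEmb_smul {A : OpQuot K L} (h : IsRational A) (p : F[X]) :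
    IsRational (polyEmb F K p • A) := by
  rw [polyEmb_eq_ratMap]
  exact h.smul _

theorem IsRational.polyEmb_inv_smul {A : OpQuot K L} (h : IsRational A) (p : F[X]) :
    IsRational ((polyEmb F K p)⁻¹ • A) := by
  rw [polyEmb_eq_ratMap, ← map_inv₀]
  exact h.smul _

theorem IsRational.sum {β : Type*} (s : Finset β) {A : β → OpQuot K L}
    (h : ∀ i ∈ s, IsRational (A i)) : IsRational (∑ i ∈ s, A i) := by
  classical
  induction s using Finset.induction_on with
  | empty => rw [Finset.sum_empty]; exact isRational_zero
  | insert a s ha ih =>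
    rw [Finset.sum_insert ha]
    exact (h a (Finset.mem_insert_self a s)).add
      (ih fun i hi => h i (Finset.mem_insert_of_mem hi))

theorem IsRational.quotD {A : OpQuot K L} (h : IsRational A) : IsRational (quotD A) := by
  obtain ⟨P, rfl⟩ := h
  exact ⟨dMul P, by rw [opMap_dMul, quotD_mk]⟩

/-- If `p` is irreducible over `F` and `p(α) = 0`, the field `F[x]/(p)` has an embedding with
`x ↦ α`. -/
def adjoinRootHom {p : F[X]} {α : K} (h : aeval α p = 0) : AdjoinRoot p →ₐ[F] K :=
  AdjoinRoot.liftAlgHom p (Algebra.ofId F K) α h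

theorem adjoinRootHom_root {p : F[X]} {α : K} (h : aeval α p = 0) :
    adjoinRootHom h (AdjoinRoot.root p) = α := AdjoinRoot.liftAlgHom_root _ _ _ _

/-- By descent, both exponents agree with the one computed over `F[x]/(p)` at the class of `x`. -/
theorem IsStartExponent.eq_of_irreducible (hord : 0 < ord L) {p : F[X]} (hp : Irreducible p)
    {α γ : K} (hα : aeval α p = 0) (hγ : aeval γ p = 0) {e e' : ℤ}
    (he : IsStartExponent ι L α e) (he' : IsStartExponent ι L γ e') : e = e' := by
  have := Fact.mk hp
  have key : ∀ {δ : K} (hδ : aeval δ p = 0) (k : ℤ),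
      IsIntegralAt ι δ (ofRat L ((RatFunc.X - RatFunc.C δ) ^ k)) ↔
        IsIntegralAt ι (AdjoinRoot.root p) ((leftIdeal (AdjoinRoot p) L).mkQ
          (Finsupp.single 0 ((RatFunc.X - RatFunc.C (AdjoinRoot.root p)) ^ k))) := by
    intro δ hδ k
    rw [← isIntegralAt_opMap_iff (adjoinRootHom hδ), adjoinRootHom_root, opMap_single, map_zpow₀,
      map_sub, ratMap_X, ratMap_C]
    have : ((adjoinRootHom hδ : AdjoinRoot p →ₐ[F] K) : AdjoinRoot p →+* K) (AdjoinRoot.root p) =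
      δ := adjoinRootHom_root hδ
    rw [this]
    rfl
  have h1 := he.isLeast hord
  have h2 := he'.isLeast hord
  simp only [key hα] at h1
  simp only [key hγ] at h2
  exact h1.unique h2

/-- Descend from `α` to the class of `x` in `F[x]/(p)`, lift the constants found there to
polynomials, and ascend along the embedding belonging to any other root. -/
theorem exists_rational_pole {B : ℕ → OpQuot K L} (hB : ∀ i, IsRational (B i)) {d : ℕ} {α : K}
    {p : F[X]} (hp : Irreducible p) (hα : aeval α p = 0) {a : ℕ → K}
    (h : IsIntegralAt ι α (poleElement B d α a)) :
    ∃ a' : ℕ → F[X], ∀ γ : K, aeval γ p = 0 →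
      IsIntegralAt ι γ (poleElement B d γ fun i => aeval γ (a' i)) := by
  have := Fact.mk hp
  choose P hP using hB
  -- The factor `(x - root)⁻¹` is absorbed into the operators, so that only constant coefficients
  -- have to be descended.
  obtain ⟨Q, hQ⟩ : ∃ Q : ℕ → ℕ →₀ RatFunc (AdjoinRoot p),
    Q = fun i => (RatFunc.X - RatFunc.C (AdjoinRoot.root p))⁻¹ •
      opMap (algebraMap F (AdjoinRoot p)) (P i) := ⟨_, rfl⟩
  have hmap : ∀ {γ : K} (hγ : aeval γ p = 0) (i : ℕ),
      opMap (adjoinRootHom hγ : AdjoinRoot p →+* K) (Q i) =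
        (RatFunc.X - RatFunc.C γ)⁻¹ • opMap (algebraMap F K) (P i) := by
    intro γ hγ i
    have h1 : ((adjoinRootHom hγ : AdjoinRoot p →ₐ[F] K) : AdjoinRoot p →+* K)
      (AdjoinRoot.root p) = γ := adjoinRootHom_root hγ
    rw [hQ, opMap_smul, map_inv₀, map_sub, ratMap_X, ratMap_C, h1, opMap_comp,
      AlgHom.comp_algebraMap]
  have hpole : ∀ {γ : K} (hγ : aeval γ p = 0) (a : ℕ → K), poleElement B d γ a =
      (leftIdeal K L).mkQ (∑ i ∈ Finset.range d, RatFunc.C (a i) •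
        opMap (adjoinRootHom hγ : AdjoinRoot p →+* K) (Q i) +
          opMap (adjoinRootHom hγ : AdjoinRoot p →+* K) (Q d)) := by
    intro γ hγ a
    rw [poleElement, map_add, map_sum, hmap, map_smul, hP, smul_add, Finset.smul_sum]
    congr 1
    refine Finset.sum_congr rfl fun i _ => ?_
    rw [hmap, map_smul, map_smul, hP, smul_comm]
  rw [hpole hα] at h
  have h' : IsIntegralAt ι (adjoinRootHom hα (AdjoinRoot.root p)) ((leftIdeal K L).mkQ
      (∑ i ∈ Finset.range d, RatFunc.C (a i) • opMap (adjoinRootHom hα : AdjoinRoot p →+* K) (Q i) +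
        opMap (adjoinRootHom hα : AdjoinRoot p →+* K) (Q d))) := by
    rwa [adjoinRootHom_root]
  obtain ⟨a', ha'⟩ := exists_isIntegralAt_combination _ _ _ _ h'
  choose b hb using fun i => AdjoinRoot.mk_surjective (a' i)
  refine ⟨b, fun γ hγ => ?_⟩
  rw [← isIntegralAt_opMap_iff (adjoinRootHom hγ), adjoinRootHom_root] at ha'
  rw [hpole hγ]
  convert ha' using 2
  rw [map_add, map_sum]
  congr 1
  refine Finset.sum_congr rfl fun i _ => ?_
  rw [opMap_smul, ratMap_C, ← hb]
  rfl

/-! ### The factor `∏ (x - α)^(e α)` -/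

-- The exponent is constant on conjugate roots, so grouping the roots by their minimal polynomials
-- gives a product of powers of polynomials over `F`; separability ensures that each root occurs
-- once.
open scoped Classical in
theorem exists_ratMap_prod [IsAlgClosed K] {f : F[X]} (hf : f ≠ 0) (e : K → ℤ)
    (he : ∀ p : F[X], Irreducible p → p ∣ f → ∀ α γ : K, aeval α p = 0 → aeval γ p = 0 →
      e α = e γ) :
    ∃ c : RatFunc F, ratMap (algebraMap F K) c =
      ∏ α ∈ (f.aroots K).toFinset, (RatFunc.X - RatFunc.C α) ^ (e α) := by
  have hroot : ∀ α, α ∈ (f.aroots K).toFinset ↔ aeval α f = 0 := fun α => by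
    rw [Multiset.mem_toFinset, Polynomial.mem_aroots]
    exact and_iff_right hf
  rw [← Finset.prod_fiberwise_of_maps_to (g := minpoly F)
    (t := (f.aroots K).toFinset.image (minpoly F)) fun α h => Finset.mem_image_of_mem _ h]
  have hmem : ∀ x : RatFunc K, x ∈ (ratMap (algebraMap F K)).fieldRange ↔
      ∃ c, ratMap (algebraMap F K) c = x := fun x => Iff.rfl
  rw [← hmem]
  refine prod_mem fun p hp => (hmem _).mpr ?_
  obtain ⟨α, hα, rfl⟩ := Finset.mem_image.mp hp
  rw [hroot] at hα
  have hαint : IsIntegral F α := IsAlgebraic.isIntegral ⟨f, hf, hα⟩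
  have hirr := minpoly.irreducible hαint
  have hdvd := minpoly.dvd F α hα
  refine ⟨(algebraMap F[X] (RatFunc F) (minpoly F α)) ^ (e α), ?_⟩
  have hset : (f.aroots K).toFinset.filter (fun β => minpoly F β = minpoly F α) =
      ((minpoly F α).map (algebraMap F K)).roots.toFinset := by
    ext β
    rw [Finset.mem_filter, hroot, Multiset.mem_toFinset]
    rw [← Polynomial.aroots_def, Polynomial.mem_aroots]
    constructor
    · rintro ⟨-, h⟩
      exact ⟨hirr.ne_zero, by rw [← h]; exact minpoly.aeval F β⟩
    · rintro ⟨-, h⟩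
      refine ⟨aeval_eq_zero_of_dvd_aeval_eq_zero hdvd h, ?_⟩
      exact (minpoly.eq_of_irreducible_of_monic hirr h (minpoly.monic hαint)).symm
  rw [hset, Finset.prod_congr rfl (g := fun β => (RatFunc.X - RatFunc.C β) ^ (e α)) fun β hβ => by
    rw [Multiset.mem_toFinset, ← Polynomial.aroots_def, Polynomial.mem_aroots] at hβ
    rw [he _ hirr hdvd β α hβ.2 (minpoly.aeval F α)]]
  have hnodup : ((minpoly F α).map (algebraMap F K)).roots.Nodup :=
    Polynomial.nodup_roots hirr.separable.map
  rw [map_zpow₀, ratMap_algebraMap, Finset.prod_zpow]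
  congr 1
  conv_lhs => rw [((IsAlgClosed.splits ((minpoly F α).map (algebraMap F K)))
    |>.eq_prod_roots_of_monic ((minpoly.monic hαint).map _))]
  rw [map_multiset_prod, Multiset.map_map, Finset.prod, Multiset.toFinset_val,
    Multiset.dedup_eq_self.mpr hnodup]
  congr 1
  exact Multiset.map_congr rfl fun β _ => algebraMap_X_sub_C β

end Rational

section Initial

set_option linter.unusedSectionVars false

variable {F K : Type*} [Field F] [CharZero F] [Field K] [Algebra F K]
  {ι : ModInt F → ℕ → F} {L : ℕ →₀ F[X]}

/-! ### The initial configuration -/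

open scoped Classical in
/-- The coefficient `∏ (x - α)^(e α)`, where `α` runs over the roots of the leading coefficient. -/
def startFactor (L : ℕ →₀ F[X]) (e : K → ℤ) : RatFunc K :=
  ∏ α ∈ ((lead L).aroots K).toFinset, (RatFunc.X - RatFunc.C α) ^ (e α)

open scoped Classical in
theorem mem_aroots_lead (hord : 0 < ord L) (α : K) :
    α ∈ ((lead L).aroots K).toFinset ↔ aeval α (lead L) = 0 := by
  rw [Multiset.mem_toFinset, Polynomial.mem_aroots]
  exact and_iff_right (lead_ne_zero hord)

theorem startFactor_ne_zero (e : K → ℤ) : startFactor L e ≠ 0 :=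
  Finset.prod_ne_zero_iff.mpr fun α _ => zpow_ne_zero _ (X_sub_C_ne_zero α)

theorem isUnitAt_startFactor (hord : 0 < ord L) (e : K → ℤ) {α : K}
    (hα : aeval α (lead L) ≠ 0) : IsUnitAt F α (startFactor L e) := by
  classical
  refine IsUnitAt.prod _ fun β hβ => (isUnitAt_X_sub_C ?_).zpow _
  rintro rfl
  exact hα ((mem_aroots_lead hord _).mp hβ)

theorem exists_startFactor_eq (hord : 0 < ord L) (e : K → ℤ) {α : K}
    (hα : aeval α (lead L) = 0) :
    ∃ u, IsUnitAt F α u ∧ startFactor L e = u * (RatFunc.X - RatFunc.C α) ^ (e α) := by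
  classical
  refine ⟨_, IsUnitAt.prod (((lead L).aroots K).toFinset.erase α) fun β hβ =>
    (isUnitAt_X_sub_C (Finset.ne_of_mem_erase hβ).symm).zpow (e β), ?_⟩
  exact (Finset.prod_erase_mul _ _ ((mem_aroots_lead hord α).mpr hα)).symm

theorem isIntegralAt_ofRat_one (hι : IsThreshold ι) (hord : 0 < ord L) {α : K}
    (hα : aeval α (lead L) ≠ 0) : IsIntegralAt ι α (ofRat L 1) := by
  intro f hf
  rw [Solution.apply_ofRat, map_one, one_mul]
  refine isIntegralSeries_of_exponentsFrom_zero hι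
    (exponentsFrom_zero_of_ordinary hord hα f hf ⟨0, hord⟩) fun μ j hj => ?_
  have : CharZero K := charZero_of_injective_algebraMap (algebraMap F K).injective
  have h := derivative_eq_zero_of_ordinary hord hα f hf
  obtain ⟨j, rfl⟩ := Nat.exists_eq_succ_of_ne_zero hj
  have h1 := termCoeff_derivative f.1 μ j
  rw [h, termCoeff_zero] at h1
  exact (mul_eq_zero.mp h1.symm).resolve_left (by exact_mod_cast Nat.succ_ne_zero j)

theorem isIntegralElement_start (hι : IsThreshold ι) (hord : 0 < ord L) {e : K → ℤ}
    (he : ∀ α, aeval α (lead L) = 0 → IsStartExponent ι L α (e α)) :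
    IsIntegralElement ι (ofRat L (startFactor L e)) := by
  intro α
  by_cases hα : aeval α (lead L) = 0
  · obtain ⟨u, hu, h⟩ := exists_startFactor_eq (F := F) hord e hα
    rw [h, ← smul_ofRat]
    exact IsIntegralAt.smul hι ((he α hα).isLeast hord).1 hu.isRegularAt
  · rw [← mul_one (startFactor L e), ← smul_ofRat]
    exact IsIntegralAt.smul hι (isIntegralAt_ofRat_one hι hord hα)
      (isUnitAt_startFactor hord e hα).isRegularAt

/-- The factors belonging to other roots are units at `α`; after cancelling them, the exponent `e α
- 1` would be admissible, against minimality. -/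
theorem not_isIntegralAt_start (hι : IsThreshold ι) (hord : 0 < ord L) {e : K → ℤ}
    (he : ∀ α, aeval α (lead L) = 0 → IsStartExponent ι L α (e α)) {α : K}
    (hα : aeval α (lead L) = 0) :
    ¬ IsIntegralAt ι α ((RatFunc.X - RatFunc.C α)⁻¹ • ofRat L (startFactor L e)) := by
  intro h
  obtain ⟨u, hu, hs⟩ := exists_startFactor_eq (F := F) hord e hα
  have hx := X_sub_C_ne_zero α
  rw [smul_ofRat, hs, mul_left_comm, ← zpow_neg_one, ← zpow_add₀ hx, ← smul_ofRat] at h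
  have := ((he α hα).isLeast hord).2 (h.of_smul hι hu)
  omega

theorem isRational_start [IsAlgClosed K] (hord : 0 < ord L) {e : K → ℤ}
    (he : ∀ α, aeval α (lead L) = 0 → IsStartExponent ι L α (e α)) :
    IsRational (ofRat L (startFactor L e)) := by
  obtain ⟨c, hc⟩ := exists_ratMap_prod (K := K) (lead_ne_zero hord) e fun p hp hdvd α γ hα hγ =>
    IsStartExponent.eq_of_irreducible hord hp hα hγ
      (he α (aeval_eq_zero_of_dvd_aeval_eq_zero hdvd hα))
      (he γ (aeval_eq_zero_of_dvd_aeval_eq_zero hdvd hγ))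
  refine ⟨Finsupp.single 0 c, ?_⟩
  rw [opMap_single, hc]
  rfl

theorem quotD_smul (c : RatFunc K) (A : OpQuot K L) :
    quotD (c • A) = ratDeriv c • A + c • quotD A := by
  obtain ⟨P, rfl⟩ := (leftIdeal K L).mkQ_surjective A
  rw [← map_smul, quotD_mk, quotD_mk, dMul_smul, map_add, map_smul, map_smul]

theorem ratDeriv_algebraMap (p : K[X]) :
    ratDeriv (algebraMap K[X] (RatFunc K) p) = algebraMap K[X] (RatFunc K) (derivative p) := by
  have := ratDeriv_div p 1 one_ne_zero
  rwa [map_one, div_one, one_pow, div_one, derivative_one, mul_zero, sub_zero, mul_one] at this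

theorem isIntegralElement_pow_smul_quotD_iterate (hι : IsThreshold ι) (hord : 0 < ord L)
    {A : OpQuot K L} (hA : IsIntegralElement ι A) (i : ℕ) :
    IsIntegralElement ι (polyEmb F K (sqfreePart L) ^ i • quotD^[i] A) := by
  intro α
  induction i with
  | zero => rw [pow_zero, one_smul]; exact hA α
  | succ i ih =>
    obtain ⟨s, hs⟩ : ∃ s, s = (sqfreePart L).map (algebraMap F K) := ⟨_, rfl⟩
    have hs' : polyEmb F K (sqfreePart L) = algebraMap K[X] (RatFunc K) s := by
      rw [hs, polyEmb_apply]
    -- With `t = i s'`, the operator `s^(i+1) D^(i+1)` is `s D - t` applied to the previous element,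
    -- and both summands preserve integrality.
    obtain ⟨t, ht⟩ : ∃ t : K[X], derivative (s ^ i) * s = t * s ^ i := by
      refine ⟨C (i : K) * derivative s, ?_⟩
      rw [derivative_pow]
      cases i with
      | zero => simp
      | succ i => rw [Nat.add_sub_cancel, pow_succ]; ring
    have h1 := IsIntegralAt.sqfreePart_smul_quotD hι hord ih
    have h2 := IsIntegralAt.smul hι ih (isRegularAt_algebraMap α t)
    have h3 := h1.sub h2
    rw [quotD_smul, hs', ← map_pow, ratDeriv_algebraMap, smul_add, smul_smul, smul_smul, smul_smul,
      ← map_mul, ← map_mul, ← map_mul, mul_comm s (derivative _), ht, add_sub_cancel_left] at h3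
    rw [hs', ← map_pow, Function.iterate_succ_apply', pow_succ']
    exact h3

theorem exists_rep_quotD_iterate (c : RatFunc K) (i : ℕ) :
    ∃ P : ℕ →₀ RatFunc K, (∀ k, i < k → P k = 0) ∧ P i = c ∧
      (leftIdeal K L).mkQ P = quotD^[i] (ofRat L c) := by
  induction i with
  | zero => exact ⟨Finsupp.single 0 c, fun k hk => Finsupp.single_eq_of_ne hk.ne',
      Finsupp.single_eq_same, rfl⟩
  | succ i ih =>
    have := exists_rep_quotD ih 1
    rwa [one_mul, one_smul, ← Function.iterate_succ_apply' quotD] at this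

theorem isTriangular_start (c : RatFunc K) :
    IsTriangular (fun i => polyEmb F K (sqfreePart L) ^ i • quotD^[i] (ofRat L c))
      (fun i => polyEmb F K (sqfreePart L) ^ i * c) := by
  intro i _
  obtain ⟨P, hP, hPi, hPA⟩ := exists_rep_quotD_iterate (L := L) c i
  refine ⟨polyEmb F K (sqfreePart L) ^ i • P, fun k hk => ?_, ?_, ?_⟩
  · rw [Finsupp.smul_apply, hP k hk, smul_zero]
  · rw [Finsupp.smul_apply, hPi, smul_eq_mul]
  · rw [map_smul, hPA]

theorem isUnitAt_sqfreePart (hord : 0 < ord L) {α : K} (hα : aeval α (lead L) ≠ 0) :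
    IsUnitAt F α (polyEmb F K (sqfreePart L)) := by
  rw [polyEmb_apply]
  refine isUnitAt_algebraMap ?_
  rwa [Polynomial.eval_map_algebraMap, Ne, aeval_sqfreePart_eq_zero_iff hord]

theorem isRational_pow_smul_quotD_iterate {A : OpQuot K L} (h : IsRational A) (p : F[X]) (i : ℕ) :
    IsRational (polyEmb F K p ^ i • quotD^[i] A) := by
  rw [← map_pow]
  refine IsRational.polyEmb_smul ?_ _
  induction i with
  | zero => exact h
  | succ i ih => rw [Function.iterate_succ_apply']; exact ih.quotD

/-! ### The invariant of the algorithm -/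

/-- The invariant of the algorithm; `lc i` is the leading coefficient of an operator of order `i`
that represents `B i`, and `c₀` the initial value of `lc 0`. -/
structure IsAdmissible (ι : ModInt F → ℕ → F) (c : Config K L) (c₀ : RatFunc K)
    (lc : ℕ → RatFunc K) : Prop where
  stage_lt : c.stage < ord L
  integral : ∀ i < ord L, IsIntegralElement ι (c.B i)
  rational : ∀ i, IsRational (c.B i)
  triangular : IsTriangular c.B lc
  lc_ne_zero : ∀ i < ord L, lc i ≠ 0
  lc_stage : ∃ q : K[X], q ≠ 0 ∧
    polyEmb F K (sqfreePart L) ^ c.stage * c₀ = algebraMap K[X] (RatFunc K) q * lc c.stage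
  lc_gt : ∀ i, c.stage < i → lc i = polyEmb F K (sqfreePart L) ^ i * c₀
  spanBelow : SpanBelow ι c.B c.stage
  minimal : ∀ α : K, aeval α (lead L) = 0 →
    ¬ IsIntegralAt ι α ((RatFunc.X - RatFunc.C α)⁻¹ • c.B 0)
  level_eq_zero : ∀ α : K, aeval α (lead L) ≠ 0 → wronskianLevel ι c.B α = 0

theorem spanBelow_zero (B : ℕ → OpQuot K L) : SpanBelow ι B 0 := by
  rintro A - ⟨P, hP, rfl⟩
  have : P = 0 := Finsupp.ext fun k => hP k (Nat.zero_le k)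
  rw [this, map_zero]
  exact Submodule.zero_mem _

theorem SpanBelow.congr {B B' : ℕ → OpQuot K L} {d : ℕ} (h : SpanBelow ι B d)
    (hB : ∀ i < d, B' i = B i) : SpanBelow ι B' d := by
  intro A hA hP
  have : B' '' Set.Iio d = B '' Set.Iio d := Set.image_congr fun i hi => hB i hi
  rw [this]
  exact h A hA hP

theorem IsInitial.exists_isAdmissible [IsAlgClosed K] (hι : IsThreshold ι) (hord : 0 < ord L)
    (hL : IsRegular K L) {c : Config K L} (h : IsInitial ι L c) :
    ∃ c₀ lc, IsAdmissible ι c c₀ lc := by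
  classical
  obtain ⟨hstage, -, e, he, hB⟩ := h
  have he' : ∀ α, aeval α (lead L) = 0 → IsStartExponent ι L α (e α) := fun α hα =>
    he α (by convert (mem_aroots_lead hord α).mpr hα)
  obtain ⟨c₀, hc₀⟩ : ∃ c₀, c₀ = startFactor L e := ⟨_, rfl⟩
  have hBeq : c.B = fun i => polyEmb F K (sqfreePart L) ^ i • quotD^[i] (ofRat L c₀) := by
    funext i
    rw [hB i, hc₀, startFactor, ofRat]
  have hs : polyEmb F K (sqfreePart L) ≠ 0 := polyEmb_ne_zero (sqfreePart_ne_zero hord)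
  have hne : c₀ ≠ 0 := hc₀ ▸ startFactor_ne_zero e
  have hint : ∀ i, IsIntegralElement ι (c.B i) := fun i => by
    rw [hBeq, hc₀]
    exact isIntegralElement_pow_smul_quotD_iterate hι hord (isIntegralElement_start hι hord he') i
  have htri : IsTriangular c.B fun i => polyEmb F K (sqfreePart L) ^ i * c₀ :=
    hBeq ▸ isTriangular_start c₀
  have hlc : ∀ i < ord L, polyEmb F K (sqfreePart L) ^ i * c₀ ≠ 0 := fun i _ =>
    mul_ne_zero (pow_ne_zero _ hs) hne
  refine ⟨c₀, fun i => polyEmb F K (sqfreePart L) ^ i * c₀, hstage ▸ hord, fun i _ => hint i,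
    fun i => ?_, htri, hlc, ⟨1, one_ne_zero, by rw [map_one, one_mul]⟩, fun i _ => rfl,
    hstage ▸ spanBelow_zero _, fun α hα => ?_, fun α hα => ?_⟩
  · rw [hBeq, hc₀]
    exact isRational_pow_smul_quotD_iterate (isRational_start hord he') _ i
  · rw [hBeq, hc₀]
    simp only [pow_zero, one_smul, Function.iterate_zero, id_eq]
    exact not_isIntegralAt_start hι hord he' hα
  -- Away from the roots of the leading coefficient of `L`, every initial `lc i` is a unit.
  · obtain ⟨v, hv, h⟩ : IsUnitAt F α
        (∏ i : Fin (ord L), polyEmb F K (sqfreePart L) ^ (i : ℕ) * c₀) :=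
      IsUnitAt.prod _ fun i _ => ((isUnitAt_sqfreePart hord hα).pow _).mul
        (hc₀ ▸ isUnitAt_startFactor hord e hα)
    exact wronskianLevel_eq_zero_of_ordinary hι hord hL htri hlc (fun i _ => hint i α) hα hv h

theorem exists_isInitial (hι : IsThreshold ι) (hord : 0 < ord L) (hL : IsRegular K L) :
    ∃ c : Config K L, IsInitial ι L c := by
  choose e he using exists_isStartExponent (ι := ι) hι hord hL
  exact ⟨⟨0, _, false⟩, rfl, rfl, e, fun α _ => he α, fun _ => rfl⟩

end Initial

/-! ### Preservation of the invariant -/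

section Steps

set_option linter.unusedSectionVars false

variable {F K : Type*} [Field F] [CharZero F] [Field K] [Algebra F K]
  {ι : ModInt F → ℕ → F} {L : ℕ →₀ F[X]}

namespace IsAdmissible

variable {c c' : Config K L} {c₀ : RatFunc K} {lc : ℕ → RatFunc K}

/-- A pole needs a positive level, and levels vanish at ordinary points. -/
theorem aeval_eq_zero_of_pole (hι : IsThreshold ι) (hord : 0 < ord L) (hL : IsRegular K L)
    (h : IsAdmissible ι c c₀ lc) {α : K} {d : ℕ} (hd : d < ord L) {a : ℕ → K}
    (ha : IsIntegralAt ι α (poleElement c.B d α a)) : aeval α (lead L) = 0 := by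
  by_contra hα
  exact wronskianLevel_ne_zero_of_pole hι hord hL h.triangular h.lc_ne_zero
    (fun i hi => h.integral i hi α) hd ha (h.level_eq_zero α hα)

/-- Only stage `0` needs an argument, as it has no loop: a missing element would yield a pole of `B
0` itself, which the choice of the start exponents excludes. -/
theorem missing_eq_empty [IsAlgClosed K] (hι : IsThreshold ι) (hord : 0 < ord L)
    (hL : IsRegular K L) (h : IsAdmissible ι c c₀ lc) (hdone : StageDone ι c) :
    missing ι c.B c.stage = ∅ := by
  rcases Nat.eq_zero_or_pos c.stage with h0 | h0
  · by_contra hne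
    obtain ⟨A, hA⟩ := Set.nonempty_iff_ne_empty.mpr hne
    obtain ⟨α, a, ha⟩ := exists_pole hι h.triangular h.lc_ne_zero h.integral h.stage_lt h.spanBelow
      hA
    refine h.minimal α (h.aeval_eq_zero_of_pole hι hord hL h.stage_lt ha) ?_
    rwa [h0, poleElement, Finset.range_zero, Finset.sum_empty, zero_add] at ha
  · exact hdone.2 h0

theorem update (hι : IsThreshold ι) (hord : 0 < ord L) (hL : IsRegular K L)
    (h : IsAdmissible ι c c₀ lc) {p : F[X]} (hu : IsUpdate ι p c c') :
    IsAdmissible ι c' c₀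
      (Function.update lc c.stage ((polyEmb F K p)⁻¹ * lc c.stage)) ∧
    ∀ α : K, wronskianLevel ι c'.B α + (p.map (algebraMap F K)).rootMultiplicity α =
        wronskianLevel ι c.B α := by
  obtain ⟨-, hpos, hp, a, A, hA, hAeq, rfl⟩ := hu
  have hp' : polyEmb F K p ≠ 0 := polyEmb_ne_zero hp
  have htri := h.triangular.update (hAeq ▸ exists_rep_combination h.triangular h.stage_lt
    (polyEmb F K p)⁻¹ fun i => polyEmb F K (a i))
  have hlc := update_ne_zero (d := c.stage) (mul_ne_zero (inv_ne_zero hp') (h.lc_ne_zero _ h.stage_lt))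
    h.lc_ne_zero
  have hint : ∀ i < ord L, IsIntegralElement ι (Function.update c.B c.stage A i) := by
    intro i hi
    by_cases hid : i = c.stage
    · rw [hid, Function.update_self]
      exact hA.1.1
    · rw [Function.update_of_ne hid]
      exact h.integral i hi
  have hlevel : ∀ α : K, wronskianLevel ι (Function.update c.B c.stage A) α +
      (p.map (algebraMap F K)).rootMultiplicity α = wronskianLevel ι c.B α := fun α =>
    wronskianLevel_add_rootMultiplicity hι hord hL h.triangular htri h.lc_ne_zero hlc
      (fun i hi => h.integral i hi α) (fun i hi => hint i hi α)
      ((Polynomial.map_ne_zero_iff (algebraMap F K).injective).mpr hp) (by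
        rw [prod_update_mul lc h.stage_lt, ← polyEmb_apply, mul_inv_cancel_left₀ hp'])
  refine ⟨⟨h.stage_lt, hint, fun i => ?_, htri, hlc, ?_, fun i hi => ?_, ?_, fun α hα => ?_,
    fun α hα => ?_⟩, hlevel⟩
  · change IsRational (Function.update c.B c.stage A i)
    by_cases hid : i = c.stage
    · rw [hid, Function.update_self, hAeq]
      exact ((IsRational.sum _ fun i _ => (h.rational i).polyEmb_smul _).add
        (h.rational _)).polyEmb_inv_smul p
    · rw [Function.update_of_ne hid]
      exact h.rational i
  · obtain ⟨q, hq, hqe⟩ := h.lc_stage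
    refine ⟨q * p.map (algebraMap F K), mul_ne_zero hq
      ((Polynomial.map_ne_zero_iff (algebraMap F K).injective).mpr hp), ?_⟩
    change _ = _ * Function.update lc c.stage _ c.stage
    rw [Function.update_self, hqe, map_mul, ← polyEmb_apply, mul_assoc, mul_inv_cancel_left₀ hp']
  · change c.stage < i at hi
    rw [Function.update_of_ne hi.ne']
    exact h.lc_gt i hi
  · exact h.spanBelow.congr fun i hi => Function.update_of_ne hi.ne _ _
  · change ¬ IsIntegralAt ι α (_ • Function.update c.B c.stage A 0)
    rw [Function.update_of_ne hpos.ne]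
    exact h.minimal α hα
  · have := hlevel α
    rw [h.level_eq_zero α hα] at this
    exact (Nat.add_eq_zero_iff.mp this).1

/-- The new leading coefficient in position `d + 1` is `s * lc d`, the old one is `s^(d+1) c₀`, and
their quotient is the polynomial `q` accumulated so far. The same `q` serves as the record for the
next stage. -/
theorem nextStage [IsAlgClosed K] (hι : IsThreshold ι) (hord : 0 < ord L) (hL : IsRegular K L)
    (h : IsAdmissible ι c c₀ lc) (hn : IsNextStage ι c c') :
    IsAdmissible ι c' c₀ (Function.update lc (c.stage + 1)
      (polyEmb F K (sqfreePart L) * lc c.stage)) ∧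
    ∀ α : K, wronskianLevel ι c'.B α ≤ wronskianLevel ι c.B α := by
  obtain ⟨hdone, hlt, rfl⟩ := hn
  obtain ⟨s, hs⟩ : ∃ s, s = polyEmb F K (sqfreePart L) := ⟨_, rfl⟩
  have hs0 : s ≠ 0 := hs ▸ polyEmb_ne_zero (sqfreePart_ne_zero hord)
  have htri := h.triangular.update (exists_rep_quotD (h.triangular _ h.stage_lt) s)
  have hlc := update_ne_zero (d := c.stage + 1) (mul_ne_zero hs0 (h.lc_ne_zero _ h.stage_lt))
    h.lc_ne_zero
  have hint : ∀ i < ord L,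
      IsIntegralElement ι (Function.update c.B (c.stage + 1) (s • quotD (c.B c.stage)) i) := by
    intro i hi
    by_cases hid : i = c.stage + 1
    · rw [hid, Function.update_self, hs]
      exact fun α => IsIntegralAt.sqfreePart_smul_quotD hι hord (h.integral _ h.stage_lt α)
    · rw [Function.update_of_ne hid]
      exact h.integral i hi
  obtain ⟨q, hq, hqe⟩ := h.lc_stage
  have hold : lc (c.stage + 1) = algebraMap K[X] (RatFunc K) q * (s * lc c.stage) := by
    rw [h.lc_gt _ (Nat.lt_succ_self _), pow_succ', mul_assoc, hqe, hs]
    ring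
  have hlevel : ∀ α : K, wronskianLevel ι
      (Function.update c.B (c.stage + 1) (s • quotD (c.B c.stage))) α + q.rootMultiplicity α =
        wronskianLevel ι c.B α := fun α =>
    wronskianLevel_add_rootMultiplicity hι hord hL h.triangular htri h.lc_ne_zero hlc
      (fun i hi => h.integral i hi α) (fun i hi => hint i hi α) hq (by
        rw [← prod_update_mul _ hlt, Function.update_self, ← hold, Function.update_idem,
          Function.update_eq_self])
  rw [← hs]
  refine ⟨⟨hlt, hint, fun i => ?_, htri, hlc, ⟨q, hq, ?_⟩, fun i hi => ?_, ?_, fun α hα => ?_,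
    fun α hα => ?_⟩, fun α => (Nat.le_add_right _ _).trans_eq (hlevel α)⟩
  · change IsRational (Function.update c.B (c.stage + 1) (s • quotD (c.B c.stage)) i)
    by_cases hid : i = c.stage + 1
    · rw [hid, Function.update_self, hs]
      exact (h.rational _).quotD.polyEmb_smul _
    · rw [Function.update_of_ne hid]
      exact h.rational i
  · change _ = _ * Function.update lc (c.stage + 1) _ (c.stage + 1)
    rw [Function.update_self, ← hold, h.lc_gt _ (Nat.lt_succ_self _)]
  · change c.stage + 1 < i at hi
    rw [Function.update_of_ne hi.ne']
    exact h.lc_gt i (by omega)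
  · refine SpanBelow.congr (B := c.B) ?_ fun i hi => Function.update_of_ne hi.ne _ _
    intro A hA hP
    by_contra hAs
    -- The condition that ended the previous stage is exactly the spanning property needed for the
    -- next one.
    have : A ∈ missing ι c.B c.stage := by
      refine ⟨⟨hA, ?_⟩, fun hmem => hAs ?_⟩
      · obtain ⟨P, hP, hPA⟩ := hP
        exact ⟨P, fun i hi => hP i hi, hPA⟩
      · rw [show Set.Iio (c.stage + 1) = Set.Iic c.stage from
          Set.ext fun i => Nat.lt_succ_iff]
        exact hmem
    rw [h.missing_eq_empty hι hord hL hdone] at this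
    exact this
  · change ¬ IsIntegralAt ι α (_ • Function.update c.B (c.stage + 1) (s • quotD (c.B c.stage)) 0)
    rw [Function.update_of_ne (Nat.succ_ne_zero _).symm]
    exact h.minimal α hα
  · have := hlevel α
    rw [h.level_eq_zero α hα] at this
    exact (Nat.add_eq_zero_iff.mp this).1

theorem step [IsAlgClosed K] (hι : IsThreshold ι) (hord : 0 < ord L) (hL : IsRegular K L)
    (h : IsAdmissible ι c c₀ lc) (hs : Step ι c c') : ∃ lc', IsAdmissible ι c' c₀ lc' := by
  rcases hs with ⟨p, hu⟩ | hn | ⟨-, -, rfl⟩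
  · exact ⟨_, (h.update hι hord hL hu).1⟩
  · exact ⟨_, (h.nextStage hι hord hL hn).1⟩
  · exact ⟨lc, h.stage_lt, h.integral, h.rational, h.triangular, h.lc_ne_zero, h.lc_stage, h.lc_gt,
      h.spanBelow, h.minimal, h.level_eq_zero⟩

end IsAdmissible

theorem Reachable.exists_isAdmissible [IsAlgClosed K] (hι : IsThreshold ι) (hord : 0 < ord L)
    (hL : IsRegular K L) {c : Config K L} (h : Reachable ι c) :
    ∃ c₀ lc, IsAdmissible ι c c₀ lc := by
  obtain ⟨c₁, h1, hc⟩ := h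
  obtain ⟨c₀, lc, hadm⟩ := h1.exists_isAdmissible hι hord hL
  induction hc with
  | refl => exact ⟨c₀, lc, hadm⟩
  | tail _ hs ih =>
    obtain ⟨c₀, lc, h⟩ := ih
    obtain ⟨lc', h'⟩ := h.step hι hord hL hs
    exact ⟨c₀, lc', h'⟩

end Steps

section Updates

set_option linter.unusedSectionVars false

variable {F K : Type*} [Field F] [CharZero F] [Field K] [Algebra F K]
  {ι : ModInt F → ℕ → F} {L : ℕ →₀ F[X]}

/-! ### Existence of updates -/

/-- Otherwise the zero element could take the place of `B d` in a triangular system with nonzero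
leading coefficients, whose Wronskian would both vanish and not vanish. Any point serves for the
argument. -/
theorem IsTriangular.combination_eq_zero (hL : IsRegular K L)
    {B : ℕ → OpQuot K L} {lc : ℕ → RatFunc K} (hB : IsTriangular B lc)
    (hlc : ∀ i < ord L, lc i ≠ 0) {d : ℕ} (hd : d < ord L) {x : RatFunc K} {a : ℕ → RatFunc K}
    (h : x • (∑ i ∈ Finset.range d, a i • B i + B d) = 0) : x = 0 := by
  by_contra hx
  obtain ⟨b, hb⟩ := hL 0
  refine genWronskian_ne_zero (hB.update (h ▸ exists_rep_combination hB hd x a))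
    (update_ne_zero (mul_ne_zero hx (hlc d hd)) hlc) hb ?_
  refine Matrix.det_eq_zero_of_row_eq_zero ⟨d, hd⟩ fun j => ?_
  rw [Matrix.of_apply, Function.update_self, map_zero]

/-- At a root `γ` write `p = (x - γ) m`, where `m` is a unit at `γ` by separability. Multiplied by
`m`, the element becomes the pole element at `γ` plus polynomial multiples of the `B i`. Elsewhere
`p` is a unit. -/
theorem isIntegralElement_of_poles (hι : IsThreshold ι) {B : ℕ → OpQuot K L}
    (hint : ∀ i < ord L, IsIntegralElement ι (B i)) {d : ℕ} (hd : d < ord L) {p : F[X]}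
    (hp : Irreducible p) {a : ℕ → F[X]}
    (h : ∀ γ : K, aeval γ p = 0 → IsIntegralAt ι γ (poleElement B d γ fun i => aeval γ (a i))) :
    IsIntegralElement ι ((polyEmb F K p)⁻¹ •
      (∑ i ∈ Finset.range d, polyEmb F K (a i) • B i + B d)) := by
  have hpoly : ∀ (γ : K) (q : K[X]) (i : ℕ), i < ord L →
      IsIntegralAt ι γ (algebraMap K[X] (RatFunc K) q • B i) := fun γ q i hi =>
    IsIntegralAt.smul hι (hint i hi γ) (isRegularAt_algebraMap γ q)
  intro γ
  by_cases hγ : aeval γ p = 0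
  · have hroot : (p.map (algebraMap F K)).IsRoot γ := by
      rwa [Polynomial.IsRoot, Polynomial.eval_map_algebraMap]
    obtain ⟨m, hm⟩ := Polynomial.dvd_iff_isRoot.mpr hroot
    have hm0 : m.eval γ ≠ 0 := by
      intro h0
      have hsep : (p.map (algebraMap F K)).Separable := hp.separable.map
      have h1 := hsep.aeval_derivative_ne_zero (x := γ) (by
        rw [Polynomial.coe_aeval_eq_eval]; exact hroot)
      refine h1 ?_
      rw [Polynomial.coe_aeval_eq_eval, hm, derivative_mul, Polynomial.eval_add,
        Polynomial.eval_mul, Polynomial.eval_mul, h0]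
      simp
    have hx := X_sub_C_ne_zero γ
    have hu : IsUnitAt F γ (algebraMap K[X] (RatFunc K) m) := isUnitAt_algebraMap hm0
    have hp' : (algebraMap K[X] (RatFunc K) m) * (polyEmb F K p)⁻¹ =
        (RatFunc.X - RatFunc.C γ)⁻¹ := by
      rw [polyEmb_apply, hm, map_mul, algebraMap_X_sub_C, mul_inv, mul_left_comm,
        mul_inv_cancel₀ hu.ne_zero, mul_one]
    choose q hq using fun i => Polynomial.X_sub_C_dvd_sub_C_eval (a := γ)
      (p := (a i).map (algebraMap F K))
    have hsplit : ∀ i, polyEmb F K (a i) = RatFunc.C (aeval γ (a i)) +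
        (RatFunc.X - RatFunc.C γ) * algebraMap K[X] (RatFunc K) (q i) := by
      intro i
      rw [← algebraMap_X_sub_C, ← map_mul, ← hq, map_sub, RatFunc.algebraMap_C,
        Polynomial.eval_map_algebraMap, polyEmb_apply, add_sub_cancel]
    refine IsIntegralAt.of_smul hι hu ?_
    have : (algebraMap K[X] (RatFunc K) m) • (polyEmb F K p)⁻¹ •
        (∑ i ∈ Finset.range d, polyEmb F K (a i) • B i + B d) =
        poleElement B d γ (fun i => aeval γ (a i)) +
          ∑ i ∈ Finset.range d, algebraMap K[X] (RatFunc K) (q i) • B i := by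
      rw [smul_smul, hp', poleElement, smul_add, smul_add, add_right_comm, Finset.smul_sum,
        Finset.smul_sum, ← Finset.sum_add_distrib]
      congr 1
      refine Finset.sum_congr rfl fun i _ => ?_
      rw [hsplit, smul_smul, smul_smul, ← add_smul, mul_add, inv_mul_cancel_left₀ hx]
    rw [this]
    exact (h γ hγ).add (IsIntegralAt.sum _ fun i hi =>
      hpoly γ _ i ((Finset.mem_range.mp hi).trans hd))
  · have hu : IsUnitAt F γ (polyEmb F K p) := by
      rw [polyEmb_apply]
      exact isUnitAt_algebraMap (by rwa [Polynomial.eval_map_algebraMap])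
    refine IsIntegralAt.smul hι ?_ hu.inv.isRegularAt
    exact (IsIntegralAt.sum _ fun i hi => hpoly γ _ i ((Finset.mem_range.mp hi).trans hd)).add
      (hint d hd γ)

/-- Comparing the coefficients of `B d` shows that `p⁻¹` is a polynomial. This certifies that the
element built from a pole is really missing from the span. -/
theorem natDegree_eq_zero_of_mem_spanUpTo (hL : IsRegular K L)
    {B : ℕ → OpQuot K L} {lc : ℕ → RatFunc K} (hB : IsTriangular B lc)
    (hlc : ∀ i < ord L, lc i ≠ 0) {d : ℕ} (hd : d < ord L) {p : F[X]} (hp : p ≠ 0)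
    {a : ℕ → F[X]}
    (h : (polyEmb F K p)⁻¹ • (∑ i ∈ Finset.range d, polyEmb F K (a i) • B i + B d) ∈
      spanUpTo B d) : p.natDegree = 0 := by
  have hp' : polyEmb F K p ≠ 0 := polyEmb_ne_zero hp
  rw [spanUpTo, show Set.Iic d = ((Finset.range (d + 1) : Finset ℕ) : Set ℕ) from
    Set.ext fun i => by simp,
    Submodule.mem_span_image_finset_iff_exists_fun'] at h
  obtain ⟨c, hc⟩ := h
  rw [Finset.sum_range_succ] at hc
  simp only [polynomial_smul_eq] at hc
  obtain ⟨x, hx⟩ : ∃ x, x = (polyEmb F K p)⁻¹ - algebraMap K[X] (RatFunc K) (c d) := ⟨_, rfl⟩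
  have hx0 : x = 0 := by
    by_contra hne
    refine hne (hB.combination_eq_zero hL hlc hd (a := fun i => x⁻¹ *
      ((polyEmb F K p)⁻¹ * polyEmb F K (a i) - algebraMap K[X] (RatFunc K) (c i))) ?_)
    rw [smul_add, Finset.smul_sum]
    simp only [smul_smul, mul_inv_cancel_left₀ hne, sub_smul, Finset.sum_sub_distrib]
    rw [smul_add, Finset.smul_sum] at hc
    simp only [smul_smul] at hc
    rw [hx, sub_smul]
    rw [← sub_eq_zero] at hc
    rw [← neg_eq_zero, ← hc]
    abel
  rw [hx, sub_eq_zero, polyEmb_apply] at hx0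
  have h1 : p.map (algebraMap F K) * c d = 1 := by
    apply RatFunc.algebraMap_injective K
    rw [map_mul, ← hx0, map_one, ← polyEmb_apply, mul_inv_cancel₀ hp']
  have h2 := Polynomial.natDegree_eq_zero_of_isUnit (IsUnit.of_mul_eq_one _ h1)
  rwa [Polynomial.natDegree_map] at h2

theorem mem_spanUpTo_of_natDegree_eq_zero {B : ℕ → OpQuot K L} {d : ℕ} {p : F[X]} (hp : p ≠ 0)
    (hdeg : p.natDegree = 0) (a : ℕ → F[X]) :
    (polyEmb F K p)⁻¹ • (∑ i ∈ Finset.range d, polyEmb F K (a i) • B i + B d) ∈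
      spanUpTo B d := by
  obtain ⟨u, rfl⟩ := Polynomial.natDegree_eq_zero.mp hdeg
  have hinv : (polyEmb F K (C u))⁻¹ = polyEmb F K (C u⁻¹) := inv_eq_of_mul_eq_one_right (by
    rw [← map_mul, ← C_mul, mul_inv_cancel₀ (by simpa using hp), C_1, map_one])
  have hmem : ∀ (q : F[X]) (A : OpQuot K L), A ∈ spanUpTo B d → polyEmb F K q • A ∈ spanUpTo B d := by
    intro q A hA
    rw [polyEmb_apply, ← polynomial_smul_eq]
    exact Submodule.smul_mem _ _ hA
  have hB : ∀ i, i ≤ d → B i ∈ spanUpTo B d := fun i hi => Submodule.subset_span ⟨i, hi, rfl⟩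
  rw [hinv]
  exact hmem _ _ (Submodule.add_mem _
    (Submodule.sum_mem _ fun i hi => hmem _ _ (hB i (Finset.mem_range.mp hi).le)) (hB d le_rfl))

namespace IsAdmissible

variable {c c' : Config K L} {c₀ : RatFunc K} {lc : ℕ → RatFunc K}

/-- The denominator is the minimal polynomial over `F` of a point `α` at which a simple pole can be
introduced; it is not constant, so the new element lies outside the span. -/
theorem exists_update [IsAlgClosed K] (hι : IsThreshold ι) (hord : 0 < ord L)
    (hL : IsRegular K L) (h : IsAdmissible ι c c₀ lc) (hret : c.returned = false)
    (hpos : 0 < c.stage) (hne : (missing ι c.B c.stage).Nonempty) :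
    ∃ p c', IsUpdate ι p c c' := by
  obtain ⟨A, hA⟩ := hne
  obtain ⟨α, a, ha⟩ := exists_pole hι h.triangular h.lc_ne_zero h.integral h.stage_lt h.spanBelow hA
  have hα := h.aeval_eq_zero_of_pole hι hord hL h.stage_lt ha
  have hαint : IsIntegral F α := IsAlgebraic.isIntegral ⟨lead L, lead_ne_zero hord, hα⟩
  have hirr := minpoly.irreducible hαint
  obtain ⟨a', ha'⟩ := exists_rational_pole h.rational hirr (minpoly.aeval F α) ha
  refine ⟨minpoly F α, _, hret, hpos, hirr.ne_zero, a', _, ⟨⟨?_, ?_⟩, ?_⟩, rfl, rfl⟩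
  · exact isIntegralElement_of_poles hι h.integral h.stage_lt hirr ha'
  · obtain ⟨P, hP, -, hPA⟩ := exists_rep_combination h.triangular h.stage_lt
      (polyEmb F K (minpoly F α))⁻¹ fun i => polyEmb F K (a' i)
    exact ⟨P, hP, hPA⟩
  · intro hmem
    have := natDegree_eq_zero_of_mem_spanUpTo hL h.triangular h.lc_ne_zero h.stage_lt
      hirr.ne_zero hmem
    exact (minpoly.natDegree_pos hαint).ne' this

theorem exists_step [IsAlgClosed K] (hι : IsThreshold ι) (hord : 0 < ord L)
    (hL : IsRegular K L) (h : IsAdmissible ι c c₀ lc) (hret : c.returned = false) :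
    ∃ c', Step ι c c' := by
  by_cases hdone : 0 < c.stage → missing ι c.B c.stage = ∅
  · rcases Nat.lt_or_ge (c.stage + 1) (ord L) with hlt | hge
    · exact ⟨_, Or.inr (Or.inl ⟨⟨hret, hdone⟩, hlt, rfl⟩)⟩
    · exact ⟨_, Or.inr (Or.inr ⟨⟨hret, hdone⟩, le_antisymm h.stage_lt hge, rfl⟩)⟩
  · push Not at hdone
    obtain ⟨p, c', hu⟩ := h.exists_update hι hord hL hret hdone.1 hdone.2
    exact ⟨c', Or.inl ⟨p, hu⟩⟩

theorem natDegree_pos {p : F[X]} (hu : IsUpdate ι p c c') : 0 < p.natDegree := by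
  obtain ⟨-, -, hp, a, A, hA, rfl, -⟩ := hu
  exact Nat.pos_of_ne_zero fun h => hA.2 (mem_spanUpTo_of_natDegree_eq_zero hp h a)

theorem genWronskian_update (h : IsAdmissible ι c c₀ lc) {p : F[X]} (hu : IsUpdate ι p c c')
    {α : K} (b : Fin (ord L) → Solution L α) :
    expand α (polyEmb F K p) * genWronskian b c'.B = genWronskian b c.B := by
  obtain ⟨-, -, hp, a, A, -, hAeq, rfl⟩ := hu
  have htri := h.triangular.update (hAeq ▸ exists_rep_combination h.triangular h.stage_lt
    (polyEmb F K p)⁻¹ fun i => polyEmb F K (a i))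
  rw [genWronskian_eq h.triangular, genWronskian_eq htri, prod_update_mul lc h.stage_lt, ← mul_assoc,
    ← map_mul, mul_inv_cancel_left₀ (polyEmb_ne_zero hp)]

end IsAdmissible

/-! ### Strict decrease of the levels and termination -/

theorem IsUpdate.sum_wronskianLevel_lt {c c' : Config K L} {p : F[X]}
    (hu : IsUpdate ι p c c') {s : Finset K} (hs : ∃ γ ∈ s, aeval γ p = 0)
    (hlevel : ∀ α : K, wronskianLevel ι c'.B α + (p.map (algebraMap F K)).rootMultiplicity α =
        wronskianLevel ι c.B α) :
    ∑ α ∈ s, wronskianLevel ι c'.B α < ∑ α ∈ s, wronskianLevel ι c.B α := by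
  obtain ⟨γ, hγs, hγ⟩ := hs
  refine Finset.sum_lt_sum (fun α _ => (Nat.le_add_right _ _).trans_eq (hlevel α)) ⟨γ, hγs, ?_⟩
  rw [← hlevel γ]
  refine Nat.lt_add_of_pos_right ((Polynomial.rootMultiplicity_pos ?_).mpr ?_)
  · exact (Polynomial.map_ne_zero_iff (algebraMap F K).injective).mpr hu.2.2.1
  · rwa [Polynomial.IsRoot, Polynomial.eval_map_algebraMap]

/-- At a root of `p` the level drops by a positive amount, so it was not zero, and the point cannot
be ordinary. -/
theorem IsUpdate.exists_root [IsAlgClosed K] (hι : IsThreshold ι) (hord : 0 < ord L)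
    (hL : IsRegular K L) {c c' : Config K L} {c₀ : RatFunc K} {lc : ℕ → RatFunc K}
    (h : IsAdmissible ι c c₀ lc) {p : F[X]} (hu : IsUpdate ι p c c') :
    ∃ α : K, aeval α p = 0 ∧ aeval α (lead L) = 0 := by
  have hdeg : (p.map (algebraMap F K)).degree ≠ 0 := by
    rw [Polynomial.degree_map]
    exact (Polynomial.natDegree_pos_iff_degree_pos.mp (IsAdmissible.natDegree_pos hu)).ne'
  obtain ⟨α, hα⟩ := IsAlgClosed.exists_root _ hdeg
  refine ⟨α, by rwa [Polynomial.IsRoot, Polynomial.eval_map_algebraMap] at hα, ?_⟩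
  by_contra hne
  have h1 := (h.update hι hord hL hu).2 α
  rw [h.level_eq_zero α hne] at h1
  have h2 := (Polynomial.rootMultiplicity_pos
    ((Polynomial.map_ne_zero_iff (algebraMap F K).injective).mpr hu.2.2.1)).mpr hα
  omega

/-- The minimal polynomial of `α` divides both `p` and the leading coefficient, so the
representative of its roots in `Q` is also a root of `p`. Thus one point per conjugacy class detects
every update. -/
theorem IsRootSystem.exists_root {Q : Finset K} (hQ : IsRootSystem L Q) (hord : 0 < ord L)
    {p : F[X]} {α : K} (hp : aeval α p = 0) (hα : aeval α (lead L) = 0) :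
    ∃ γ ∈ Q, aeval γ p = 0 := by
  have hαint : IsIntegral F α := IsAlgebraic.isIntegral ⟨lead L, lead_ne_zero hord, hα⟩
  obtain ⟨γ, ⟨hγQ, hγ⟩, -⟩ := hQ.1 _ (minpoly.irreducible hαint) (minpoly.dvd F α hα)
  exact ⟨γ, hγQ, aeval_eq_zero_of_dvd_aeval_eq_zero (minpoly.dvd F α hp) hγ⟩

open scoped Classical in
/-- A natural number that decreases in every step of the algorithm. -/
def remaining (ι : ModInt F → ℕ → F) (c : Config K L) : ℕ :=
  ∑ α ∈ ((lead L).aroots K).toFinset, wronskianLevel ι c.B α + (ord L - c.stage) +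
    (if c.returned then 0 else 1)

/-- An update lowers the sum of levels and keeps the stage; a new stage lowers `ord L - stage`
without raising any level; the return is paid for by the last summand. -/
theorem Step.remaining_lt [IsAlgClosed K] (hι : IsThreshold ι) (hord : 0 < ord L)
    (hL : IsRegular K L) {c c' : Config K L} {c₀ : RatFunc K} {lc : ℕ → RatFunc K}
    (h : IsAdmissible ι c c₀ lc) (hs : Step ι c c') : remaining ι c' < remaining ι c := by
  classical
  rcases hs with ⟨p, hu⟩ | hn | hr
  · obtain ⟨α, hp, hα⟩ := hu.exists_root hι hord hL h
    have h1 := hu.sum_wronskianLevel_lt ⟨α, (mem_aroots_lead hord α).mpr hα, hp⟩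
      (h.update hι hord hL hu).2
    obtain ⟨hret, _, _, _, _, _, _, rfl⟩ := hu
    simp only [remaining, hret]
    exact Nat.add_lt_add_right (Nat.add_lt_add_right (by convert h1) _) _
  · have h1 := Finset.sum_le_sum (s := ((lead L).aroots K).toFinset) fun α _ =>
      (h.nextStage hι hord hL hn).2 α
    obtain ⟨⟨hret, -⟩, hlt, rfl⟩ := hn
    simp only [remaining, hret]
    refine Nat.add_lt_add_right (Nat.add_lt_add_of_le_of_lt (by convert h1) ?_) _
    omega
  · obtain ⟨⟨hret, -⟩, -, rfl⟩ := hr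
    simp [remaining, hret]

theorem not_exists_infinite_run [IsAlgClosed K] (hι : IsThreshold ι) (hord : 0 < ord L)
    (hL : IsRegular K L) :
    ¬ ∃ run : ℕ → Config K L, IsInitial ι L (run 0) ∧ ∀ n, Step ι (run n) (run (n + 1)) := by
  rintro ⟨run, h0, hrun⟩
  have hreach : ∀ n, Reachable ι (run n) := by
    intro n
    refine ⟨run 0, h0, ?_⟩
    induction n with
    | zero => exact Relation.ReflTransGen.refl
    | succ n ih => exact ih.tail (hrun n)
  have hlt : ∀ n, remaining ι (run (n + 1)) < remaining ι (run n) := fun n => by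
    obtain ⟨c₀, lc, h⟩ := (hreach n).exists_isAdmissible hι hord hL
    exact (hrun n).remaining_lt hι hord hL h
  have hle : ∀ n, remaining ι (run n) + n ≤ remaining ι (run 0) := by
    intro n
    induction n with
    | zero => rfl
    | succ n ih => have := hlt n; omega
  have := hle (remaining ι (run 0) + 1)
  omega

end Updates

end

end IntegralBasis

open IntegralBasis in
theorem mainTheorem2 {F K : Type*} [Field F] [CharZero F] [Field K] [IsAlgClosed K] [Algebra F K]
    (ι : ModInt F → ℕ → F) (hι : IsThreshold ι)
    (L : ℕ →₀ F[X]) (hord : 0 < ord L) (hL : IsRegular K L) :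
    -- every execution is finite and ends with a return
    (∃ c : Config K L, IsInitial ι L c) ∧
    (¬ ∃ run : ℕ → Config K L, IsInitial ι L (run 0) ∧ ∀ n, Step ι (run n) (run (n + 1))) ∧
    (∀ c : Config K L, Reachable ι c → c.returned = false → ∃ c', Step ι c c') ∧
    -- the basis elements and the generalized Wronskian in every configuration
    (∀ c : Config K L, Reachable ι c →
      (∀ i < ord L, IsIntegralElement ι (c.B i)) ∧
      (∃ g : RatFunc K, ∀ (α : K) (b : Fin (ord L) → Solution L α), IsFundamentalSystem b →
        genWronskian b c.B ≠ 0 ∧ D (genWronskian b c.B) = expand α g * genWronskian b c.B) ∧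
      ∀ (α : K) (b : Fin (ord L) → Solution L α), IsFundamentalSystem b →
        IsIntegralSeries ι (genWronskian b c.B) ∧
        (∀ (μ : F) (j : ℕ), j ≠ 0 → termCoeff (genWronskian b c.B) μ j = 0) ∧
        IsLeast (levels ι (genWronskian b c.B)) (wronskianLevel ι c.B α)) ∧
    -- updates of the current basis element
    (∀ (c c' : Config K L) (p : F[X]), Reachable ι c → IsUpdate ι p c c' →
      0 < p.natDegree ∧
      (∀ (α : K) (b : Fin (ord L) → Solution L α), IsFundamentalSystem b →
        expand α (polyEmb F K p) * genWronskian b c'.B = genWronskian b c.B) ∧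
      (∀ α : K, wronskianLevel ι c'.B α + (p.map (algebraMap F K)).rootMultiplicity α =
        wronskianLevel ι c.B α) ∧
      ∀ Q : Finset K, IsRootSystem L Q →
        ∑ α ∈ Q, wronskianLevel ι c'.B α < ∑ α ∈ Q, wronskianLevel ι c.B α) ∧
    -- transitions between the stages
    (∀ c c' : Config K L, Reachable ι c → IsNextStage ι c c' →
      ∀ α : K, wronskianLevel ι c'.B α ≤ wronskianLevel ι c.B α) := by
  refine ⟨exists_isInitial hι hord hL, not_exists_infinite_run hι hord hL, fun c hc hret => ?_,
    fun c hc => ⟨?_, ?_, fun α b hb => ⟨?_, fun μ j hj => ?_, ?_⟩⟩,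
    fun c c' p hc hu => ⟨?_, fun α b _ => ?_, ?_, fun Q hQ => ?_⟩, fun c c' hc hn => ?_⟩ <;>
  obtain ⟨c₀, lc, h⟩ := hc.exists_isAdmissible hι hord hL
  · exact h.exists_step hι hord hL hret
  · exact h.integral
  · obtain ⟨g, hg⟩ := D_genWronskian hord h.triangular h.lc_ne_zero
    exact ⟨g, fun α b hb => ⟨genWronskian_ne_zero h.triangular h.lc_ne_zero hb, hg α b⟩⟩
  · exact isIntegralSeries_genWronskian hι (fun i hi => h.integral i hi α) hb
  · rw [termCoeff, Polynomial.coeff_eq_zero_of_natDegree_lt, HahnSeries.coeff_zero]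
    rw [natDegree_genWronskian hord h.triangular h.lc_ne_zero hb]
    exact Nat.pos_of_ne_zero hj
  · exact isLeast_wronskianLevel hι hord h.triangular h.lc_ne_zero
      (fun i hi => h.integral i hi α) hb
  · exact IsAdmissible.natDegree_pos hu
  · exact h.genWronskian_update hu b
  · exact (h.update hι hord hL hu).2
  · obtain ⟨α, hp, hα⟩ := hu.exists_root hι hord hL h
    exact hu.sum_wronskianLevel_lt (hQ.exists_root hord hp hα) (h.update hι hord hL hu).2
  · exact (h.nextStage hι hord hL hn).2
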